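/- **Setting.** Let $n\ge 1$, let $B_+$ (resp. $B_-$) be the group of upper (resp. lower) triangular matrices in $\mathrm{GL}_n(\mathbb C)$, $U_\pm\subset B_\pm$ the unipotent ones, $H=B_+\cap B_-$ the diagonal matrices. Identify the Weyl group with $S_n$ (generated by the adjacent transpositions $s_i=(i\ i{+}1)$, where $w\in S_n$ is represented by the permutation matrix $e_j\mapsto e_{w(j)}$). For $u,v\in S_n$ put $\mathrm{GL}_n^{u,v}=B_+uB_+\cap B_-vB_-$. "Generic $x\in \mathrm{GL}_n^{u,v}$" means: all $x$ in a Zariski open dense subset of $\mathrm{GL}_n^{u,v}$. Let $e_i=\exp E_{i,i+1}$, $e_{-i}=\exp E_{i+1,i}$ ($1\le i\le n-1$), let $h^j(X)$ ($0\le j\le n$, $X\in\mathbb C^*$) be the diagonal matrix with first $j$ entries $X$ and the others $1$, let $\overline{s_i}=e_i^{-1}e_{-i}e_i^{-1}$, and $\overline w=\overline{s_{i(1)}}\cdots\overline{s_{i(l)}}$ for any reduced word $(i(1),\dots,i(l))$ of $w$. Write $y=[y]_-[y]_0[y]_+$ for the Gaussian decomposition of $y\in U_-HU_+$. $\Delta^{I,J}(x)$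 is the minor of $x$ with rows $I$ and columns $J$ ($\Delta^{\emptyset,\emptyset}=1$, and $\Delta^{I,J}=0$ if $|I|\ne|J|$). **The bipartite graph.** Let $\mathbf i=(i(1),\dots,i(l))$ be a reduced word of $(u,v)$: a sequence in $\{\pm1,\dots,\pm(n-1)\}$ whose negative entries, with the signs deleted, form a reduced word of $u$, and whose positive entries form a reduced word of $v$. Draw $n$ horizontal lines, numbered from the top, and from left to right, for $k=1,\dots,l$, a vertical edge between lines $|i(k)|$ and $|i(k)|+1$, with white upper and black lower end if $i(k)>0$, and black upper and white lower end if $i(k)<0$. On each line insert a vertex of the opposite colour between any two neighbouring vertices of the same colour, and add a white vertex at each end of the line that does not already end with one. This gives the bipartite graph $\Gamma_{\mathbf i}$, with $n$ external edges on each side; a face lies in the $j$th spacing if it lies just below line $j$ ($0\le j\le n$; the top face is in spacing $0$, the bottom face in spacing $n$). *Zig-zag strands* travel next to the edges, turning left at each white vertex and right at each black vertex. One right-going strand starts at each left external edge, just above it; one left-going strand starts at each right external edge, just below it. Strands are labelled by the line of the external edge where they start. For a face $f$ (resp. a white vertex $\omega$) let $I(f),J(f)$ (resp. $I(\omega),J(\omega)$)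 be the sets of labels of the right-going and the left-going strands below which $f$ (resp. $\omega$) lies; one has $|I(f)|=|J(f)|$ and $|I(\omega)|=|J(\omega)|+1$. **The maps.** $\tilde\psi_{\mathbf i}:\mathrm{GL}_n^{u,v}\dashrightarrow(\mathbb C^*)^{\text{faces}}$ is $x\mapsto(A_f(x))_f$ with $A_f(x)=\Delta^{I(f),J(f)}(x)$, defined where all $A_f(x)\neq0$. The quiver on the set of faces has a counterclockwise $3$-cycle around each $3$-valent black vertex, with $2$-cycles removed; let $\epsilon_{fg}$ be the number of arrows $f\to g$ minus the number of arrows $g\to f$, and let $\tilde p_{\mathbf i}:(\mathbb C^*)^{\text{faces}}\to(\mathbb C^*)^{\text{faces}}$, $X_f=\prod_gA_g^{\epsilon_{fg}}$. Finally $\tilde\chi_{\mathbf i}:(\mathbb C^*)^{\text{faces}}\to\mathrm{GL}_n$ sends $(X_f)$ to the product, from left to right over $\Gamma_{\mathbf i}$, of $h^j(X_f)$ for each face $f$ in the $j$th spacing and $e_{i(k)}$ for each vertical edge (this is well defined since $h^j$ commutes with $e_{\pm i}$ for $i\neq j$). **The dual vectors.** Let $V$ be an $n$-dimensional complex vector space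 with basis $a_1,\dots,a_n$ and dual basis $\alpha_1,\dots,\alpha_n$ of $V^*$. For $x\in\mathrm{GL}_n$ let $b_i=\sum_kx_{ki}a_k$. For a white vertex $\omega$ define $\xi_\omega\in V^*$ by $$\langle\xi_\omega,y\rangle=\Big\langle\bigwedge_{i\in I(\omega)}\alpha_i,\ \Big(\bigwedge_{j\in J(\omega)}b_j\Big)\wedge y\Big\rangle\qquad(y\in V),$$ the wedge products being taken in ascending order and $\langle\phi_1\wedge\dots\wedge\phi_m,y_1\wedge\dots\wedge y_m\rangle=\det(\phi_i(y_j))$. Let $\xi_i$ (resp. $\eta_i$) be $\xi_\omega$ for the far left (resp. far right) white vertex $\omega$ of line $i$. **Statement.** For generic $x\in\mathrm{GL}_n^{u,v}$, all $A_f(x)$ are non-zero, $(\xi_1,\dots,\xi_n)$ and $(\eta_1,\dots,\eta_n)$ are bases of $V^*$, and $\tilde\chi_{\mathbf i}\circ\tilde p_{\mathbf i}\circ\tilde\psi_{\mathbf i}(x)$ is the unique $g\in\mathrm{GL}_n$ with $$(\xi_1,\dots,\xi_n)\,g=(\eta_1,\dots,\eta_n),\qquad\text{i.e. }\ \eta_j=\sum_ig_{ij}\xi_i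 .$$ Moreover $\overline u^{-1}x$ and $x\overline{v^{-1}}$ have Gaussian decompositions, and $$\tilde\chi_{\mathbf i}\circ\tilde p_{\mathbf i}\circ\tilde\psi_{\mathbf i}(x)=D\left(\left[\overline u^{-1}x\right]_-^{-1}\,\overline u^{-1}\,x\,\overline{v^{-1}}\,\left[x\overline{v^{-1}}\right]_+^{-1}\right)^tD'$$ for some invertible diagonal matrices $D,D'$ (which may depend on $x$). -/

import Mathlib

open scoped MatrixGroups

noncomputable section

namespace DoubleBruhat

/-! ### The group, its Weyl group and double Bruhat cells

Lines, rows and columns are numbered from `0`, so `i : Fin (n - 1)` stands for the simple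
reflection exchanging the positions `i` and `i + 1`. -/

/-- The first of the two positions exchanged by the `i`th simple reflection. -/
def topIdx {n : ℕ} (i : Fin (n - 1)) : Fin n := ⟨i.1, by omega⟩

/-- The second of the two positions exchanged by the `i`th simple reflection. -/
def botIdx {n : ℕ} (i : Fin (n - 1)) : Fin n := ⟨i.1 + 1, by omega⟩

theorem topIdx_ne_botIdx {n : ℕ} (i : Fin (n - 1)) : topIdx i ≠ botIdx i := by
  simp [topIdx, botIdx, Fin.ext_iff]

/-- The adjacent transposition `s_i`. -/
def simpleReflection {n : ℕ} (i : Fin (n - 1)) : Equiv.Perm (Fin n) :=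
  Equiv.swap (topIdx i) (botIdx i)

/-- `a` is a word of minimal length among the words in the simple reflections with product `w`. -/
def IsReducedWord {n : ℕ} (a : List (Fin (n - 1))) (w : Equiv.Perm (Fin n)) : Prop :=
  (a.map simpleReflection).prod = w ∧
    ∀ a' : List (Fin (n - 1)), (a'.map simpleReflection).prod = w → a.length ≤ a'.length

/-- The permutation matrix of `w`: it sends the basis vector `e_j` to `e_{w j}`. -/
def permMat {n : ℕ} (w : Equiv.Perm (Fin n)) : Matrix (Fin n) (Fin n) ℂ :=
  Matrix.of fun i j => if i = w j then 1 else 0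

/-- `B_+`: invertible upper triangular matrices. -/
def IsUpper {n : ℕ} (b : GL (Fin n) ℂ) : Prop := ∀ i j : Fin n, j < i → b.1 i j = 0

/-- `B_-`: invertible lower triangular matrices. -/
def IsLower {n : ℕ} (b : GL (Fin n) ℂ) : Prop := ∀ i j : Fin n, i < j → b.1 i j = 0

/-- The double Bruhat cell `B_+ u B_+ ∩ B_- v B_-`. -/
def cell {n : ℕ} (u v : Equiv.Perm (Fin n)) : Set (GL (Fin n) ℂ) :=
  {x | (∃ b b' : GL (Fin n) ℂ, IsUpper b ∧ IsUpper b' ∧ x.1 = b.1 * permMat u * b'.1) ∧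
    ∃ c c' : GL (Fin n) ℂ, IsLower c ∧ IsLower c' ∧ x.1 = c.1 * permMat v * c'.1}

/-- `x = m * h * p` is the Gaussian decomposition of `x`: `m` is unipotent lower triangular, `h`
is diagonal and `p` is unipotent upper triangular. -/
def IsGaussian {n : ℕ} (x m h p : GL (Fin n) ℂ) : Prop :=
  (IsLower m ∧ ∀ i, m.1 i i = 1) ∧ h.1.IsDiag ∧ (IsUpper p ∧ ∀ i, p.1 i i = 1) ∧ x = m * h * p

/-- Zariski closed subsets of `GL_n`, as the zero loci of polynomials in the matrix entries. -/
def IsZariskiClosed {n : ℕ} (Z : Set (GL (Fin n) ℂ)) : Prop :=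
  ∃ I : Set (MvPolynomial (Fin n × Fin n) ℂ),
    Z = {x | ∀ P ∈ I, MvPolynomial.eval (fun ij => x.1 ij.1 ij.2) P = 0}

/-- `p` holds for a generic point of `S`: there is a Zariski open set `U` such that `S ∩ U` is
Zariski dense in `S` and `p` holds on `S ∩ U`. -/
def Generically {n : ℕ} (S : Set (GL (Fin n) ℂ)) (p : GL (Fin n) ℂ → Prop) : Prop :=
  ∃ U : Set (GL (Fin n) ℂ), IsZariskiClosed Uᶜ ∧
    (∀ Z : Set (GL (Fin n) ℂ), IsZariskiClosed Z → S ∩ U ⊆ Z → S ⊆ Z) ∧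
    ∀ x ∈ S ∩ U, p x

/-- The elementary matrix `1 + E_{i,j} = exp E_{i,j}`, `i ≠ j`. -/
def elem {n : ℕ} (i j : Fin n) (h : i ≠ j) : GL (Fin n) ℂ where
  val := Matrix.transvection i j 1
  inv := Matrix.transvection i j (-1)
  val_inv := by rw [Matrix.transvection_mul_transvection_same i j h]; simp
  inv_val := by rw [Matrix.transvection_mul_transvection_same i j h]; simp

/-- `e_i = exp E_{i,i+1}`. -/
def ePos {n : ℕ} (i : Fin (n - 1)) : GL (Fin n) ℂ :=
  elem (topIdx i) (botIdx i) (topIdx_ne_botIdx i)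

/-- `e_{-i} = exp E_{i+1,i}`. -/
def eNeg {n : ℕ} (i : Fin (n - 1)) : GL (Fin n) ℂ :=
  elem (botIdx i) (topIdx i) (topIdx_ne_botIdx i).symm

/-- `h^j(X)`: the diagonal matrix whose first `j` diagonal entries are `X`, the others `1`. -/
def hMat {n : ℕ} (j : ℕ) (X : ℂˣ) : GL (Fin n) ℂ where
  val := Matrix.diagonal fun k => if k.1 < j then (X : ℂ) else 1
  inv := Matrix.diagonal fun k => if k.1 < j then ((X⁻¹ : ℂˣ) : ℂ) else 1
  val_inv := by
    rw [Matrix.diagonal_mul_diagonal, ← Matrix.diagonal_one]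
    congr 1; ext k; split_ifs <;> simp
  inv_val := by
    rw [Matrix.diagonal_mul_diagonal, ← Matrix.diagonal_one]
    congr 1; ext k; split_ifs <;> simp

/-- The lift `e_i⁻¹ e_{-i} e_i⁻¹` of `s_i`. -/
def sBar {n : ℕ} (i : Fin (n - 1)) : GL (Fin n) ℂ := (ePos i)⁻¹ * eNeg i * (ePos i)⁻¹

/-- The product of the lifts of the letters of a word. On a reduced word of `w` it is the lift of
`w` to `GL_n`, which does not depend on the reduced word. -/
def wordLift {n : ℕ} (a : List (Fin (n - 1))) : GL (Fin n) ℂ := (a.map sBar).prod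

/-! ### Reduced words of pairs and their bipartite graphs -/

/-- A letter `± i`: the number `i` and whether the sign is positive. -/
structure Letter (n : ℕ) where
  idx : Fin (n - 1)
  pos : Bool

/-- A reduced word of the pair `(u, v)`: the negative letters spell a reduced word of `u` and the
positive letters one of `v`. -/
def IsReducedPair {n : ℕ} (w : List (Letter n)) (u v : Equiv.Perm (Fin n)) : Prop :=
  IsReducedWord ((w.filter fun a => !a.pos).map Letter.idx) u ∧
    IsReducedWord ((w.filter fun a => a.pos).map Letter.idx) v

/-- The two colours of vertices. -/
inductive Colour
  | white
  | black
  deriving DecidableEq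

/-- The other colour. -/
def Colour.opp : Colour → Colour
  | .white => .black
  | .black => .white

/-- The vertical edge of a letter `± i` joins the lines `i` and `i + 1` (lines are counted from the
top). For a positive letter its upper end is white and its lower end is black, for a negative
letter it is the other way round. This is the colour of its end on the line `r`, if there is one. -/
def endColour {n : ℕ} (a : Letter n) (r : Fin n) : Option Colour :=
  if r = topIdx a.idx then some (if a.pos then .white else .black)
  else if r = botIdx a.idx then some (if a.pos then .black else .white)
  else none

/-- The colours, from left to right, of the ends of vertical edges on the line `r`. -/
def lineColours {n : ℕ} (w : List (Letter n)) (r : Fin n) : List Colour :=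
  w.filterMap fun a => endColour a r

/-- The bipartite graph of the word `w` is drawn on `n` horizontal lines, with the vertical edge of
the letter `w[k]` at the abscissa `2 k + 1`. This is the colour of the vertex at the abscissa `x` on
the line `r`, if there is a vertex. At odd abscissas these are the ends of the vertical edges. A
vertex of the opposite colour is put between two neighbouring ends of the same colour (just to the
right of the first of them). A white vertex is put at the left end (`x = 0`) of a line that does not
start with a white vertex, and at the right end (`x = 2 * w.length`) of a line whose last vertex is
not white. -/
def vertexColour {n : ℕ} (w : List (Letter n)) (x : ℕ) (r : Fin n) : Option Colour :=
  if x = 0 then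
    if (lineColours w r).head? = some .white then none else some .white
  else if x % 2 = 1 then (w[x / 2]?).bind fun a => endColour a r
  else if x = 2 * w.length then
    if (lineColours w r).getLast? = some .black then some .white else none
  else
    match (w[x / 2 - 1]?).bind (fun a => endColour a r), (lineColours (w.drop (x / 2)) r).head? with
    | some c, some c' => if c = c' then some c.opp else none
    | _, _ => none

/-! ### Zig-zag strands -/

/-- The directions in which a strand can travel next to an edge. -/
inductive Heading
  | east
  | north
  | west
  | south

/-- A left turn. -/
def Heading.left : Heading → Heading
  | .east => .north
  | .north => .west
  | .west => .south
  | .south => .east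

/-- A right turn. -/
def Heading.right : Heading → Heading
  | .east => .south
  | .south => .west
  | .west => .north
  | .north => .east

/-- The letter whose vertical edge is at the abscissa `x`, if there is one. -/
def letterAt {n : ℕ} (w : List (Letter n)) (x : ℕ) : Option (Letter n) :=
  if x % 2 = 1 then w[x / 2]? else none

/-- Whether an edge (possibly an external one) leaves the point at the abscissa `x` of the line `r`
in the given direction. -/
def hasEdge {n : ℕ} (w : List (Letter n)) (x : ℕ) (r : Fin n) : Heading → Bool
  | .east => true
  | .west => true
  | .north => (letterAt w x).any fun a => decide (r = botIdx a.idx)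
  | .south => (letterAt w x).any fun a => decide (r = topIdx a.idx)

/-- The heading of a strand after the point `(x, r)`, which it reaches with the heading `d`: it
takes the leftmost edge at a white vertex, the rightmost edge at a black vertex, and goes straight
on where there is no vertex. -/
def turn {n : ℕ} (w : List (Letter n)) (x : ℕ) (r : Fin n) (d : Heading) : Heading :=
  match vertexColour w x r with
  | none => d
  | some .white =>
    if hasEdge w x r d.left then d.left else if hasEdge w x r d then d else d.right
  | some .black =>
    if hasEdge w x r d.right then d.right else if hasEdge w x r d then d else d.left

/-- How a strand crosses the abscissa `x`, coming along a horizontal line: it turns at the vertex on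
that line, and if this leads it into the vertical edge, it turns again at the other end. A strand is
recorded by the line along which it travels and its heading. -/
def crossing {n : ℕ} (w : List (Letter n)) (x : ℕ) (s : Fin n × Heading) : Fin n × Heading :=
  match letterAt w x, turn w x s.1 s.2 with
  | some a, .south => (botIdx a.idx, turn w x (botIdx a.idx) .south)
  | some a, .north => (topIdx a.idx, turn w x (topIdx a.idx) .north)
  | _, d => (s.1, d)

/-- The zig-zag strand that starts at the `i`th external edge on the left, recorded in the gap
between the abscissas `x - 1` and `x`. (The gap `0` carries the external edges on the left, the gap
`2 * w.length + 1` those on the right.) It travels just above its line. -/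
def rightStrand {n : ℕ} (w : List (Letter n)) (i : Fin n) : ℕ → Fin n × Heading
  | 0 => (i, .east)
  | x + 1 => crossing w x (rightStrand w i x)

/-- The zig-zag strand that starts at the `j`th external edge on the right, recorded in the gap
between the abscissas `2 * w.length - y` and `2 * w.length + 1 - y`. -/
def leftStrandAux {n : ℕ} (w : List (Letter n)) (j : Fin n) : ℕ → Fin n × Heading
  | 0 => (j, .west)
  | y + 1 => crossing w (2 * w.length - y) (leftStrandAux w j y)

/-- The zig-zag strand that starts at the `j`th external edge on the right, recorded in the gap
between the abscissas `x - 1` and `x`. It travels just below its line. -/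
def leftStrand {n : ℕ} (w : List (Letter n)) (j : Fin n) (x : ℕ) : Fin n × Heading :=
  leftStrandAux w j (2 * w.length + 1 - x)

/-! ### Faces, dominating sets and the quiver -/

/-- The spacing of a letter `± i`. The spacing `j` lies between the `j`th line and the next one,
where in this count the first line is line `1`; spacing `0` is above all lines and spacing `n` below
all lines. -/
def Letter.spacing {n : ℕ} (a : Letter n) : Fin (n + 1) := ⟨a.idx.1 + 1, by omega⟩

/-- The faces. In each spacing `j` from `0` to `n` there is a leftmost face `Sum.inl j`, and to the
right of each vertical edge `k` there is the face `Sum.inr k` of the same spacing, which reaches to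
the next vertical edge of that spacing. -/
abbrev Face {n : ℕ} (w : List (Letter n)) := Fin (n + 1) ⊕ Fin w.length

/-- The spacing in which a face lies. -/
def faceSpacing {n : ℕ} (w : List (Letter n)) : Face w → Fin (n + 1)
  | .inl j => j
  | .inr k => (w[k]).spacing

/-- The leftmost gap of abscissas that a face meets. -/
def faceGap {n : ℕ} (w : List (Letter n)) : Face w → ℕ
  | .inl _ => 0
  | .inr k => 2 * k.1 + 2

/-- `I(f)`: the right-going strands above `f`. A strand changes from one side of the spacing of `f`
to the other only at the vertical edges in that spacing, hence not along `f`, so that it is enough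
to look at the leftmost gap of `f`. A strand that travels along the line just below `f`, or along a
lower line, does not dominate `f`, one on a higher line does. -/
def faceI {n : ℕ} (w : List (Letter n)) (f : Face w) : Finset (Fin n) :=
  Finset.univ.filter fun i => (rightStrand w i (faceGap w f)).1.1 < (faceSpacing w f).1

/-- `J(f)`: the left-going strands above `f`. -/
def faceJ {n : ℕ} (w : List (Letter n)) (f : Face w) : Finset (Fin n) :=
  Finset.univ.filter fun j => (leftStrand w j (faceGap w f)).1.1 < (faceSpacing w f).1

/-- `I(ω)` for the white vertex `ω` at the abscissa `x` of the line `r`: the right-going strands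
above it. As strands follow the edges around a white vertex on one side, this can be read off along
the horizontal edge on the left of `ω`. A right-going strand on the line of `ω` passes above it. -/
def vertexI {n : ℕ} (w : List (Letter n)) (x : ℕ) (r : Fin n) : Finset (Fin n) :=
  Finset.univ.filter fun i => (rightStrand w i x).1 ≤ r

/-- `J(ω)`: the left-going strands above the white vertex `ω` at the abscissa `x` of the line `r`. A
left-going strand on the line of `ω` passes below it. -/
def vertexJ {n : ℕ} (w : List (Letter n)) (x : ℕ) (r : Fin n) : Finset (Fin n) :=
  Finset.univ.filter fun j => (leftStrand w j x).1 < r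

/-- The face of the spacing `j` at the abscissas just before the vertical edge `k`. -/
def faceBefore {n : ℕ} (w : List (Letter n)) : ℕ → Fin (n + 1) → Face w
  | 0, j => .inl j
  | k + 1, j =>
    if h : k < w.length then
      if (w[k]).spacing = j then .inr ⟨k, h⟩ else faceBefore w k j
    else faceBefore w k j

/-- The three faces around the black end of the vertical edge `k`, in counterclockwise order. The
black end of a positive letter is the lower one, so that the faces are those on the left of the
edge, below the edge and on the right of the edge. The black end of a negative letter is the upper
one, and the faces are those above the edge, on its left and on its right. -/
def blackCycle {n : ℕ} (w : List (Letter n)) (k : Fin w.length) : Face w × Face w × Face w :=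
  if (w[k]).pos then
    (faceBefore w k (w[k]).spacing, faceBefore w k ⟨(w[k]).idx.1 + 2, by omega⟩, .inr k)
  else
    (faceBefore w k ⟨(w[k]).idx.1, by omega⟩, faceBefore w k (w[k]).spacing, .inr k)

/-- The number of arrows from `f` to `g` in the union of the counterclockwise 3-cycles around the
3-valent black vertices. -/
def arrows {n : ℕ} (w : List (Letter n)) (f g : Face w) : ℕ :=
  ∑ k : Fin w.length,
    ((if f = (blackCycle w k).1 ∧ g = (blackCycle w k).2.1 then 1 else 0) +
      (if f = (blackCycle w k).2.1 ∧ g = (blackCycle w k).2.2 then 1 else 0) +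
      (if f = (blackCycle w k).2.2 ∧ g = (blackCycle w k).1 then 1 else 0))

/-- The exchange matrix of the quiver (the difference accounts for the removal of 2-cycles). -/
def exchange {n : ℕ} (w : List (Letter n)) (f g : Face w) : ℤ := (arrows w f g : ℤ) - arrows w g f

/-! ### The three maps -/

/-- The minor with rows `I` and columns `J`, which is `0` if `I` and `J` differ in size. -/
def minor {n : ℕ} (x : GL (Fin n) ℂ) (I J : Finset (Fin n)) : ℂ :=
  if h : J.card = I.card then
    (x.1.submatrix (I.orderEmbOfFin rfl) (J.orderEmbOfFin h)).det
  else 0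

/-- The function `A_f`. -/
def faceMinor {n : ℕ} (w : List (Letter n)) (x : GL (Fin n) ℂ) (f : Face w) : ℂ :=
  minor x (faceI w f) (faceJ w f)

/-- The rational map `ψ̃`, with values in the torus `(ℂˣ)^{faces}`, at a point where it is defined. -/
def psiMap {n : ℕ} (w : List (Letter n)) (x : GL (Fin n) ℂ) (hx : ∀ f, faceMinor w x f ≠ 0) :
    Face w → ℂˣ :=
  fun f => Units.mk0 (faceMinor w x f) (hx f)

/-- The map `p̃`: `X_f = ∏_g A_g ^ ε_{fg}`. -/
def pMap {n : ℕ} (w : List (Letter n)) (A : Face w → ℂˣ) : Face w → ℂˣ :=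
  fun f => ∏ g, A g ^ exchange w f g

/-- The map `χ̃`. Going from left to right over the graph, it multiplies a factor `h^j(X_f)` for each
face `f` in the spacing `j` and a factor `e_{±i}` for each vertical edge. Here the factor of a face
stands as far left as possible, which does not matter since `h^j` commutes with `e_{±i}` for
`i ≠ j`. -/
def chiMap {n : ℕ} (w : List (Letter n)) (X : Face w → ℂˣ) : GL (Fin n) ℂ :=
  (List.ofFn fun j : Fin (n + 1) => hMat j.1 (X (.inl j))).prod *
    (List.ofFn fun k : Fin w.length =>
      (if (w[k]).pos then ePos (w[k]).idx else eNeg (w[k]).idx) *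
        hMat (w[k]).spacing.1 (X (.inr k))).prod

/-! ### The dual vectors -/

section Dual

variable {V : Type*} [AddCommGroup V] [Module ℂ V]

/-- The contraction of `⋀_{i ∈ I} α_i` by `⋀_{j ∈ J} b_j` (with ascending indices), that is
`v ↦ ⟨⋀_{i ∈ I} α_i, (⋀_{j ∈ J} b_j) ∧ v⟩`, where `I` has one element more than `J`. -/
def contraction {n : ℕ} (α : Fin n → Module.Dual ℂ V) (b : Fin n → V) (I J : Finset (Fin n)) :
    Module.Dual ℂ V :=
  if h : I.card = J.card + 1 then
    exteriorPower.pairingDual ℂ V (J.card + 1)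
        (exteriorPower.ιMulti ℂ (J.card + 1) fun k => α (I.orderEmbOfFin h k)) ∘ₗ
      (exteriorPower.ιMulti ℂ (J.card + 1) (M := V)).toMultilinearMap.toLinearMap
        (Fin.snoc (fun k => b (J.orderEmbOfFin rfl k)) 0) (Fin.last J.card)
  else 0

/-- The basis `{a_i}.x`, that is `b_i = ∑_k x_{k i} a_k`. -/
def translate {n : ℕ} (a : Module.Basis (Fin n) ℂ V) (x : GL (Fin n) ℂ) (i : Fin n) : V :=
  ∑ k, x.1 k i • a k

/-- The dual vector `ξ_ω` of the white vertex `ω` at the abscissa `x'` of the line `r`. -/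
def xiVertex {n : ℕ} (w : List (Letter n)) (a : Module.Basis (Fin n) ℂ V) (x : GL (Fin n) ℂ)
    (x' : ℕ) (r : Fin n) : Module.Dual ℂ V :=
  contraction a.coord (translate a x) (vertexI w x' r) (vertexJ w x' r)

/-- The abscissa of the white vertex on the far left of the line `r`. -/
def farLeft {n : ℕ} (w : List (Letter n)) (r : Fin n) : ℕ :=
  sInf {x | vertexColour w x r = some .white}

/-- The abscissa of the white vertex on the far right of the line `r`. -/
def farRight {n : ℕ} (w : List (Letter n)) (r : Fin n) : ℕ :=
  sSup {x | vertexColour w x r = some .white}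

/-- `ξ_1, …, ξ_n`. -/
def xi {n : ℕ} (w : List (Letter n)) (a : Module.Basis (Fin n) ℂ V) (x : GL (Fin n) ℂ)
    (r : Fin n) : Module.Dual ℂ V :=
  xiVertex w a x (farLeft w r) r

/-- `η_1, …, η_n`. -/
def eta {n : ℕ} (w : List (Letter n)) (a : Module.Basis (Fin n) ℂ V) (x : GL (Fin n) ℂ)
    (r : Fin n) : Module.Dual ℂ V :=
  xiVertex w a x (farRight w r) r

/-- The vectors `ξ_i` form a basis. -/
def IsBasis {n : ℕ} (ξ : Fin n → Module.Dual ℂ V) : Prop :=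
  LinearIndependent ℂ ξ ∧ Submodule.span ℂ (Set.range ξ) = ⊤

/-- `(ξ_1, …, ξ_n) g = (η_1, …, η_n)`. -/
def TakesTo {n : ℕ} (g : GL (Fin n) ℂ) (ξ η : Fin n → Module.Dual ℂ V) : Prop :=
  ∀ j, ∑ i, g.1 i j • ξ i = η j

end Dual

end DoubleBruhat

end

/-! Solving the turning rules shows that the labels of the strands above a point form the image of
an initial segment. After `k` letters the row labels come from `uPre w k`, the product of the
negative letters already passed. The column labels come from the inverse of `vSuf w k`, the product
of the positive letters still to come. So each `A_f` and each `ξ_ω` depends only on a gap `k` and on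
a spacing or line, and `xiAt w a x k` interpolates between the `ξ_r` (at `k = 0`) and the `η_r` (at
`k = w.length`).

Passing a vertical edge changes only the vector on the line of its black end. The new vector is a
combination of the old vectors on the two lines of the edge, with ratios of the minors of the three
faces around the black vertex as coefficients. This is a three-term Plücker relation
(`contraction_insert_col`, `contraction_insert_row`). Reducedness of the word orders the two
exchanged labels, and this order makes both signs positive. The step is therefore an elementary
matrix between factors `h^j` of ratios of face minors (`takesTo_pos`, `takesTo_neg`), and these
ratios are what the 3-cycle around the black vertex contributes to `p̃`. The factor of the last face
in a spacing can be moved to the right end of the partial product, so the steps multiply to `χ̃ ∘ p̃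
∘ ψ̃ (x)` (`takesTo_chiPart`).

For the twist, let `Ξ` and `E` be the coordinate matrices of the `ξ_r` and the `η_r`, so that `g =
Ξ⁻¹ E`. Since `ξ_ω` kills `a_s` for `s ∉ I(ω)` and `b_j` for `j ∈ J(ω)`, the matrices `Ξ` and `P_u⁻¹
E` are upper triangular, while `P_v xᵗ Ξ` and `xᵗ E` are lower triangular. The diagonal entries of
`Ξ` are, up to sign, minors of leftmost faces, hence `Ξ` and `E` are invertible. Splitting `x` as
`E⁻ᵗ · Eᵗ x` and as `Ξ⁻ᵗ · Ξᵗ x` gives both Gaussian decompositions, and the twist becomes `Eᵗ Ξ⁻ᵗ`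
up to diagonal factors (`exists_gaussian`).

All of this holds wherever no `A_f` vanishes. Such points are dense because each `A_f` is non-zero
somewhere on the cell (`exists_mem_cell_faceMinor_ne_zero`) and the cell, a polynomial image of a
principal open set in an affine space, is irreducible (`cell_irreducible`). -/

noncomputable section

namespace DoubleBruhat

/-! ### Reduced words -/

variable {n : ℕ}

/-- The product of the simple reflections spelled by a word. -/
def spell (a : List (Fin (n - 1))) : Equiv.Perm (Fin n) := (a.map simpleReflection).prod

@[simp] theorem spell_nil : spell ([] : List (Fin (n - 1))) = 1 := rfl

@[simp] theorem spell_cons (i : Fin (n - 1)) (a : List (Fin (n - 1))) :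
    spell (i :: a) = simpleReflection i * spell a := by simp [spell]

@[simp] theorem spell_append (a b : List (Fin (n - 1))) : spell (a ++ b) = spell a * spell b := by
  simp [spell]

@[simp] theorem simpleReflection_inv (i : Fin (n - 1)) :
    (simpleReflection i)⁻¹ = simpleReflection i := Equiv.swap_inv _ _

theorem spell_reverse (a : List (Fin (n - 1))) : spell a.reverse = (spell a)⁻¹ := by
  induction a with
  | nil => simp
  | cons i a ih => simp [ih]

@[simp] theorem simpleReflection_topIdx (i : Fin (n - 1)) :
    simpleReflection i (topIdx i) = botIdx i := Equiv.swap_apply_left _ _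

@[simp] theorem simpleReflection_botIdx (i : Fin (n - 1)) :
    simpleReflection i (botIdx i) = topIdx i := Equiv.swap_apply_right _ _

theorem simpleReflection_of_ne {i : Fin (n - 1)} {r : Fin n} (h₁ : r ≠ topIdx i)
    (h₂ : r ≠ botIdx i) : simpleReflection i r = r := Equiv.swap_apply_of_ne_of_ne h₁ h₂

/-- The two positions exchanged are adjacent, so no third element lies between them and theirs is
the only pair whose order is reversed. -/
theorem simpleReflection_lt {i : Fin (n - 1)} {r s : Fin n} (h : r < s)
    (h' : ¬ (r = topIdx i ∧ s = botIdx i)) : simpleReflection i r < simpleReflection i s := by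
  have key : ∀ t : Fin n, (simpleReflection i t).1 =
      if t.1 = i.1 then i.1 + 1 else if t.1 = i.1 + 1 then i.1 else t.1 := by
    intro t
    rcases eq_or_ne t (topIdx i) with rfl | h₁
    · simp; simp [topIdx, botIdx]
    rcases eq_or_ne t (botIdx i) with rfl | h₂
    · simp; simp [topIdx, botIdx]
    rw [simpleReflection_of_ne h₁ h₂]
    simp only [topIdx, botIdx, ne_eq, Fin.ext_iff] at h₁ h₂
    simp [h₁, h₂]
  rw [Fin.lt_def] at h ⊢
  simp only [topIdx, botIdx, Fin.ext_iff, not_and] at h'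
  rw [key, key]
  split_ifs <;> omega

/-- The exchange property. -/
theorem exists_spell_eq_mul_swap (a : List (Fin (n - 1))) {p q : Fin n} (hpq : p < q)
    (h : spell a q < spell a p) :
    ∃ a' : List (Fin (n - 1)), a'.length + 1 = a.length ∧
      spell a' = spell a * Equiv.swap p q := by
  induction a with
  | nil => exact absurd h (by simpa using hpq.le)
  | cons i a ih =>
    by_cases h' : spell a q < spell a p
    · obtain ⟨a', hl, ha'⟩ := ih h'
      exact ⟨i :: a', by simp [hl], by simp [ha', mul_assoc]⟩
    · have hlt : spell a p < spell a q :=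
        lt_of_le_of_ne (not_lt.1 h') fun e => hpq.ne ((spell a).injective e)
      -- The first letter reverses the order of the two values, so they are the pair it exchanges.
      -- Deleting that letter then amounts to multiplying by the transposition on the right.
      have hi : spell a p = topIdx i ∧ spell a q = botIdx i := by
        by_contra hc
        exact absurd (simpleReflection_lt hlt hc) (by simpa using h.le)
      refine ⟨a, by simp, ?_⟩
      have : simpleReflection i = spell a * Equiv.swap p q * (spell a)⁻¹ := by
        rw [Equiv.mul_swap_eq_swap_mul, hi.1, hi.2, mul_inv_cancel_right]; rfl
      rw [spell_cons, this]
      simp [mul_assoc]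

/-- Otherwise the exchange property absorbs `i` into a word one letter shorter than `b`, which
shortens the whole word by two letters. -/
theorem IsReducedWord.lt_of_eq_append {a b c : List (Fin (n - 1))} {i : Fin (n - 1)}
    {w : Equiv.Perm (Fin n)} (ha : IsReducedWord a w) (h : a = b ++ i :: c) :
    spell b (topIdx i) < spell b (botIdx i) := by
  by_contra hc
  have hlt : topIdx i < botIdx i := by simp [topIdx, botIdx, Fin.lt_def]
  have h' : spell b (botIdx i) < spell b (topIdx i) :=
    lt_of_le_of_ne (not_lt.1 hc) fun e => hlt.ne' ((spell b).injective e)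
  obtain ⟨b', hl, hb'⟩ := exists_spell_eq_mul_swap b hlt h'
  have := ha.2 (b' ++ c) (by
    rw [← ha.1, h]
    change spell (b' ++ c) = spell (b ++ i :: c)
    rw [spell_append, hb', spell_append, spell_cons, mul_assoc]
    rfl)
  rw [h] at this
  simp at this
  omega

theorem IsReducedWord.reverse {a : List (Fin (n - 1))} {w : Equiv.Perm (Fin n)}
    (ha : IsReducedWord a w) : IsReducedWord a.reverse w⁻¹ := by
  refine ⟨?_, fun a' h => ?_⟩
  · rw [← ha.1]; exact spell_reverse a
  · have := ha.2 a'.reverse (by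
      change spell _ = _
      rw [spell_reverse]
      exact inv_eq_iff_eq_inv.2 h)
    simpa using this

theorem IsReducedWord.inv_lt_of_eq_append {a b c : List (Fin (n - 1))} {i : Fin (n - 1)}
    {w : Equiv.Perm (Fin n)} (ha : IsReducedWord a w) (h : a = b ++ i :: c) :
    (spell c)⁻¹ (topIdx i) < (spell c)⁻¹ (botIdx i) := by
  rw [← spell_reverse]
  exact ha.reverse.lt_of_eq_append (c := b.reverse) (by simp [h])

/-! ### Partial products of the negative and the positive letters. -/

/-- The negative letters of a word, with the signs deleted. -/
def negWord (w : List (Letter n)) : List (Fin (n - 1)) :=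
  (w.filter fun a => !a.pos).map Letter.idx

/-- The positive letters of a word. -/
def posWord (w : List (Letter n)) : List (Fin (n - 1)) :=
  (w.filter fun a => a.pos).map Letter.idx

/-- The permutation spelled by the negative ones among the first `k` letters. -/
def uPre (w : List (Letter n)) (k : ℕ) : Equiv.Perm (Fin n) := spell (negWord (w.take k))

/-- The permutation spelled by the positive letters from the `k`th on. -/
def vSuf (w : List (Letter n)) (k : ℕ) : Equiv.Perm (Fin n) := spell (posWord (w.drop k))

theorem uPre_zero (w : List (Letter n)) : uPre w 0 = 1 := by simp [uPre, negWord]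

theorem vSuf_of_length_le (w : List (Letter n)) {k : ℕ} (h : w.length ≤ k) : vSuf w k = 1 := by
  simp [vSuf, posWord, List.drop_eq_nil_of_le h]

theorem negWord_append (a b : List (Letter n)) : negWord (a ++ b) = negWord a ++ negWord b := by
  simp [negWord]

theorem posWord_append (a b : List (Letter n)) : posWord (a ++ b) = posWord a ++ posWord b := by
  simp [posWord]

theorem negWord_cons (c : Letter n) (b : List (Letter n)) :
    negWord (c :: b) = if c.pos then negWord b else c.idx :: negWord b := by
  rcases hp : c.pos <;> simp [negWord, hp]

theorem posWord_cons (c : Letter n) (b : List (Letter n)) :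
    posWord (c :: b) = if c.pos then c.idx :: posWord b else posWord b := by
  rcases hp : c.pos <;> simp [posWord, hp]

theorem uPre_succ {w : List (Letter n)} {k : ℕ} (h : k < w.length) :
    uPre w (k + 1) = uPre w k * spell (negWord [w[k]]) := by
  rw [uPre, uPre, ← List.take_concat_get' _ _ h, negWord_append, spell_append]

theorem uPre_succ_of_pos {w : List (Letter n)} {k : ℕ} (h : k < w.length) (hp : w[k].pos = true) :
    uPre w (k + 1) = uPre w k := by
  rw [uPre_succ h, negWord_cons, if_pos hp]
  exact mul_one _

theorem uPre_succ_of_neg {w : List (Letter n)} {k : ℕ} (h : k < w.length) (hp : w[k].pos = false) :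
    uPre w (k + 1) = uPre w k * simpleReflection w[k].idx := by
  rw [uPre_succ h, negWord_cons, hp]
  exact congrArg (uPre w k * ·) (mul_one _)

theorem vSuf_of_neg {w : List (Letter n)} {k : ℕ} (h : k < w.length) (hp : w[k].pos = false) :
    vSuf w k = vSuf w (k + 1) := by
  rw [vSuf, List.drop_eq_getElem_cons h, posWord_cons, hp]; rfl

theorem vSuf_of_pos {w : List (Letter n)} {k : ℕ} (h : k < w.length) (hp : w[k].pos = true) :
    vSuf w k = simpleReflection w[k].idx * vSuf w (k + 1) := by
  rw [vSuf, List.drop_eq_getElem_cons h, posWord_cons, if_pos hp, spell_cons]; rfl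

theorem uPre_lt {u v : Equiv.Perm (Fin n)} {w : List (Letter n)} (hw : IsReducedPair w u v)
    {k : ℕ} (h : k < w.length) (hp : w[k].pos = false) :
    uPre w k (topIdx w[k].idx) < uPre w k (botIdx w[k].idx) := by
  refine hw.1.lt_of_eq_append (b := negWord (w.take k)) (c := negWord (w.drop (k + 1))) ?_
  change negWord w = _
  conv_lhs => rw [← List.take_append_drop k w, List.drop_eq_getElem_cons h]
  rw [negWord_append, negWord_cons, hp]
  rfl

theorem vSuf_lt {u v : Equiv.Perm (Fin n)} {w : List (Letter n)} (hw : IsReducedPair w u v)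
    {k : ℕ} (h : k < w.length) (hp : w[k].pos = true) :
    (vSuf w (k + 1))⁻¹ (topIdx w[k].idx) < (vSuf w (k + 1))⁻¹ (botIdx w[k].idx) := by
  refine hw.2.inv_lt_of_eq_append (b := posWord (w.take k)) (c := posWord (w.drop (k + 1))) ?_
  change posWord w = _
  conv_lhs => rw [← List.take_append_drop k w, List.drop_eq_getElem_cons h]
  rw [posWord_append, posWord_cons, if_pos hp]

/-! ### Strands -/

theorem letterAt_even (w : List (Letter n)) (k : ℕ) : letterAt w (2 * k) = none := by
  simp [letterAt]

theorem letterAt_odd (w : List (Letter n)) (k : ℕ) : letterAt w (2 * k + 1) = w[k]? := by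
  have h₁ : (2 * k + 1) % 2 = 1 := by omega
  have h₂ : (2 * k + 1) / 2 = k := by omega
  simp [letterAt, h₁, h₂]

theorem vertexColour_odd (w : List (Letter n)) {k : ℕ} (h : k < w.length) (r : Fin n) :
    vertexColour w (2 * k + 1) r = endColour w[k] r := by
  have h₁ : (2 * k + 1) % 2 = 1 := by omega
  have h₂ : (2 * k + 1) / 2 = k := by omega
  simp [vertexColour, h₁, h₂, h]

/-- No vertical edge stands at an even abscissa, so a vertex there has only its two horizontal edges
and every strand goes straight on. -/
theorem crossing_even (w : List (Letter n)) (k : ℕ) (r : Fin n) {d : Heading}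
    (hd : d = .east ∨ d = .west) : crossing w (2 * k) (r, d) = (r, d) := by
  have ht : turn w (2 * k) r d = d := by
    rcases hd with rfl | rfl <;>
    simp only [turn, hasEdge, letterAt_even, Heading.left, Heading.right] <;>
    rcases vertexColour w (2 * k) r with _ | _ | _ <;> simp
  simp [crossing, letterAt_even, ht]

/-- Seen by an eastbound strand, the vertical edge lies on the right at its upper end and on the
left at its lower end. The strand enters it exactly when the upper end is black and the lower end
white, that is for a negative letter, and the vertex at the other end turns it east again. -/
theorem crossing_odd_east (w : List (Letter n)) {k : ℕ} (h : k < w.length) (r : Fin n) :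
    crossing w (2 * k + 1) (r, .east) =
      (if w[k].pos then r else simpleReflection w[k].idx r, .east) := by
  have hne := topIdx_ne_botIdx w[k].idx
  rcases hp : w[k].pos <;> by_cases h₁ : r = topIdx w[k].idx <;>
    by_cases h₂ : r = botIdx w[k].idx <;>
    simp_all [crossing, turn, hasEdge, letterAt_odd, vertexColour_odd, endColour, Heading.left,
      Heading.right, simpleReflection_of_ne, hne.symm]

/-- For a westbound strand left and right are exchanged, so that now the positive letters are
followed across. -/
theorem crossing_odd_west (w : List (Letter n)) {k : ℕ} (h : k < w.length) (r : Fin n) :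
    crossing w (2 * k + 1) (r, .west) =
      (if w[k].pos then simpleReflection w[k].idx r else r, .west) := by
  have hne := topIdx_ne_botIdx w[k].idx
  rcases hp : w[k].pos <;> by_cases h₁ : r = topIdx w[k].idx <;>
    by_cases h₂ : r = botIdx w[k].idx <;>
    simp_all [crossing, turn, hasEdge, letterAt_odd, vertexColour_odd, endColour, Heading.left,
      Heading.right, simpleReflection_of_ne, hne.symm]

theorem rightStrand_eq (w : List (Letter n)) (i : Fin n) (x : ℕ) (hx : x ≤ 2 * w.length + 1) :
    rightStrand w i x = ((uPre w (x / 2))⁻¹ i, .east) := by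
  induction x with
  | zero => simp [rightStrand, uPre_zero]
  | succ x ih =>
    rw [rightStrand, ih (by omega)]
    rcases Nat.even_or_odd' x with ⟨k, rfl | rfl⟩
    · rw [crossing_even _ _ _ (Or.inl rfl)]
      congr 4; omega
    · have hk : k < w.length := by omega
      have h₁ : (2 * k + 1) / 2 = k := by omega
      have h₂ : (2 * k + 1 + 1) / 2 = k + 1 := by omega
      rw [crossing_odd_east _ hk, h₁, h₂]
      rcases hp : w[k].pos
      · simp [uPre_succ_of_neg hk hp]
      · simp [uPre_succ_of_pos hk hp]

theorem leftStrandAux_eq (w : List (Letter n)) (j : Fin n) (y : ℕ) (hy : y ≤ 2 * w.length + 1) :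
    leftStrandAux w j y = (vSuf w ((2 * w.length + 1 - y) / 2) j, .west) := by
  induction y with
  | zero =>
    rw [vSuf_of_length_le _ (by omega)]; rfl
  | succ y ih =>
    rw [leftStrandAux, ih (by omega)]
    obtain ⟨x, hx⟩ : ∃ x, 2 * w.length - y = x := ⟨_, rfl⟩
    have hx' : 2 * w.length + 1 - y = x + 1 := by omega
    have hx'' : 2 * w.length + 1 - (y + 1) = x := by omega
    rw [hx, hx', hx'']
    rcases Nat.even_or_odd' x with ⟨k, rfl | rfl⟩
    · rw [crossing_even _ _ _ (Or.inr rfl)]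
      congr 3; omega
    · have hk : k < w.length := by omega
      have h₁ : (2 * k + 1) / 2 = k := by omega
      have h₂ : (2 * k + 1 + 1) / 2 = k + 1 := by omega
      rw [crossing_odd_west _ hk, h₁, h₂]
      rcases hp : w[k].pos
      · simp [vSuf_of_neg hk hp]
      · simp [vSuf_of_pos hk hp]

theorem leftStrand_eq (w : List (Letter n)) (j : Fin n) (x : ℕ) (hx : x ≤ 2 * w.length + 1) :
    leftStrand w j x = (vSuf w (x / 2) j, .west) := by
  rw [leftStrand, leftStrandAux_eq _ _ _ (by omega)]
  congr 3; omega

/-! ### Dominating sets -/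

/-- The set of the images of the first `j` elements under `σ`. -/
def initSet (σ : Equiv.Perm (Fin n)) (j : ℕ) : Finset (Fin n) :=
  Finset.univ.filter fun i => (σ⁻¹ i).1 < j

theorem mem_initSet {σ : Equiv.Perm (Fin n)} {j : ℕ} {i : Fin n} :
    i ∈ initSet σ j ↔ (σ⁻¹ i).1 < j := by simp [initSet]

theorem initSet_succ (σ : Equiv.Perm (Fin n)) (r : Fin n) :
    initSet σ (r.1 + 1) = insert (σ r) (initSet σ r.1) := by
  ext i
  simp only [mem_initSet, Finset.mem_insert, ← Equiv.Perm.inv_eq_iff_eq, Nat.lt_succ_iff_lt_or_eq]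
  rw [Fin.ext_iff]
  tauto

theorem notMem_initSet (σ : Equiv.Perm (Fin n)) (r : Fin n) : σ r ∉ initSet σ r.1 := by
  simp [mem_initSet]

theorem card_initSet (σ : Equiv.Perm (Fin n)) {j : ℕ} (hj : j ≤ n) : (initSet σ j).card = j := by
  induction j with
  | zero => simp [initSet]
  | succ j ih =>
    have := initSet_succ σ ⟨j, hj⟩
    simp only at this
    rw [this, Finset.card_insert_of_notMem (notMem_initSet σ ⟨j, hj⟩), ih (by omega)]

/-- The image of the first `j` elements sees `s_i` only if the cut falls between the two positions
that `s_i` exchanges. -/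
theorem initSet_mul_simpleReflection (σ : Equiv.Perm (Fin n)) (i : Fin (n - 1)) {j : ℕ}
    (hj : j ≠ i.1 + 1) : initSet (σ * simpleReflection i) j = initSet σ j := by
  ext t
  simp only [mem_initSet, mul_inv_rev, simpleReflection_inv, Equiv.Perm.mul_apply]
  generalize σ⁻¹ t = s
  rcases eq_or_ne s (topIdx i) with rfl | h₁
  · simp; simp [topIdx, botIdx]; omega
  rcases eq_or_ne s (botIdx i) with rfl | h₂
  · simp; simp [topIdx, botIdx]; omega
  rw [simpleReflection_of_ne h₁ h₂]

/-- The number of letters to the left of the left end of a face. -/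
def faceTime (w : List (Letter n)) : Face w → ℕ
  | .inl _ => 0
  | .inr k => k.1 + 1

theorem faceGap_eq (w : List (Letter n)) (f : Face w) : faceGap w f = 2 * faceTime w f := by
  rcases f with f | k <;> simp [faceGap, faceTime]; omega

theorem faceTime_le (w : List (Letter n)) (f : Face w) : faceTime w f ≤ w.length := by
  rcases f with f | k <;> simp [faceTime]

theorem faceI_eq (w : List (Letter n)) (f : Face w) :
    faceI w f = initSet (uPre w (faceTime w f)) (faceSpacing w f) := by
  have := faceTime_le w f
  ext i
  rw [faceI, mem_initSet, Finset.mem_filter, faceGap_eq, rightStrand_eq _ _ _ (by omega)]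
  simp

theorem faceJ_eq (w : List (Letter n)) (f : Face w) :
    faceJ w f = initSet (vSuf w (faceTime w f))⁻¹ (faceSpacing w f) := by
  have := faceTime_le w f
  ext i
  rw [faceJ, mem_initSet, Finset.mem_filter, faceGap_eq, leftStrand_eq _ _ _ (by omega)]
  simp

theorem vertexI_eq (w : List (Letter n)) {x : ℕ} (hx : x ≤ 2 * w.length + 1) (r : Fin n) :
    vertexI w x r = initSet (uPre w (x / 2)) (r.1 + 1) := by
  ext i
  rw [vertexI, mem_initSet, Finset.mem_filter, rightStrand_eq _ _ _ hx]
  simp only [Finset.mem_univ, true_and, Nat.lt_succ_iff]; rfl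

theorem vertexJ_eq (w : List (Letter n)) {x : ℕ} (hx : x ≤ 2 * w.length + 1) (r : Fin n) :
    vertexJ w x r = initSet (vSuf w (x / 2))⁻¹ r.1 := by
  ext i
  rw [vertexJ, mem_initSet, Finset.mem_filter, leftStrand_eq _ _ _ hx]
  simp only [Finset.mem_univ, true_and, inv_inv]; rfl

/-- The row set of the minor of the face that lies in the spacing `j` after `k` letters. -/
def rowSet (w : List (Letter n)) (k j : ℕ) : Finset (Fin n) := initSet (uPre w k) j

/-- The column set of the minor of the face that lies in the spacing `j` after `k` letters. -/
def colSet (w : List (Letter n)) (k j : ℕ) : Finset (Fin n) := initSet (vSuf w k)⁻¹ j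

theorem rowSet_succ {w : List (Letter n)} {k j : ℕ} (h : k < w.length)
    (hj : w[k].pos = true ∨ j ≠ w[k].idx.1 + 1) : rowSet w (k + 1) j = rowSet w k j := by
  unfold rowSet
  rcases hp : w[k].pos
  · rw [uPre_succ_of_neg h hp, initSet_mul_simpleReflection _ _ (by simpa [hp] using hj)]
  · rw [uPre_succ_of_pos h hp]

theorem colSet_succ {w : List (Letter n)} {k j : ℕ} (h : k < w.length)
    (hj : w[k].pos = false ∨ j ≠ w[k].idx.1 + 1) : colSet w (k + 1) j = colSet w k j := by
  unfold colSet
  rcases hp : w[k].pos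
  · rw [vSuf_of_neg h hp]
  · rw [vSuf_of_pos h hp, mul_inv_rev, simpleReflection_inv,
      initSet_mul_simpleReflection _ _ (by simpa [hp] using hj)]

theorem spacing_val (a : Letter n) : a.spacing.1 = a.idx.1 + 1 := rfl

theorem faceSpacing_faceBefore (w : List (Letter n)) (k : ℕ) (j : Fin (n + 1)) :
    faceSpacing w (faceBefore w k j) = j := by
  induction k with
  | zero => rfl
  | succ k ih =>
    rw [faceBefore]
    split_ifs with h h'
    · exact h'
    · exact ih
    · exact ih

/-- Along a face no vertical edge of its spacing is passed, and only such edges change its label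
sets. Hence `A_f` can be read off in any gap that the face meets, not only in its leftmost one. -/
theorem sets_faceTime_faceBefore (w : List (Letter n)) (k : ℕ) (hk : k ≤ w.length)
    (j : Fin (n + 1)) :
    rowSet w (faceTime w (faceBefore w k j)) j = rowSet w k j ∧
      colSet w (faceTime w (faceBefore w k j)) j = colSet w k j := by
  induction k with
  | zero => simp [faceBefore, faceTime]
  | succ k ih =>
    have hk' : k < w.length := hk
    rw [faceBefore, dif_pos hk']
    split_ifs with h'
    · simp [faceTime]
    · have hne : j.1 ≠ w[k].idx.1 + 1 := fun e => h' (Fin.ext e.symm)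
      rw [rowSet_succ hk' (.inr hne), colSet_succ hk' (.inr hne)]
      exact ih hk'.le

/-- The minor of the face that lies in the spacing `j` after `k` letters. -/
def minorAt (w : List (Letter n)) (x : GL (Fin n) ℂ) (k j : ℕ) : ℂ :=
  minor x (rowSet w k j) (colSet w k j)

theorem faceMinor_eq (w : List (Letter n)) (x : GL (Fin n) ℂ) (f : Face w) :
    faceMinor w x f = minorAt w x (faceTime w f) (faceSpacing w f) := by
  rw [faceMinor, faceI_eq, faceJ_eq]; rfl

theorem faceMinor_faceBefore (w : List (Letter n)) (x : GL (Fin n) ℂ) {k : ℕ} (hk : k ≤ w.length)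
    (j : Fin (n + 1)) : faceMinor w x (faceBefore w k j) = minorAt w x k j := by
  rw [faceMinor_eq, faceSpacing_faceBefore, minorAt, minorAt,
    (sets_faceTime_faceBefore w k hk j).1, (sets_faceTime_faceBefore w k hk j).2]

theorem faceMinor_inr (w : List (Letter n)) (x : GL (Fin n) ℂ) (k : Fin w.length) :
    faceMinor w x (.inr k) = minorAt w x (k + 1) (w[k].idx + 1) := by
  rw [faceMinor_eq]; rfl

/-! ### The white vertices at the ends of a line -/

section Dual

variable {V : Type*} [AddCommGroup V] [Module ℂ V]

/-- The dual vector of the white vertices on the line `r` next to the gap after `k` letters. -/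
def xiAt (w : List (Letter n)) (a : Module.Basis (Fin n) ℂ V) (x : GL (Fin n) ℂ) (k : ℕ)
    (r : Fin n) : Module.Dual ℂ V :=
  contraction a.coord (translate a x) (rowSet w k (r.1 + 1)) (colSet w k r.1)

theorem xiVertex_eq (w : List (Letter n)) (a : Module.Basis (Fin n) ℂ V) (x : GL (Fin n) ℂ)
    {y : ℕ} (hy : y ≤ 2 * w.length + 1) (r : Fin n) :
    xiVertex w a x y r = xiAt w a x (y / 2) r := by
  rw [xiVertex, vertexI_eq _ hy, vertexJ_eq _ hy]; rfl

/-- A positive letter changes only the columns in spacing `i + 1`, which enter the vector of the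
lower line; a negative letter changes only the rows there, which enter the vector of the upper line.
In both cases this is the line of the black end. -/
theorem xiAt_succ {w : List (Letter n)} (a : Module.Basis (Fin n) ℂ V) (x : GL (Fin n) ℂ) {k : ℕ}
    (hk : k < w.length) {r : Fin n} (h : endColour w[k] r ≠ some .black) :
    xiAt w a x (k + 1) r = xiAt w a x k r := by
  have hne := topIdx_ne_botIdx w[k].idx
  rw [xiAt, xiAt, rowSet_succ hk, colSet_succ hk]
  · rcases hp : w[k].pos
    · exact .inl rfl
    · right
      rintro e
      apply h
      have : r = botIdx w[k].idx := Fin.ext e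
      simp [endColour, hp, this, hne.symm]
  · rcases hp : w[k].pos
    · right
      rintro e
      apply h
      have : r = topIdx w[k].idx := Fin.ext (by simpa [topIdx] using e)
      simp [endColour, hp, this]
    · exact .inl rfl

theorem xiAt_eq_of_forall {w : List (Letter n)} (a : Module.Basis (Fin n) ℂ V) (x : GL (Fin n) ℂ)
    {k l : ℕ} (hkl : k ≤ l) (hl : l ≤ w.length) {r : Fin n}
    (h : ∀ m (hm : m < w.length), k ≤ m → m < l → endColour w[m] r ≠ some .black) :
    xiAt w a x l r = xiAt w a x k r := by
  induction l, hkl using Nat.le_induction with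
  | base => rfl
  | succ l hkl ih =>
    rw [xiAt_succ a x hl (h l hl hkl (Nat.lt_succ_self l)),
      ih (by omega) fun m hm h₁ h₂ => h m hm h₁ (by omega)]

theorem vertexColour_eq_none {w : List (Letter n)} {x : ℕ} (hx : 2 * w.length < x) (r : Fin n) :
    vertexColour w x r = none := by
  have h0 : x ≠ 0 := by omega
  have h1 : x ≠ 2 * w.length := by omega
  rw [vertexColour, if_neg h0, if_neg h1]
  split_ifs with h
  · rw [List.getElem?_eq_none (by omega)]; rfl
  · rw [List.getElem?_eq_none (by omega)]; rfl

theorem exists_of_head_lineColours {w : List (Letter n)} {r : Fin n} {c : Colour}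
    (h : (lineColours w r).head? = some c) :
    ∃ k, ∃ hk : k < w.length, endColour w[k] r = some c ∧
      ∀ m (hm : m < w.length), m < k → endColour w[m] r = none := by
  induction w with
  | nil => simp [lineColours] at h
  | cons b w ih =>
    rcases hb : endColour b r with _ | d
    · have : (lineColours w r).head? = some c := by simpa [lineColours, hb] using h
      obtain ⟨k, hk, h₁, h₂⟩ := ih this
      refine ⟨k + 1, by simpa using hk, by simpa using h₁, fun m hm hmk => ?_⟩
      rcases m with _ | m
      · simpa using hb
      · simpa using h₂ m (by simpa using hm) (by omega)
    · refine ⟨0, by simp, ?_, fun m hm hmk => absurd hmk (by omega)⟩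
      simpa [lineColours, hb] using h

theorem exists_of_getLast_lineColours {w : List (Letter n)} {r : Fin n} {c : Colour}
    (h : (lineColours w r).getLast? = some c) :
    ∃ k, ∃ hk : k < w.length, endColour w[k] r = some c ∧
      ∀ m (hm : m < w.length), k < m → endColour w[m] r = none := by
  induction w using List.reverseRecOn with
  | nil => simp [lineColours] at h
  | append_singleton w b ih =>
    rcases hb : endColour b r with _ | d
    · have : (lineColours w r).getLast? = some c := by simpa [lineColours, hb] using h
      obtain ⟨k, hk, h₁, h₂⟩ := ih this
      refine ⟨k, by simp; omega, by simpa [List.getElem_append_left hk] using h₁,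
        fun m hm hmk => ?_⟩
      rcases Nat.lt_or_ge m w.length with hm' | hm'
      · simpa [List.getElem_append_left hm'] using h₂ m hm' hmk
      · simpa [List.getElem_append_right hm'] using hb
    · refine ⟨w.length, by simp, ?_, fun m hm hmk => ?_⟩
      · simpa [lineColours, hb] using h
      · simp at hm; omega

theorem endColour_eq_none_of_lineColours_eq_nil {w : List (Letter n)} {r : Fin n}
    (h : lineColours w r = []) (m : ℕ) (hm : m < w.length) : endColour w[m] r = none := by
  rw [lineColours, List.filterMap_eq_nil_iff] at h
  exact h _ (List.getElem_mem hm)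

/-- Either the line begins with a white end, before which it meets no vertical edge, or its far left
white vertex was added at abscissa `0`. -/
theorem xi_eq (w : List (Letter n)) (a : Module.Basis (Fin n) ℂ V) (x : GL (Fin n) ℂ)
    (r : Fin n) : xi w a x r = xiAt w a x 0 r := by
  by_cases h : (lineColours w r).head? = some .white
  · obtain ⟨k, hk, h₁, h₂⟩ := exists_of_head_lineColours h
    have hle : farLeft w r ≤ 2 * k + 1 :=
      Nat.sInf_le (by rw [Set.mem_ofPred_eq, vertexColour_odd w hk, h₁])
    rw [xi, xiVertex_eq _ _ _ (by omega)]
    refine xiAt_eq_of_forall a x (by omega) (by omega) fun m hm _ hm' => ?_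
    rw [h₂ m hm (by omega)]; simp
  · have : farLeft w r = 0 := by
      apply Nat.eq_zero_of_le_zero
      apply Nat.sInf_le
      simp [vertexColour, h]
    rw [xi, this, xiVertex_eq _ _ _ (by omega)]

/-- No black end lies to the right of the far right white vertex: after a last black end a white
vertex is added at the right end of the line. -/
theorem eta_eq (w : List (Letter n)) (a : Module.Basis (Fin n) ℂ V) (x : GL (Fin n) ℂ)
    (r : Fin n) : eta w a x r = xiAt w a x w.length r := by
  have hb : ∀ y ∈ {y | vertexColour w y r = some .white}, y ≤ 2 * w.length := by
    intro y hy
    by_contra hc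
    rw [Set.mem_ofPred_eq, vertexColour_eq_none (not_le.1 hc)] at hy
    simp at hy
  have hle : farRight w r ≤ 2 * w.length := csSup_le' hb
  have hge : ∀ y, vertexColour w y r = some .white → y ≤ farRight w r :=
    fun y hy => le_csSup ⟨_, hb⟩ hy
  rw [eta, xiVertex_eq _ _ _ (by omega)]
  refine (xiAt_eq_of_forall a x (by omega) le_rfl fun m hm h₁ _ => ?_).symm
  rcases hl : (lineColours w r).getLast? with _ | _ | _
  · rw [List.getLast?_eq_none_iff] at hl
    rw [endColour_eq_none_of_lineColours_eq_nil hl]; simp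
  · obtain ⟨k, hk, h₂, h₃⟩ := exists_of_getLast_lineColours hl
    have := hge (2 * k + 1) (by rw [vertexColour_odd w hk, h₂])
    rcases (show k ≤ m by omega).eq_or_lt with rfl | hkm
    · rw [h₂]; simp
    · rw [h₃ m hm hkm]; simp
  · have := hge (2 * w.length) (by
      have h0 : w.length ≠ 0 := by omega
      simp [vertexColour, h0, hl])
    omega

end Dual

end DoubleBruhat

namespace DoubleBruhat

/-! ### Three-term relations between minors -/

section Minors

variable {R : Type*} [CommRing R] {m n : ℕ}

/-- The determinant with the columns `C` on the rows `ρ`. -/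
def colDet (ρ : Fin m → Fin n) (C : Fin m → Fin n → R) : R :=
  (Matrix.of fun t s => C t (ρ s)).det

theorem det_snoc (C : Fin m → Fin (m + 1) → R) (y : Fin (m + 1) → R) :
    (Matrix.of (Fin.snoc (α := fun _ => Fin (m + 1) → R) C y)).det =
      (-1) ^ m * (Matrix.of (Matrix.vecCons y C)).det := by
  have := Matrix.det_permute (finRotate (m + 1)) (Matrix.of (Matrix.vecCons y C))
  rw [sign_finRotate] at this
  rw [Fin.snoc_eq_cons_rotate]
  refine Eq.trans ?_ (this.trans (by push_cast; rfl))
  rfl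

theorem det_vecCons_swap (C : Fin m → Fin (m + 2) → R) (y z : Fin (m + 2) → R) :
    (Matrix.of (Matrix.vecCons y (Matrix.vecCons z C))).det =
      -(Matrix.of (Matrix.vecCons z (Matrix.vecCons y C))).det := by
  have := Matrix.det_permute (Equiv.swap 0 1) (Matrix.of (Matrix.vecCons z (Matrix.vecCons y C)))
  rw [Equiv.Perm.sign_swap (by simp)] at this
  simp only [Units.val_neg, Units.val_one, Int.cast_neg, Int.cast_one, neg_mul, one_mul] at this
  rw [← this]
  congr 1
  ext i j
  refine Fin.cases ?_ (fun i => Fin.cases ?_ (fun i => ?_) i) i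
  · simp
  · simp
  · have h : Equiv.swap (0 : Fin (m + 2)) 1 i.succ.succ = i.succ.succ :=
      Equiv.swap_apply_of_ne_of_ne (Fin.succ_ne_zero _) (by simp [Fin.ext_iff])
    simp [h]

/-- The three-term Plücker relation. -/
theorem det_plucker (J : Fin m → Fin (m + 2) → R) (e b c y : Fin (m + 2) → R) :
    (Matrix.of (Matrix.vecCons e (Matrix.vecCons b J))).det *
        (Matrix.of (Matrix.vecCons y (Matrix.vecCons c J))).det =
      (Matrix.of (Matrix.vecCons e (Matrix.vecCons c J))).det *
          (Matrix.of (Matrix.vecCons y (Matrix.vecCons b J))).det -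
        (Matrix.of (Matrix.vecCons b (Matrix.vecCons c J))).det *
          (Matrix.of (Matrix.vecCons y (Matrix.vecCons e J))).det := by
  set M : Matrix (Fin (m + 2)) (Fin (m + 2)) R :=
    Matrix.of (Matrix.vecCons e (Matrix.vecCons b J)) with hM
  -- Cramer's rule expands `y` in the rows `e`, `b`, `J` of `M`. The linear form `z ↦ det (z, c,
  -- J)`, applied to this expansion, kills the rows from `J` and leaves three terms.
  have key : M.det • y = ∑ t, (M.updateRow t y).det • M t := by
    have := Matrix.mulVec_cramer M.transpose y
    rw [Matrix.det_transpose] at this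
    rw [← this]
    ext s
    simp only [Matrix.mulVec, dotProduct, Matrix.transpose_apply, Finset.sum_apply,
      Pi.smul_apply, smul_eq_mul, Matrix.cramer_transpose_apply, mul_comm]
  let ℓ := (Matrix.detRowAlternating (R := R) (n := Fin (m + 2))).toMultilinearMap.toLinearMap
    (Matrix.vecCons 0 (Matrix.vecCons c J)) 0
  have hℓ : ∀ z, ℓ z = (Matrix.of (Matrix.vecCons z (Matrix.vecCons c J))).det := fun z =>
    congrArg Matrix.det (Fin.update_cons_zero (α := fun _ => Fin (m + 2) → R) _ _ _)
  have h := congrArg ℓ key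
  rw [map_smul, map_sum] at h
  simp only [map_smul] at h
  simp only [hℓ, Fin.sum_univ_succ, smul_eq_mul] at h
  rw [h, Finset.sum_eq_zero, add_zero]
  · have h₀ : M.updateRow 0 y = Matrix.of (Matrix.vecCons y (Matrix.vecCons b J)) := by
      ext i j
      refine Fin.cases ?_ (fun i => ?_) i
      · simp
      · rw [Matrix.updateRow_ne (Fin.succ_ne_zero i)]; rfl
    have h₁ : M.updateRow (Fin.succ 0) y = Matrix.of (Matrix.vecCons e (Matrix.vecCons y J)) := by
      ext i j
      refine Fin.cases ?_ (fun i => Fin.cases ?_ (fun i => ?_) i) i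
      · rw [Matrix.updateRow_ne (Fin.succ_ne_zero _).symm]; rfl
      · rw [Matrix.updateRow_self]; rfl
      · rw [Matrix.updateRow_ne (by simp [Fin.ext_iff])]; rfl
    have h₂ : M 0 = e := rfl
    have h₃ : M (Fin.succ 0) = b := rfl
    rw [h₀, h₁, h₂, h₃, det_vecCons_swap J e y]
    ring
  · intro t _
    have ht : M t.succ.succ = J t := rfl
    rw [ht, mul_eq_zero_of_right]
    refine Matrix.det_zero_of_row_eq (i := 0) (j := t.succ.succ) (Fin.succ_ne_zero _).symm ?_
    rfl

/-- Bordering by a unit vector turns a minor that omits the row `p` into a determinant of full size.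
In this way minors of different sizes enter one Plücker relation. -/
theorem det_vecCons_single_zero (p : Fin n) (ρ : Fin m → Fin n) (C : Fin m → Fin n → R) :
    (Matrix.of (Matrix.vecCons (Pi.single 0 1)
      (fun t s => C t ((Matrix.vecCons p ρ : Fin (m + 1) → Fin n) s)))).det = colDet ρ C := by
  rw [Matrix.det_succ_row_zero, Finset.sum_eq_single 0]
  · simp only [Fin.val_zero, pow_zero, one_mul, Matrix.of_apply, Matrix.cons_val_zero,
      Pi.single_eq_same]
    rfl
  · intro j _ hj
    simp [Pi.single_eq_of_ne hj]
  · simp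

theorem det_vecCons_single_one (p q : Fin n) (ρ : Fin m → Fin n) (C : Fin (m + 1) → Fin n → R) :
    (Matrix.of (Matrix.vecCons (Pi.single 1 1)
      (fun t s => C t ((Matrix.vecCons p (Matrix.vecCons q ρ) : Fin (m + 2) → Fin n) s)))).det =
        -colDet (Matrix.vecCons p ρ) C := by
  rw [Matrix.det_succ_row_zero, Finset.sum_eq_single 1]
  · simp only [Fin.val_one, pow_one, Matrix.of_apply, Matrix.cons_val_zero,
      Pi.single_eq_same, neg_mul, one_mul]
    congr 2
    ext t s
    refine Fin.cases ?_ (fun s => ?_) s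
    · rfl
    · have : (1 : Fin (m + 2)).succAbove s.succ = s.succ.succ := by
        rw [← Fin.succ_zero_eq_one, Fin.succ_succAbove_succ, Fin.succAbove_zero]
      simp [this]
  · intro j _ hj
    simp [Pi.single_eq_of_ne hj]
  · simp

theorem comp_vecCons {R : Type*} (C : Fin m → Fin n → R) {k : ℕ} (c : Fin n → R) (ρ : Fin k → Fin n) :
    (fun t s => (Matrix.vecCons c C : Fin (m + 1) → Fin n → R) t (ρ s)) =
      Matrix.vecCons (fun s => c (ρ s)) fun t s => C t (ρ s) := by
  ext t s
  refine Fin.cases ?_ (fun t => ?_) t <;> rfl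

theorem comp_snoc {R : Type*} (C : Fin m → Fin n → R) {k : ℕ} (y : Fin n → R) (ρ : Fin k → Fin n) :
    (fun t s => (Fin.snoc (α := fun _ => Fin n → R) C y) t (ρ s)) =
      Fin.snoc (α := fun _ => Fin k → R) (fun t s => C t (ρ s)) (fun s => y (ρ s)) := by
  ext t s
  refine Fin.lastCases ?_ (fun t => ?_) t <;> simp

theorem vecCons_snoc {R : Type*} (C : Fin m → Fin n → R) (c y : Fin n → R) :
    Matrix.vecCons c (Fin.snoc (α := fun _ => Fin n → R) C y) =
      Fin.snoc (α := fun _ => Fin n → R) (Matrix.vecCons c C) y :=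
  Fin.cons_snoc_eq_snoc_cons (β := Fin n → R) c C y

/-- This is `det_plucker` on the rows `e, ρ`, with the unit vector at `e` as one of the vectors: it
removes the row `e` from the determinants in which it occurs. -/
theorem colDet_plucker_col (e : Fin n) (ρ : Fin (m + 1) → Fin n) (J : Fin m → Fin n → R)
    (b c y : Fin n → R) :
    colDet ρ (Matrix.vecCons b J) *
        colDet (Matrix.vecCons e ρ) (Matrix.vecCons c (Fin.snoc (α := fun _ => Fin n → R) J y)) =
      colDet ρ (Matrix.vecCons c J) *
          colDet (Matrix.vecCons e ρ)
            (Matrix.vecCons b (Fin.snoc (α := fun _ => Fin n → R) J y)) -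
        colDet (Matrix.vecCons e ρ) (Matrix.vecCons b (Matrix.vecCons c J)) *
          colDet ρ (Fin.snoc (α := fun _ => Fin n → R) J y) := by
  simp only [← det_vecCons_single_zero e ρ]
  simp only [colDet, comp_vecCons, comp_snoc]
  simp only [vecCons_snoc, det_snoc]
  have := det_plucker (fun t s => J t ((Matrix.vecCons e ρ : Fin (m + 2) → Fin n) s))
    (Pi.single 0 1) (fun s => b ((Matrix.vecCons e ρ : Fin (m + 2) → Fin n) s))
    (fun s => c ((Matrix.vecCons e ρ : Fin (m + 2) → Fin n) s))
    (fun s => y ((Matrix.vecCons e ρ : Fin (m + 2) → Fin n) s))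
  linear_combination (-1) ^ (m + 1) * this

/-- Here `det_plucker` is used on the rows `q, p, ρ` with two unit vectors, one removing the row `q`
and the other the row `p`; together they leave `colDet ρ J`. -/
theorem colDet_plucker_row (p q : Fin n) (ρ : Fin m → Fin n) (J : Fin m → Fin n → R)
    (c y : Fin n → R) :
    colDet (Matrix.vecCons p ρ) (Matrix.vecCons c J) *
        colDet (Matrix.vecCons q ρ) (Fin.snoc (α := fun _ => Fin n → R) J y) =
      colDet (Matrix.vecCons q ρ) (Matrix.vecCons c J) *
          colDet (Matrix.vecCons p ρ) (Fin.snoc (α := fun _ => Fin n → R) J y) -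
        colDet ρ J * colDet (Matrix.vecCons q (Matrix.vecCons p ρ))
            (Matrix.vecCons c (Fin.snoc (α := fun _ => Fin n → R) J y)) := by
  have hq : ∀ C : Fin (m + 1) → Fin n → R, colDet (Matrix.vecCons q ρ) C = -_ :=
    fun C => neg_eq_iff_eq_neg.1 (det_vecCons_single_one q p ρ C).symm
  have h0 : colDet ρ J = (Matrix.of (Matrix.vecCons (Pi.single 0 1) (Matrix.vecCons (Pi.single 1 1)
      fun t s => J t ((Matrix.vecCons q (Matrix.vecCons p ρ) : Fin (m + 2) → Fin n) s)))).det := by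
    rw [← det_vecCons_single_zero p ρ]
    rw [Matrix.det_succ_row_zero (n := m + 1), Finset.sum_eq_single 0]
    · simp only [Fin.val_zero, pow_zero, one_mul, Matrix.of_apply, Matrix.cons_val_zero,
        Pi.single_eq_same]
      congr 1
      ext t s
      refine Fin.cases ?_ (fun t => ?_) t
      · refine Fin.cases ?_ (fun s => ?_) s <;> simp [Fin.ext_iff]
      · rfl
    · intro j _ hj
      simp [Pi.single_eq_of_ne hj]
    · simp
  rw [h0]
  simp only [← det_vecCons_single_zero q (Matrix.vecCons p ρ), hq]
  simp only [colDet, comp_vecCons, comp_snoc]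
  simp only [vecCons_snoc, det_snoc]
  have := det_plucker
    (fun t s => J t ((Matrix.vecCons q (Matrix.vecCons p ρ) : Fin (m + 2) → Fin n) s))
    (Pi.single 0 1)
    (fun s => c ((Matrix.vecCons q (Matrix.vecCons p ρ) : Fin (m + 2) → Fin n) s)) (Pi.single 1 1)
    (fun s => y ((Matrix.vecCons q (Matrix.vecCons p ρ) : Fin (m + 2) → Fin n) s))
  rw [det_vecCons_swap _ (fun s => c _) (Pi.single 1 1)] at this
  linear_combination (-(-1) ^ (m + 1)) * this

/-! ### Signs from sorting index sets. -/

/-- The sign of the cyclic permutation that sorts `i` into `I`. -/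
def insertSign (R : Type*) [CommRing R] (I : Finset (Fin n)) (i : Fin n) : R :=
  (-1) ^ (I.filter (· < i)).card

theorem insertSign_insert_of_lt {I : Finset (Fin n)} {i j : Fin n} (hi : i ∉ I) (hij : i < j) :
    insertSign R (insert i I) j = -insertSign R I j := by
  rw [insertSign, insertSign, Finset.filter_insert, if_pos hij,
    Finset.card_insert_of_notMem (by simp [hi]), pow_succ, mul_neg_one]

/-- With `k` the rank of `i` in `insert i I`, omitting the position `k` from the sorted enumeration
leaves the enumeration of `I`. So bringing `i` to the front is a cycle of the first `k + 1`
positions, of sign `(-1) ^ k`. -/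
theorem orderEmbOfFin_insert {I : Finset (Fin n)} {i : Fin n} (hI : I.card = m)
    (h : (insert i I).card = m + 1) :
    ∃ k : Fin (m + 1), (-1 : R) ^ k.1 = insertSign R I i ∧
      ⇑((insert i I).orderEmbOfFin h) =
        (Matrix.vecCons i (I.orderEmbOfFin hI) : Fin (m + 1) → Fin n) ∘ k.cycleRange := by
  set f := (insert i I).orderEmbOfFin h with hf
  have hmem : ∀ s, f s ∈ insert i I := fun s => Finset.orderEmbOfFin_mem _ h s
  obtain ⟨k, hk⟩ : ∃ k, f k = i := by
    have : i ∈ Set.range f := by rw [hf, Finset.range_orderEmbOfFin]; simp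
    exact this
  refine ⟨k, ?_, ?_⟩
  · rw [insertSign]
    congr 1
    have : I.filter (· < i) = (Finset.Iio k).map f.toEmbedding := by
      ext t
      simp only [Finset.mem_filter, Finset.mem_map, Finset.mem_Iio]
      constructor
      · rintro ⟨ht, hti⟩
        have : t ∈ Set.range f := by rw [hf, Finset.range_orderEmbOfFin]; simp [ht]
        obtain ⟨s, rfl⟩ := this
        exact ⟨s, by rw [← hk] at hti; exact f.lt_iff_lt.1 hti, rfl⟩
      · rintro ⟨s, hs, rfl⟩
        have h1 : f s < i := by rw [← hk]; exact f.lt_iff_lt.2 hs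
        exact ⟨(Finset.mem_insert.1 (hmem s)).resolve_left h1.ne, h1⟩
    rw [this, Finset.card_map, Fin.card_Iio]
  · have hs : f ∘ k.succAbove = I.orderEmbOfFin hI := by
      refine Finset.orderEmbOfFin_unique hI (fun s => ?_) (f.strictMono.comp
        (Fin.strictMono_succAbove k))
      refine (Finset.mem_insert.1 (hmem _)).resolve_left fun e => ?_
      exact Fin.succAbove_ne k s (f.injective (e.trans hk.symm))
    ext1 s
    rcases eq_or_ne s k with rfl | hsk
    · simp [hk]
    · obtain ⟨t, rfl⟩ := Fin.exists_succAbove_eq hsk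
      rw [Function.comp_apply, Fin.cycleRange_succAbove]
      exact congrFun hs t

theorem colDet_comp_row (ρ : Fin m → Fin n) (C : Fin m → Fin n → R) (σ : Equiv.Perm (Fin m)) :
    colDet (ρ ∘ σ) C = ((Equiv.Perm.sign σ : ℤ) : R) * colDet ρ C :=
  Matrix.det_permute' σ (Matrix.of fun t s => C t (ρ s))

theorem colDet_comp_col (ρ : Fin m → Fin n) (C : Fin m → Fin n → R) (σ : Equiv.Perm (Fin m)) :
    colDet ρ (C ∘ σ) = ((Equiv.Perm.sign σ : ℤ) : R) * colDet ρ C :=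
  Matrix.det_permute σ (Matrix.of fun t s => C t (ρ s))

theorem colDet_insert_row {I : Finset (Fin n)} {i : Fin n} (hI : I.card = m)
    (h : (insert i I).card = m + 1) (C : Fin (m + 1) → Fin n → R) :
    colDet ((insert i I).orderEmbOfFin h) C =
      insertSign R I i * colDet (Matrix.vecCons i (I.orderEmbOfFin hI)) C := by
  obtain ⟨k, hk, he⟩ := orderEmbOfFin_insert (R := R) hI h
  rw [he, colDet_comp_row, Fin.sign_cycleRange, ← hk]
  push_cast; rfl

theorem comp_orderEmbOfFin_insert {I : Finset (Fin n)} {i : Fin n} (hI : I.card = m)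
    (h : (insert i I).card = m + 1) (X : Fin n → Fin n → R) :
    ∃ k : Fin (m + 1), (-1 : R) ^ k.1 = insertSign R I i ∧
      (fun t => X ((insert i I).orderEmbOfFin h t)) =
        (Matrix.vecCons (X i) (fun t => X (I.orderEmbOfFin hI t)) : Fin (m + 1) → Fin n → R) ∘
          k.cycleRange := by
  obtain ⟨k, hk, he⟩ := orderEmbOfFin_insert (R := R) hI h
  refine ⟨k, hk, ?_⟩
  rw [he]
  ext1 t
  simp only [Function.comp_apply]
  refine Fin.cases ?_ (fun s => ?_) (k.cycleRange t) <;> rfl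

theorem colDet_insert_col {J : Finset (Fin n)} {c : Fin n} (hJ : J.card = m)
    (h : (insert c J).card = m + 1) (ρ : Fin (m + 1) → Fin n) (X : Fin n → Fin n → R) :
    colDet ρ (fun t => X ((insert c J).orderEmbOfFin h t)) =
      insertSign R J c * colDet ρ (Matrix.vecCons (X c) fun t => X (J.orderEmbOfFin hJ t)) := by
  obtain ⟨k, hk, he⟩ := comp_orderEmbOfFin_insert (R := R) hJ h X
  rw [he, colDet_comp_col, Fin.sign_cycleRange, ← hk]
  push_cast; rfl

theorem colDet_insert_col_snoc {J : Finset (Fin n)} {c : Fin n} (hJ : J.card = m)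
    (h : (insert c J).card = m + 1) (ρ : Fin (m + 2) → Fin n) (X : Fin n → Fin n → R)
    (y : Fin n → R) :
    colDet ρ (Fin.snoc (α := fun _ => Fin n → R)
        (fun t => X ((insert c J).orderEmbOfFin h t)) y) =
      insertSign R J c * colDet ρ (Matrix.vecCons (X c)
        (Fin.snoc (α := fun _ => Fin n → R) (fun t => X (J.orderEmbOfFin hJ t)) y)) := by
  obtain ⟨k, hk, he⟩ := comp_orderEmbOfFin_insert (R := R) hJ h X
  -- The sorting cycle moves only the entries before `y`; `k.castSucc.cycleRange` is the same cycle,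
  -- with the last position fixed.
  have : Fin.snoc (α := fun _ => Fin n → R) (fun t => X ((insert c J).orderEmbOfFin h t)) y =
      (Matrix.vecCons (X c)
        (Fin.snoc (α := fun _ => Fin n → R) (fun t => X (J.orderEmbOfFin hJ t)) y)) ∘
          k.castSucc.cycleRange := by
    rw [he, vecCons_snoc]
    ext1 t
    refine Fin.lastCases ?_ (fun t => ?_) t
    · rw [Function.comp_apply, Fin.cycleRange_of_gt (Fin.castSucc_lt_last k)]
      simp
    · have : k.castSucc.cycleRange t.castSucc = (k.cycleRange t).castSucc := by
        rcases lt_trichotomy t k with h | rfl | h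
        · ext
          rw [Fin.val_castSucc, Fin.coe_cycleRange_of_lt h,
            Fin.coe_cycleRange_of_lt (Fin.castSucc_lt_castSucc_iff.2 h), Fin.val_castSucc]
        · simp
        · rw [Fin.cycleRange_of_gt h, Fin.cycleRange_of_gt (Fin.castSucc_lt_castSucc_iff.2 h)]
      rw [Function.comp_apply, this, Fin.snoc_castSucc, Fin.snoc_castSucc]
      rfl
  rw [this, colDet_comp_col, Fin.sign_cycleRange, ← hk]
  push_cast; rfl

theorem colDet_vecCons_comp_col (ρ : Fin (m + 1) → Fin n) (b : Fin n → R) (C : Fin m → Fin n → R)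
    (σ : Equiv.Perm (Fin m)) : colDet ρ (Matrix.vecCons b (C ∘ σ)) =
      ((Equiv.Perm.sign σ : ℤ) : R) * colDet ρ (Matrix.vecCons b C) := by
  rw [colDet, colDet, comp_vecCons, comp_vecCons]
  have := (Matrix.detRowAlternating.curryLeft fun s => b (ρ s)).map_perm (fun t s => C t (ρ s)) σ
  rw [Units.smul_def, zsmul_eq_mul] at this
  exact this

theorem colDet_swap (ρ : Fin m → Fin n) (C : Fin m → Fin n → R) :
    colDet ρ C = (Matrix.of fun s t => C t (ρ s)).det := (Matrix.det_transpose _).symm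

theorem comp_vecCons' {R : Type*} (C : Fin m → Fin n → R) {k : ℕ} (p : Fin n) (ρ : Fin k → Fin n) :
    (fun s t => C t ((Matrix.vecCons p ρ : Fin (k + 1) → Fin n) s)) =
      Matrix.vecCons (fun t => C t p) fun s t => C t (ρ s) := by
  ext s t
  refine Fin.cases ?_ (fun s => ?_) s <;> rfl

theorem colDet_vecCons_comp_row (p : Fin n) (ρ : Fin m → Fin n) (C : Fin (m + 1) → Fin n → R)
    (σ : Equiv.Perm (Fin m)) : colDet (Matrix.vecCons p (ρ ∘ σ)) C =
      ((Equiv.Perm.sign σ : ℤ) : R) * colDet (Matrix.vecCons p ρ) C := by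
  rw [colDet_swap, colDet_swap, comp_vecCons', comp_vecCons']
  have := (Matrix.detRowAlternating.curryLeft fun t => C t p).map_perm (fun s t => C t (ρ s)) σ
  rw [Units.smul_def, zsmul_eq_mul] at this
  exact this

end Minors

/-! ### Three-term relations for the dual vectors. -/

section Dual

variable {n : ℕ} {V : Type*} [AddCommGroup V] [Module ℂ V]

/-- The columns of `x`. -/
def colVec (x : GL (Fin n) ℂ) (j i : Fin n) : ℂ := x.1 i j

theorem minor_eq_colDet (x : GL (Fin n) ℂ) {m : ℕ} {I J : Finset (Fin n)} (hI : I.card = m)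
    (hJ : J.card = m) :
    minor x I J = colDet (I.orderEmbOfFin hI) fun t => colVec x (J.orderEmbOfFin hJ t) := by
  subst hI
  rw [minor, dif_pos hJ, ← Matrix.det_transpose]
  rfl

theorem coord_translate (a : Module.Basis (Fin n) ℂ V) (x : GL (Fin n) ℂ) (i j : Fin n) :
    a.coord i (translate a x j) = x.1 i j := by
  simp [translate, Finsupp.single_apply]

theorem contraction_apply (a : Module.Basis (Fin n) ℂ V) (x : GL (Fin n) ℂ) {m : ℕ}
    {I J : Finset (Fin n)} (hI : I.card = m + 1) (hJ : J.card = m) (y : V) :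
    contraction a.coord (translate a x) I J y =
      colDet (I.orderEmbOfFin hI) (Fin.snoc (α := fun _ => Fin n → ℂ)
        (fun t => colVec x (J.orderEmbOfFin hJ t)) (a.repr y)) := by
  subst hJ
  rw [contraction, dif_pos hI, LinearMap.comp_apply, MultilinearMap.toLinearMap_apply,
    Fin.update_snoc_last]
  change exteriorPower.pairingDual ℂ V _ _ (exteriorPower.ιMulti ℂ _ _) = _
  rw [exteriorPower.pairingDual_ιMulti_ιMulti, colDet]
  congr 1
  ext t s
  refine Fin.lastCases ?_ (fun t => ?_) t
  · simp
  · simp only [Matrix.of_apply, Fin.snoc_castSucc, coord_translate, colVec]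

/-- Evaluated at `y`, this is `colDet_plucker_col` up to sorting signs. All terms share one sign
except the one with both `b` and `c`, where `c < b` gives an extra minus that turns the difference
into a sum. -/
theorem contraction_insert_col (a : Module.Basis (Fin n) ℂ V) (x : GL (Fin n) ℂ)
    {I J : Finset (Fin n)} {e b c : Fin n} (hIJ : I.card = J.card + 1) (he : e ∉ I) (hc : c ∉ J)
    (hb : b ∉ J) (hcb : c < b) :
    minor x I (insert b J) • contraction a.coord (translate a x) (insert e I) (insert c J) =
      minor x I (insert c J) • contraction a.coord (translate a x) (insert e I) (insert b J) +
        minor x (insert e I) (insert b (insert c J)) •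
          contraction a.coord (translate a x) I J := by
  have hb' : b ∉ insert c J := by simp [hb, hcb.ne']
  have e1 : (insert e I).card = J.card + 2 := by rw [Finset.card_insert_of_notMem he, hIJ]
  have e2 := Finset.card_insert_of_notMem hc
  have e3 := Finset.card_insert_of_notMem hb
  have e4 : (insert b (insert c J)).card = J.card + 2 := by
    rw [Finset.card_insert_of_notMem hb', e2]
  ext y
  simp only [LinearMap.smul_apply, LinearMap.add_apply, smul_eq_mul]
  rw [minor_eq_colDet x hIJ e2, minor_eq_colDet x hIJ e3, minor_eq_colDet x e1 e4,
    contraction_apply a x e1 e2, contraction_apply a x e1 e3, contraction_apply a x hIJ rfl]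
  rw [colDet_insert_col rfl, colDet_insert_col rfl, colDet_insert_row hIJ,
    colDet_insert_row hIJ, colDet_insert_row hIJ, colDet_insert_col e2,
    insertSign_insert_of_lt hc hcb, colDet_insert_col_snoc rfl, colDet_insert_col_snoc rfl]
  have h4 : colDet (Matrix.vecCons e (I.orderEmbOfFin hIJ)) (Matrix.vecCons (colVec x b)
      fun t => colVec x ((insert c J).orderEmbOfFin e2 t)) = insertSign ℂ J c *
      colDet (Matrix.vecCons e (I.orderEmbOfFin hIJ)) (Matrix.vecCons (colVec x b)
        (Matrix.vecCons (colVec x c) fun t => colVec x (J.orderEmbOfFin rfl t))) := by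
    obtain ⟨k, hk, hk'⟩ := comp_orderEmbOfFin_insert (R := ℂ) rfl e2 (colVec x)
    rw [hk', colDet_vecCons_comp_col, Fin.sign_cycleRange, ← hk]
    push_cast; rfl
  rw [h4]
  have := colDet_plucker_col e (I.orderEmbOfFin hIJ)
    (fun t => colVec x (J.orderEmbOfFin rfl t)) (colVec x b) (colVec x c) (a.repr y)
  linear_combination (insertSign ℂ J b * insertSign ℂ J c * insertSign ℂ I e) * this

/-- The same with rows: `colDet_plucker_row` has one negative term, and `p < q` makes its sorting
sign negative as well. -/
theorem contraction_insert_row (a : Module.Basis (Fin n) ℂ V) (x : GL (Fin n) ℂ)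
    {I J : Finset (Fin n)} {p q c : Fin n} (hIJ : I.card = J.card) (hp : p ∉ I) (hq : q ∉ I)
    (hc : c ∉ J) (hpq : p < q) :
    minor x (insert p I) (insert c J) • contraction a.coord (translate a x) (insert q I) J =
      minor x (insert q I) (insert c J) • contraction a.coord (translate a x) (insert p I) J +
        minor x I J •
          contraction a.coord (translate a x) (insert q (insert p I)) (insert c J) := by
  have hq' : q ∉ insert p I := by simp [hq, hpq.ne']
  have e1 : (insert p I).card = J.card + 1 := by rw [Finset.card_insert_of_notMem hp, hIJ]
  have e2 : (insert q I).card = J.card + 1 := by rw [Finset.card_insert_of_notMem hq, hIJ]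
  have e3 := Finset.card_insert_of_notMem hc
  have e4 : (insert q (insert p I)).card = J.card + 2 := by
    rw [Finset.card_insert_of_notMem hq', e1]
  ext y
  simp only [LinearMap.smul_apply, LinearMap.add_apply, smul_eq_mul]
  rw [minor_eq_colDet x e1 e3, minor_eq_colDet x e2 e3, minor_eq_colDet x hIJ rfl,
    contraction_apply a x e1 rfl, contraction_apply a x e2 rfl, contraction_apply a x e4 e3]
  rw [colDet_insert_col rfl, colDet_insert_col rfl, colDet_insert_row hIJ,
    colDet_insert_row hIJ, colDet_insert_row hIJ, colDet_insert_row hIJ,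
    colDet_insert_row e1, insertSign_insert_of_lt hp hpq, colDet_insert_col_snoc rfl]
  have h4 : ∀ C : Fin (J.card + 2) → Fin n → ℂ,
      colDet (Matrix.vecCons q ((insert p I).orderEmbOfFin e1)) C = insertSign ℂ I p *
        colDet (Matrix.vecCons q (Matrix.vecCons p (I.orderEmbOfFin hIJ))) C := by
    intro C
    obtain ⟨k, hk, hk'⟩ := orderEmbOfFin_insert (R := ℂ) hIJ e1
    rw [hk', colDet_vecCons_comp_row, Fin.sign_cycleRange, ← hk]
    push_cast; rfl
  rw [h4]
  have := colDet_plucker_row p q (I.orderEmbOfFin hIJ)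
    (fun t => colVec x (J.orderEmbOfFin rfl t)) (colVec x c) (a.repr y)
  linear_combination (insertSign ℂ I p * insertSign ℂ I q * insertSign ℂ J c) * this

end Dual

end DoubleBruhat

namespace DoubleBruhat

/-! ### Factorization of the change of basis -/

section TakesTo

variable {n : ℕ} {V : Type*} [AddCommGroup V] [Module ℂ V]

theorem takesTo_one (ξ : Fin n → Module.Dual ℂ V) : TakesTo 1 ξ ξ := by
  intro j
  simp [Matrix.one_apply]

theorem TakesTo.mul {g h : GL (Fin n) ℂ} {ξ ζ η : Fin n → Module.Dual ℂ V} (hg : TakesTo g ξ ζ)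
    (hh : TakesTo h ζ η) : TakesTo (g * h) ξ η := by
  intro j
  have h' : ∀ k, h.1 k j • ζ k = ∑ i, (g.1 i k * h.1 k j) • ξ i := fun k => by
    rw [← hg k, Finset.smul_sum]
    exact Finset.sum_congr rfl fun i _ => by rw [smul_smul, mul_comm]
  rw [← hh j, Finset.sum_congr rfl fun k _ => h' k, Finset.sum_comm]
  exact Finset.sum_congr rfl fun i _ => by
    rw [← Finset.sum_smul, Units.val_mul, Matrix.mul_apply]

theorem takesTo_hMat (j : ℕ) (X : ℂˣ) (ξ : Fin n → Module.Dual ℂ V) :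
    TakesTo (hMat j X) ξ fun r => (if r.1 < j then (X : ℂ) else 1) • ξ r := by
  intro r
  simp [hMat, Matrix.diagonal_apply]

theorem takesTo_elem {p q : Fin n} (hpq : p ≠ q) (ξ : Fin n → Module.Dual ℂ V) :
    TakesTo (elem p q hpq) ξ fun r => if r = q then ξ r + ξ p else ξ r := by
  intro r
  simp only [elem, Matrix.transvection, Matrix.add_apply, Matrix.one_apply, Matrix.single_apply,
    add_smul, ite_smul, one_smul, zero_smul, Finset.sum_add_distrib, Finset.sum_ite_eq',
    Finset.mem_univ, if_true]
  by_cases h : r = q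
  · simp [h]
  · simp [h, Ne.symm h]

/-- `L`, `B`, `R` are the minors of the faces to the left of, below and to the right of the black
lower end. The diagonal factors scale the two summands on the lower line to `R / L` and `B / L`,
while above it they cancel, since `(B/R)(R/L)(L/B) = 1`. -/
theorem takesTo_pos (i : Fin (n - 1)) {ζ ζ' : Fin n → Module.Dual ℂ V} (L B R : ℂˣ)
    (h : (L : ℂ) • ζ' (botIdx i) = (R : ℂ) • ζ (botIdx i) + (B : ℂ) • ζ (topIdx i))
    (h' : ∀ r, r ≠ botIdx i → ζ' r = ζ r) :
    TakesTo (hMat (i.1 + 1) (B / R) * hMat (i.1 + 2) (R / L) * ePos i * hMat (i.1 + 1) (L / B))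
      ζ ζ' := by
  have H := (((takesTo_hMat (i.1 + 1) (B / R) ζ).mul (takesTo_hMat (i.1 + 2) (R / L) _)).mul
    (takesTo_elem (topIdx_ne_botIdx i) _)).mul (takesTo_hMat (i.1 + 1) (L / B) _)
  refine Eq.mpr (congrArg (TakesTo _ ζ) ?_) H
  ext1 r
  have hL := L.ne_zero
  have hB := B.ne_zero
  have hR := R.ne_zero
  by_cases hr : r = botIdx i
  · have : ζ' r = (L : ℂ)⁻¹ • ((R : ℂ) • ζ (botIdx i) + (B : ℂ) • ζ (topIdx i)) := by
      rw [← h, hr, smul_smul, inv_mul_cancel₀ hL, one_smul]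
    rw [this]
    subst hr
    simp only [botIdx, topIdx, lt_irrefl, if_true, if_false, Nat.lt_succ_self,
      show i.1 < i.1 + 2 by omega, Units.val_div_eq_div_val, smul_smul, smul_add, one_smul]
    congr 2 <;> field_simp
  · rw [h' r hr]
    simp only [hr, if_false, smul_smul]
    have hr' : r.1 ≠ i.1 + 1 := fun e => hr (Fin.ext e)
    by_cases h1 : r.1 < i.1 + 1
    · simp only [h1, show r.1 < i.1 + 2 by omega, if_true, Units.val_div_eq_div_val]
      rw [show (L : ℂ) / B * (R / L * (B / R)) = 1 by field_simp, one_smul]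
    · simp [h1, show ¬ r.1 < i.1 + 2 by omega]

/-- The black end is now the upper one, with the faces `T` above it, `L` on its left and `R` on its
right. -/
theorem takesTo_neg (i : Fin (n - 1)) {ζ ζ' : Fin n → Module.Dual ℂ V} (T L R : ℂˣ)
    (h : (L : ℂ) • ζ' (topIdx i) = (R : ℂ) • ζ (topIdx i) + (T : ℂ) • ζ (botIdx i))
    (h' : ∀ r, r ≠ topIdx i → ζ' r = ζ r) :
    TakesTo (hMat i.1 (L / R) * hMat (i.1 + 1) (R / T) * eNeg i * hMat (i.1 + 1) (T / L))
      ζ ζ' := by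
  have H := (((takesTo_hMat i.1 (L / R) ζ).mul (takesTo_hMat (i.1 + 1) (R / T) _)).mul
    (takesTo_elem (topIdx_ne_botIdx i).symm _)).mul (takesTo_hMat (i.1 + 1) (T / L) _)
  refine Eq.mpr (congrArg (TakesTo _ ζ) ?_) H
  ext1 r
  have hL := L.ne_zero
  have hT := T.ne_zero
  have hR := R.ne_zero
  by_cases hr : r = topIdx i
  · have : ζ' r = (L : ℂ)⁻¹ • ((R : ℂ) • ζ (topIdx i) + (T : ℂ) • ζ (botIdx i)) := by
      rw [← h, hr, smul_smul, inv_mul_cancel₀ hL, one_smul]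
    rw [this]
    subst hr
    simp only [botIdx, topIdx, lt_irrefl, if_true, if_false, Nat.lt_succ_self,
      show ¬ i.1 + 1 < i.1 by omega, Units.val_div_eq_div_val, smul_smul, smul_add, one_smul]
    congr 2 <;> field_simp
  · rw [h' r hr]
    simp only [hr, if_false, smul_smul]
    have hr' : r.1 ≠ i.1 := fun e => hr (Fin.ext e)
    by_cases h1 : r.1 < i.1
    · simp only [h1, show r.1 < i.1 + 1 by omega, if_true, Units.val_div_eq_div_val]
      rw [show (T : ℂ) / L * (R / T * (L / R)) = 1 by field_simp, one_smul]
    · simp [h1, show ¬ r.1 < i.1 + 1 by omega]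

end TakesTo

variable {n : ℕ}

/-! ### The change of the dual vectors across one vertical edge. -/

section Step

variable {V : Type*} [AddCommGroup V] [Module ℂ V]

theorem initSet_mul_simpleReflection_succ (σ : Equiv.Perm (Fin n)) (i : Fin (n - 1)) :
    initSet (σ * simpleReflection i) (i.1 + 1) = insert (σ (botIdx i)) (initSet σ i.1) := by
  have := initSet_succ (σ * simpleReflection i) (topIdx i)
  simp only [Equiv.Perm.mul_apply, simpleReflection_topIdx] at this
  rw [show i.1 = (topIdx i).1 from rfl, this,
    initSet_mul_simpleReflection σ i (by simp [topIdx])]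

/-- The column set in spacing `i + 1` exchanges the label `τ (botIdx i)` for `τ (topIdx i)`, all
other sets being unchanged. Reducedness, through `vSuf_lt`, puts these labels in the order that
`contraction_insert_col` needs. -/
theorem xiAt_step_pos {u v : Equiv.Perm (Fin n)} {w : List (Letter n)}
    (hw : IsReducedPair w u v) (a : Module.Basis (Fin n) ℂ V) (x : GL (Fin n) ℂ) {k : ℕ}
    (hk : k < w.length) (hp : w[k].pos = true) :
    minorAt w x k (w[k].idx.1 + 1) • xiAt w a x (k + 1) (botIdx w[k].idx) =
      minorAt w x (k + 1) (w[k].idx.1 + 1) • xiAt w a x k (botIdx w[k].idx) +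
        minorAt w x k (w[k].idx.1 + 2) • xiAt w a x k (topIdx w[k].idx) := by
  have hi := w[k].idx.2
  have hlt := vSuf_lt hw hk hp
  have hv := vSuf_of_pos hk hp
  have hu := uPre_succ_of_pos hk hp
  set i := w[k].idx
  set τ := (vSuf w (k + 1))⁻¹
  have hv' : (vSuf w k)⁻¹ = τ * simpleReflection i := by
    rw [hv, mul_inv_rev, simpleReflection_inv]
  have c1 : colSet w k (i.1 + 1) = insert (τ (botIdx i)) (initSet τ i.1) := by
    rw [colSet, hv', initSet_mul_simpleReflection_succ]
  have c2 : colSet w (k + 1) (i.1 + 1) = insert (τ (topIdx i)) (initSet τ i.1) :=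
    initSet_succ τ (topIdx i)
  have c3 : colSet w k (i.1 + 2) =
      insert (τ (botIdx i)) (insert (τ (topIdx i)) (initSet τ i.1)) := by
    rw [colSet, hv', initSet_mul_simpleReflection _ _ (by omega)]
    have := initSet_succ τ (botIdx i)
    rw [← c2]
    exact this
  have c4 : colSet w k i.1 = initSet τ i.1 := by
    rw [colSet, hv', initSet_mul_simpleReflection _ _ (by omega)]
  have r1 : rowSet w k (i.1 + 2) = insert (uPre w k (botIdx i)) (rowSet w k (i.1 + 1)) :=
    initSet_succ (uPre w k) (botIdx i)
  have r2 : rowSet w (k + 1) = rowSet w k := by unfold rowSet; rw [hu]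
  rw [xiAt, xiAt, xiAt, minorAt, minorAt, minorAt, r2,
    show (botIdx i).1 = i.1 + 1 from rfl, show (topIdx i).1 = i.1 from rfl, c1, c2, c3, c4, r1]
  refine contraction_insert_col a x ?_ (notMem_initSet _ (botIdx i)) (notMem_initSet τ (topIdx i))
    (by simp [mem_initSet, botIdx]) hlt
  rw [rowSet, card_initSet _ (by omega), card_initSet _ (by omega)]

/-- Now a row label is exchanged, and `uPre_lt` supplies the order for `contraction_insert_row`. -/
theorem xiAt_step_neg {u v : Equiv.Perm (Fin n)} {w : List (Letter n)}
    (hw : IsReducedPair w u v) (a : Module.Basis (Fin n) ℂ V) (x : GL (Fin n) ℂ) {k : ℕ}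
    (hk : k < w.length) (hp : w[k].pos = false) :
    minorAt w x k (w[k].idx.1 + 1) • xiAt w a x (k + 1) (topIdx w[k].idx) =
      minorAt w x (k + 1) (w[k].idx.1 + 1) • xiAt w a x k (topIdx w[k].idx) +
        minorAt w x k w[k].idx.1 • xiAt w a x k (botIdx w[k].idx) := by
  have hi := w[k].idx.2
  have hlt := uPre_lt hw hk hp
  have hv := vSuf_of_neg hk hp
  have hu := uPre_succ_of_neg hk hp
  set i := w[k].idx
  set σ := uPre w k
  have r1 : rowSet w (k + 1) (i.1 + 1) = insert (σ (botIdx i)) (initSet σ i.1) := by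
    rw [rowSet, hu, initSet_mul_simpleReflection_succ]
  have r2 : rowSet w k (i.1 + 1) = insert (σ (topIdx i)) (initSet σ i.1) :=
    initSet_succ σ (topIdx i)
  have r3 : rowSet w k (i.1 + 1 + 1) =
      insert (σ (botIdx i)) (insert (σ (topIdx i)) (initSet σ i.1)) := by
    rw [← r2]
    exact initSet_succ σ (botIdx i)
  have c1 : colSet w k (i.1 + 1) =
      insert ((vSuf w k)⁻¹ (topIdx i)) (initSet (vSuf w k)⁻¹ i.1) :=
    initSet_succ _ (topIdx i)
  have c2 : colSet w (k + 1) = colSet w k := by unfold colSet; rw [hv]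
  rw [xiAt, xiAt, xiAt, minorAt, minorAt, minorAt, c2,
    show (botIdx i).1 = i.1 + 1 from rfl, show (topIdx i).1 = i.1 from rfl, r1, r2, r3, c1]
  refine contraction_insert_row a x ?_ (notMem_initSet σ (topIdx i))
    (by simp [mem_initSet, botIdx, σ]) (notMem_initSet _ (topIdx i)) hlt
  rw [card_initSet _ (by omega), card_initSet _ (by omega)]

end Step

/-! ### The factors of the product -/

/-- The exponents of the three faces around the black end of the `k`th vertical edge: the part of
`p̃` that comes from the 3-cycle around it. -/
def cyclePart (w : List (Letter n)) (A : Face w → ℂˣ) (k : Fin w.length) (f : Face w) : ℂˣ :=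
  (if f = (blackCycle w k).1 then A (blackCycle w k).2.1 / A (blackCycle w k).2.2 else 1) *
    (if f = (blackCycle w k).2.1 then A (blackCycle w k).2.2 / A (blackCycle w k).1 else 1) *
    (if f = (blackCycle w k).2.2 then A (blackCycle w k).1 / A (blackCycle w k).2.1 else 1)

theorem prod_pow_ite {ι : Type*} [Fintype ι] [DecidableEq ι] (A : ι → ℂˣ) (P : Prop) [Decidable P]
    (c : ι) : ∏ g, A g ^ (((if P ∧ g = c then 1 else 0 : ℕ) : ℤ)) = if P then A c else 1 := by
  by_cases hP : P
  · rw [Finset.prod_eq_single c]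
    · simp [hP]
    · intro b _ hb; simp [hb]
    · simp
  · simp [hP]

/-- The exchange matrix is a sum over black vertices, and opposite arrows cancel in it, so `p̃` is a
product of local factors. -/
theorem pMap_eq (w : List (Letter n)) (A : Face w → ℂˣ) (f : Face w) :
    pMap w A f = ∏ k, cyclePart w A k f := by
  have h : ∀ g, A g ^ exchange w f g = ∏ k : Fin w.length,
      (A g ^ (((if f = (blackCycle w k).1 ∧ g = (blackCycle w k).2.1 then 1 else 0 : ℕ) : ℤ)) *
        A g ^ (((if f = (blackCycle w k).2.1 ∧ g = (blackCycle w k).2.2 then 1 else 0 : ℕ) : ℤ)) *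
        A g ^ (((if f = (blackCycle w k).2.2 ∧ g = (blackCycle w k).1 then 1 else 0 : ℕ) : ℤ)) /
        (A g ^ (((if f = (blackCycle w k).2.1 ∧ g = (blackCycle w k).1 then 1 else 0 : ℕ) : ℤ)) *
        A g ^ (((if f = (blackCycle w k).2.2 ∧ g = (blackCycle w k).2.1 then 1 else 0 : ℕ) : ℤ)) *
        A g ^ (((if f = (blackCycle w k).1 ∧ g = (blackCycle w k).2.2 then 1 else 0 : ℕ) :
          ℤ)))) := by
    intro g
    rw [Finset.prod_div_distrib]
    simp only [← zpow_add, ← Nat.cast_add]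
    rw [exchange, zpow_sub, arrows, arrows, Nat.cast_sum, Nat.cast_sum]
    have hz : ∀ e : Fin w.length → ℕ, A g ^ (∑ k, (e k : ℤ)) = ∏ k, A g ^ ((e k : ℕ) : ℤ) := by
      intro e
      induction (Finset.univ : Finset (Fin w.length)) using Finset.cons_induction with
      | empty => simp
      | cons b s hb ih => rw [Finset.sum_cons, Finset.prod_cons, zpow_add, ih]
    rw [hz, hz, ← div_eq_mul_inv]
    simp only [and_comm]
  rw [pMap, Finset.prod_congr rfl fun g _ => h g, Finset.prod_comm]
  refine Finset.prod_congr rfl fun k _ => ?_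
  simp only [Finset.prod_div_distrib, Finset.prod_mul_distrib, prod_pow_ite]
  have hd : ∀ (P : Prop) [Decidable P] (a b : ℂˣ),
      (if P then a / b else 1) = (if P then a else 1) / if P then b else 1 := by
    intro P _ a b
    split_ifs <;> simp
  rw [cyclePart, hd, hd, hd, div_mul_div_comm, div_mul_div_comm]
  congr 1
  rw [mul_comm, mul_assoc]

/-- The part of `p̃` that comes from the first `m` letters. -/
def pPart (w : List (Letter n)) (A : Face w → ℂˣ) (m : ℕ) (f : Face w) : ℂˣ :=
  ∏ k ∈ Finset.univ.filter fun k : Fin w.length => k.1 < m, cyclePart w A k f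

theorem pPart_zero (w : List (Letter n)) (A : Face w → ℂˣ) (f : Face w) : pPart w A 0 f = 1 := by
  simp [pPart]

theorem pPart_succ (w : List (Letter n)) (A : Face w → ℂˣ) {m : ℕ} (hm : m < w.length)
    (f : Face w) : pPart w A (m + 1) f = pPart w A m f * cyclePart w A ⟨m, hm⟩ f := by
  have : (Finset.univ.filter fun k : Fin w.length => k.1 < m + 1) =
      insert ⟨m, hm⟩ (Finset.univ.filter fun k : Fin w.length => k.1 < m) := by
    ext k
    simp only [Finset.mem_filter, Finset.mem_univ, true_and, Finset.mem_insert, Fin.ext_iff]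
    omega
  rw [pPart, this, Finset.prod_insert (by simp), mul_comm]
  rfl

theorem pPart_length (w : List (Letter n)) (A : Face w → ℂˣ) : pPart w A w.length = pMap w A := by
  ext1 f
  rw [pMap_eq, pPart, Finset.filter_true_of_mem fun k _ => k.2]

/-- The factor of a letter. -/
def letterMat (a : Letter n) : GL (Fin n) ℂ := if a.pos then ePos a.idx else eNeg a.idx

/-- The part of the product `χ̃` up to the face to the right of the `m`th letter. -/
def chiPart (w : List (Letter n)) (X : Face w → ℂˣ) (m : ℕ) : GL (Fin n) ℂ :=
  (List.ofFn fun j : Fin (n + 1) => hMat j.1 (X (.inl j))).prod *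
    ((List.ofFn fun k : Fin w.length =>
      letterMat w[k] * hMat w[k].spacing.1 (X (.inr k))).take m).prod

theorem chiPart_length (w : List (Letter n)) (X : Face w → ℂˣ) :
    chiPart w X w.length = chiMap w X := by
  rw [chiPart, List.take_of_length_le (by simp)]
  rfl

theorem chiPart_succ (w : List (Letter n)) (X : Face w → ℂˣ) {m : ℕ} (hm : m < w.length) :
    chiPart w X (m + 1) =
      chiPart w X m * (letterMat w[m] * hMat w[m].spacing.1 (X (.inr ⟨m, hm⟩))) := by
  rw [chiPart, chiPart, List.prod_take_succ _ _ (by simpa using hm), List.getElem_ofFn, mul_assoc]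
  rfl

/-! ### Commutation of the diagonal factors with the letters. -/

/-- Invertible diagonal matrices. -/
def diagHom : (Fin n → ℂˣ) →* GL (Fin n) ℂ where
  toFun d := ⟨Matrix.diagonal fun i => (d i : ℂ), Matrix.diagonal fun i => ((d i)⁻¹ : ℂˣ),
    by simp, by simp⟩
  map_one' := by ext i j; simp [Matrix.one_apply, Matrix.diagonal_apply]
  map_mul' d e := by
    apply Units.ext
    simp

theorem hMat_eq_diagHom (j : ℕ) (X : ℂˣ) :
    (hMat j X : GL (Fin n) ℂ) = diagHom fun k => if k.1 < j then X else 1 := by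
  apply Units.ext
  simp only [hMat, diagHom, MonoidHom.coe_mk, OneHom.coe_mk]
  congr 1
  ext k
  split_ifs <;> simp

theorem hMat_mul (j : ℕ) (X Y : ℂˣ) : (hMat j (X * Y) : GL (Fin n) ℂ) = hMat j X * hMat j Y := by
  rw [hMat_eq_diagHom, hMat_eq_diagHom, hMat_eq_diagHom, ← map_mul]
  congr 1
  ext1 k
  simp only [Pi.mul_apply]
  split_ifs <;> simp

theorem hMat_one (j : ℕ) : (hMat j 1 : GL (Fin n) ℂ) = 1 := by
  rw [hMat_eq_diagHom, ← map_one diagHom]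
  congr 1
  ext1 k
  simp

theorem hMat_mul_comm (i j : ℕ) (X Y : ℂˣ) :
    (hMat i X * hMat j Y : GL (Fin n) ℂ) = hMat j Y * hMat i X := by
  rw [hMat_eq_diagHom, hMat_eq_diagHom, ← map_mul, ← map_mul, mul_comm]

theorem hMat_mul_elem (j : ℕ) (X : ℂˣ) {p q : Fin n} (hpq : p ≠ q) (h : p.1 < j ↔ q.1 < j) :
    hMat j X * elem p q hpq = elem p q hpq * hMat j X := by
  ext r s
  simp only [hMat, elem, Units.val_mul, Matrix.diagonal_mul, Matrix.mul_diagonal,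
    Matrix.transvection, Matrix.add_apply, Matrix.one_apply, Matrix.single_apply]
  by_cases hrs : r = s
  · subst hrs
    ring
  · by_cases h' : p = r ∧ q = s
    · obtain ⟨rfl, rfl⟩ := h'
      simp [h, mul_comm]
    · simp [hrs, h']

theorem hMat_mul_letterMat (j : ℕ) (X : ℂˣ) (a : Letter n) (h : a.spacing.1 ≠ j) :
    hMat j X * letterMat a = letterMat a * hMat j X := by
  rw [spacing_val] at h
  unfold letterMat
  split_ifs
  · exact hMat_mul_elem _ _ _ (by simp only [topIdx, botIdx]; omega)
  · exact hMat_mul_elem _ _ _ (by simp only [topIdx, botIdx]; omega)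

theorem prod_hMat (X : Fin (n + 1) → ℂˣ) :
    (List.ofFn fun j : Fin (n + 1) => (hMat j.1 (X j) : GL (Fin n) ℂ)).prod =
      diagHom (∏ j : Fin (n + 1), fun k : Fin n => if k.1 < j.1 then X j else 1) := by
  rw [← List.prod_ofFn, map_list_prod, List.map_ofFn]
  congr 2
  ext1 j
  exact hMat_eq_diagHom _ _

theorem prod_hMat_mul_ite (X : Fin (n + 1) → ℂˣ) (j : Fin (n + 1)) (c : ℂˣ) :
    (List.ofFn fun i : Fin (n + 1) =>
        (hMat i.1 (X i * if i = j then c else 1) : GL (Fin n) ℂ)).prod =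
      (List.ofFn fun i : Fin (n + 1) => hMat i.1 (X i)).prod * hMat j.1 c := by
  rw [prod_hMat, prod_hMat, hMat_eq_diagHom, ← map_mul]
  congr 1
  have : (fun k : Fin n => if k.1 < j.1 then c else 1) =
      ∏ i : Fin (n + 1), fun k : Fin n => if k.1 < i.1 then (if i = j then c else 1) else 1 := by
    rw [Finset.prod_eq_single j]
    · simp
    · intro i _ hi
      ext1 k
      simp [hi]
    · simp
  rw [this, ← Finset.prod_mul_distrib]
  refine Finset.prod_congr rfl fun i _ => ?_
  ext1 k
  simp only [Pi.mul_apply]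
  split_ifs <;> simp

theorem faceBefore_ne_inr (w : List (Letter n)) {m : ℕ} (j : Fin (n + 1)) {k : Fin w.length}
    (hk : m ≤ k.1) : faceBefore w m j ≠ .inr k := by
  induction m with
  | zero => simp [faceBefore]
  | succ m ih =>
    rw [faceBefore]
    split_ifs
    · simp only [ne_eq, Sum.inr.injEq, Fin.ext_iff]; omega
    · exact ih (by omega)
    · exact ih (by omega)

theorem chiPart_congr (w : List (Letter n)) {X Y : Face w → ℂˣ} {m : ℕ} (hm : m ≤ w.length)
    (h₀ : ∀ j, X (.inl j) = Y (.inl j))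
    (h₁ : ∀ k : Fin w.length, k.1 < m → X (.inr k) = Y (.inr k)) :
    chiPart w X m = chiPart w Y m := by
  induction m with
  | zero => simp [chiPart, h₀]
  | succ m ih =>
    rw [chiPart_succ _ _ hm, chiPart_succ _ _ hm, h₁ ⟨m, hm⟩ (Nat.lt_succ_self m),
      ih (Nat.le_of_succ_le hm) fun k hk => h₁ k (hk.trans (Nat.lt_succ_self m))]

theorem chiPart_mul_inr (w : List (Letter n)) (X : Face w → ℂˣ) {m : ℕ} (hm : m ≤ w.length)
    (k : Fin w.length) (hk : m ≤ k.1) (c : ℂˣ) :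
    chiPart w (fun f => X f * if f = .inr k then c else 1) m = chiPart w X m := by
  refine chiPart_congr w hm (by simp) fun l hl => ?_
  rw [if_neg, mul_one]
  simp only [Sum.inr.injEq, Fin.ext_iff]
  omega

/-- Multiplying the coordinate of the last face in the spacing `j` by `c` multiplies the partial
product by `h^j(c)`. -/
theorem chiPart_mul_faceBefore (w : List (Letter n)) (X : Face w → ℂˣ) {m : ℕ} (hm : m ≤ w.length)
    (j : Fin (n + 1)) (c : ℂˣ) :
    chiPart w (fun f => X f * if f = faceBefore w m j then c else 1) m =
      chiPart w X m * hMat j.1 c := by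
  induction m with
  | zero =>
    simp only [chiPart, List.take_zero, List.prod_nil, mul_one, faceBefore, Sum.inl.injEq]
    exact prod_hMat_mul_ite _ _ _
  | succ m ih =>
    have hm' : m < w.length := hm
    rw [chiPart_succ _ _ hm', chiPart_succ _ _ hm']
    by_cases h : w[m].spacing = j
    · have : faceBefore w (m + 1) j = .inr ⟨m, hm'⟩ := by simp [faceBefore, hm', h]
      rw [this, chiPart_mul_inr w X hm'.le ⟨m, hm'⟩ le_rfl, if_pos rfl, hMat_mul, h]
      simp only [mul_assoc]
    · have : faceBefore w (m + 1) j = faceBefore w m j := by simp [faceBefore, hm', h]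
      -- The last face in spacing `j` lies to the left of this edge, and its factor passes the
      -- letter because the letter belongs to another spacing.
      rw [this, ih hm'.le, if_neg (faceBefore_ne_inr w j (k := ⟨m, hm'⟩) le_rfl).symm, mul_one,
        mul_assoc, ← mul_assoc (hMat j.1 c), hMat_mul_letterMat _ _ _ (fun e => h (Fin.ext e)),
        mul_assoc, hMat_mul_comm, mul_assoc, mul_assoc]

/-- The new 3-cycle touches the face born at this edge and two faces that are the last ones in their
spacings. Its contributions to those two can be moved to the right end of the partial product, so
adding the edge is multiplication by one matrix on the right. -/
theorem chiPart_pPart_succ (w : List (Letter n)) (A : Face w → ℂˣ) {m : ℕ} (hm : m < w.length)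
    {j₁ j₂ : Fin (n + 1)} (h : blackCycle w ⟨m, hm⟩ =
      (faceBefore w m j₁, faceBefore w m j₂, .inr ⟨m, hm⟩)) :
    chiPart w (pPart w A (m + 1)) (m + 1) = chiPart w (pPart w A m) m *
      (hMat j₁.1 (A (faceBefore w m j₂) / A (.inr ⟨m, hm⟩)) *
        hMat j₂.1 (A (.inr ⟨m, hm⟩) / A (faceBefore w m j₁)) * letterMat w[m] *
        hMat w[m].spacing.1 (A (faceBefore w m j₁) / A (faceBefore w m j₂))) := by
  have hX : pPart w A (m + 1) = fun f => pPart w A m f *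
      (if f = faceBefore w m j₁ then A (faceBefore w m j₂) / A (.inr ⟨m, hm⟩) else 1) *
      (if f = faceBefore w m j₂ then A (.inr ⟨m, hm⟩) / A (faceBefore w m j₁) else 1) *
      (if f = .inr ⟨m, hm⟩ then A (faceBefore w m j₁) / A (faceBefore w m j₂) else 1) := by
    ext1 f
    rw [pPart_succ w A hm, cyclePart, h]
    simp only [mul_assoc]
  -- The face to the right of an edge occurs in no earlier 3-cycle.
  have h1 : pPart w A m (.inr ⟨m, hm⟩) = 1 := by
    refine Finset.prod_eq_one fun k hk => ?_
    have hk' : k.1 < m := by simpa using hk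
    have hne : (Sum.inr ⟨m, hm⟩ : Face w) ≠ .inr k := by simp [Fin.ext_iff]; omega
    have hb : ∀ j, (Sum.inr ⟨m, hm⟩ : Face w) ≠ faceBefore w k j :=
      fun j => (faceBefore_ne_inr w j hk'.le).symm
    rw [cyclePart, if_neg, if_neg, if_neg, mul_one, mul_one] <;> rw [blackCycle] <;> split_ifs
    exacts [hne, hne, hb _, hb _, hb _, hb _]
  rw [chiPart_succ _ _ hm, hX, chiPart_mul_inr w _ hm.le ⟨m, hm⟩ le_rfl,
    chiPart_mul_faceBefore w _ hm.le, chiPart_mul_faceBefore w _ hm.le]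
  beta_reduce
  rw [h1,
    if_neg (faceBefore_ne_inr w j₁ (k := ⟨m, hm⟩) le_rfl).symm,
    if_neg (faceBefore_ne_inr w j₂ (k := ⟨m, hm⟩) le_rfl).symm, if_pos rfl]
  simp only [mul_assoc, one_mul]

/-- At each edge the new right factor of the partial product is the matrix that carries the vectors
before the edge to those after it; `TakesTo` composes accordingly. -/
theorem takesTo_chiPart {V : Type*} [AddCommGroup V] [Module ℂ V] {u v : Equiv.Perm (Fin n)}
    {w : List (Letter n)} (hw : IsReducedPair w u v) (a : Module.Basis (Fin n) ℂ V)
    (x : GL (Fin n) ℂ) (hx : ∀ f, faceMinor w x f ≠ 0) {m : ℕ} (hm : m ≤ w.length) :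
    TakesTo (chiPart w (pPart w (psiMap w x hx) m) m) (xiAt w a x 0) (xiAt w a x m) := by
  induction m with
  | zero =>
    have : chiPart w (pPart w (psiMap w x hx) 0) 0 = 1 := by
      simp [chiPart, pPart_zero, hMat_one]
    rw [this]
    exact takesTo_one _
  | succ m ih =>
    have hm' : m < w.length := hm
    have hA : ∀ j, ((psiMap w x hx (faceBefore w m j) : ℂˣ) : ℂ) = minorAt w x m j :=
      fun j => faceMinor_faceBefore w x hm'.le j
    have hR : ((psiMap w x hx (.inr ⟨m, hm'⟩) : ℂˣ) : ℂ) = minorAt w x (m + 1) (w[m].idx + 1) :=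
      faceMinor_inr w x ⟨m, hm'⟩
    have hne := topIdx_ne_botIdx w[m].idx
    rcases hp : w[m].pos
    · have hc : blackCycle w ⟨m, hm'⟩ = (faceBefore w m ⟨w[m].idx.1, by omega⟩,
          faceBefore w m w[m].spacing, .inr ⟨m, hm'⟩) := by
        simp [blackCycle, hp]
      rw [chiPart_pPart_succ w _ hm' hc]
      refine (ih hm'.le).mul ?_
      rw [letterMat, hp]
      refine takesTo_neg w[m].idx _ _ _ ?_ fun r hr => xiAt_succ a x hm' ?_
      · rw [hA, hA, hR]
        exact xiAt_step_neg hw a x hm' hp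
      · rw [endColour, if_neg hr, hp]
        split_ifs <;> simp_all
    · have hc : blackCycle w ⟨m, hm'⟩ = (faceBefore w m w[m].spacing,
          faceBefore w m ⟨w[m].idx.1 + 2, by omega⟩, .inr ⟨m, hm'⟩) := by
        simp [blackCycle, hp]
      rw [chiPart_pPart_succ w _ hm' hc]
      refine (ih hm'.le).mul ?_
      rw [letterMat, hp]
      refine takesTo_pos w[m].idx _ _ _ ?_ fun r hr => xiAt_succ a x hm' ?_
      · rw [hA, hA, hR]
        exact xiAt_step_pos hw a x hm' hp
      · rw [endColour]
        split_ifs <;> simp_all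

/-- `χ̃ ∘ p̃ ∘ ψ̃(x)` takes `(ξ_1, …, ξ_n)` to `(η_1, …, η_n)`. -/
theorem takesTo_chiMap {V : Type*} [AddCommGroup V] [Module ℂ V] {u v : Equiv.Perm (Fin n)}
    {w : List (Letter n)} (hw : IsReducedPair w u v) (a : Module.Basis (Fin n) ℂ V)
    (x : GL (Fin n) ℂ) (hx : ∀ f, faceMinor w x f ≠ 0) :
    TakesTo (chiMap w (pMap w (psiMap w x hx))) (xi w a x) (eta w a x) := by
  have := takesTo_chiPart hw a x hx le_rfl
  rw [pPart_length, chiPart_length] at this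
  intro j
  rw [eta_eq, ← this j]
  simp only [xi_eq]

end DoubleBruhat

namespace DoubleBruhat

variable {n : ℕ}

/-! ### Triangular, diagonal and permutation matrices -/

theorem IsUpper.mul {b c : GL (Fin n) ℂ} (hb : IsUpper b) (hc : IsUpper c) : IsUpper (b * c) :=
  fun _ _ h => Matrix.BlockTriangular.mul (b := id) (M := b.1) (N := c.1) (fun _ _ h => hb _ _ h)
    (fun _ _ h => hc _ _ h) h

theorem IsLower.mul {b c : GL (Fin n) ℂ} (hb : IsLower b) (hc : IsLower c) : IsLower (b * c) :=
  fun _ _ h => Matrix.BlockTriangular.mul (b := OrderDual.toDual) (M := b.1) (N := c.1)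
    (fun _ _ h => hb _ _ h) (fun _ _ h => hc _ _ h) h

theorem IsUpper.inv {b : GL (Fin n) ℂ} (hb : IsUpper b) : IsUpper b⁻¹ := by
  have : Matrix.BlockTriangular b.1⁻¹ id :=
    Matrix.blockTriangular_inv_of_blockTriangular fun i j h => hb i j h
  intro i j h
  rw [Matrix.coe_units_inv]
  exact this h

theorem IsLower.inv {b : GL (Fin n) ℂ} (hb : IsLower b) : IsLower b⁻¹ := by
  have : Matrix.BlockTriangular b.1⁻¹ OrderDual.toDual :=
    Matrix.blockTriangular_inv_of_blockTriangular fun i j h => hb i j h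
  intro i j h
  rw [Matrix.coe_units_inv]
  exact this h

theorem det_ne_zero (b : GL (Fin n) ℂ) : b.1.det ≠ 0 :=
  ((Matrix.isUnit_iff_isUnit_det b.1).1 b.isUnit).ne_zero

theorem IsUpper.apply_ne_zero {b : GL (Fin n) ℂ} (hb : IsUpper b) (i : Fin n) : b.1 i i ≠ 0 := by
  have h := det_ne_zero b
  rw [Matrix.det_of_isUpperTriangular fun i j h => hb i j h, Finset.prod_ne_zero_iff] at h
  exact h i (Finset.mem_univ i)

theorem IsLower.apply_ne_zero {b : GL (Fin n) ℂ} (hb : IsLower b) (i : Fin n) : b.1 i i ≠ 0 := by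
  have h := det_ne_zero b
  rw [Matrix.det_of_isLowerTriangular _ fun i j h => hb i j h, Finset.prod_ne_zero_iff] at h
  exact h i (Finset.mem_univ i)

theorem diagHom_val (d : Fin n → ℂˣ) : (diagHom d).1 = Matrix.diagonal fun i => (d i : ℂ) := rfl

theorem isUpper_diagHom (d : Fin n → ℂˣ) : IsUpper (diagHom d) := fun i j h => by
  rw [diagHom_val, Matrix.diagonal_apply_ne _ h.ne']

theorem isLower_diagHom (d : Fin n → ℂˣ) : IsLower (diagHom d) := fun i j h => by
  rw [diagHom_val, Matrix.diagonal_apply_ne _ h.ne]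

/-- The transpose of an invertible matrix. -/
def transposeGL (x : GL (Fin n) ℂ) : GL (Fin n) ℂ where
  val := x.1.transpose
  inv := (x⁻¹).1.transpose
  val_inv := by rw [← Matrix.transpose_mul, ← Units.val_mul, inv_mul_cancel]; simp
  inv_val := by rw [← Matrix.transpose_mul, ← Units.val_mul, mul_inv_cancel]; simp

theorem transposeGL_mul (x y : GL (Fin n) ℂ) :
    transposeGL (x * y) = transposeGL y * transposeGL x :=
  Units.ext (Matrix.transpose_mul _ _)

theorem transposeGL_inv (x : GL (Fin n) ℂ) : transposeGL x⁻¹ = (transposeGL x)⁻¹ := rfl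

theorem transposeGL_transposeGL (x : GL (Fin n) ℂ) : transposeGL (transposeGL x) = x :=
  Units.ext (Matrix.transpose_transpose _)

theorem transposeGL_diagHom (d : Fin n → ℂˣ) : transposeGL (diagHom d) = diagHom d :=
  Units.ext (Matrix.diagonal_transpose _)

theorem IsUpper.transposeGL {b : GL (Fin n) ℂ} (hb : IsUpper b) : IsLower (transposeGL b) :=
  fun i j h => hb j i h

theorem IsLower.transposeGL {b : GL (Fin n) ℂ} (hb : IsLower b) : IsUpper (transposeGL b) :=
  fun i j h => hb j i h

theorem permMat_mul (w w' : Equiv.Perm (Fin n)) : permMat (w * w') = permMat w * permMat w' := by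
  ext i j
  by_cases h : i = w (w' j) <;> simp [permMat, Matrix.mul_apply, h]

theorem permMat_one : permMat (1 : Equiv.Perm (Fin n)) = 1 := by
  ext i j
  by_cases h : i = j <;> simp [permMat, Matrix.one_apply, h]

theorem permMat_transpose (w : Equiv.Perm (Fin n)) : (permMat w).transpose = permMat w⁻¹ := by
  ext i j
  rw [Matrix.transpose_apply, permMat, permMat, Matrix.of_apply, Matrix.of_apply]
  simp only [Equiv.Perm.eq_inv_iff_eq, eq_comm]

/-- Permutation matrices. -/
def permGL : Equiv.Perm (Fin n) →* GL (Fin n) ℂ where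
  toFun w := ⟨permMat w, permMat w⁻¹, by rw [← permMat_mul, mul_inv_cancel, permMat_one],
    by rw [← permMat_mul, inv_mul_cancel, permMat_one]⟩
  map_one' := Units.ext permMat_one
  map_mul' w w' := Units.ext (permMat_mul w w')

theorem permGL_val (w : Equiv.Perm (Fin n)) : (permGL w).1 = permMat w := rfl

theorem transposeGL_permGL (w : Equiv.Perm (Fin n)) : transposeGL (permGL w) = (permGL w)⁻¹ := by
  rw [← map_inv]
  exact Units.ext (permMat_transpose w)

theorem permMat_mul_apply (w : Equiv.Perm (Fin n)) (M : Matrix (Fin n) (Fin n) ℂ) (i j : Fin n) :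
    (permMat w * M) i j = M (w⁻¹ i) j := by
  simp [permMat, Matrix.mul_apply, ← Equiv.Perm.inv_eq_iff_eq]

theorem mul_permMat_apply (w : Equiv.Perm (Fin n)) (M : Matrix (Fin n) (Fin n) ℂ) (i j : Fin n) :
    (M * permMat w) i j = M i (w j) := by
  simp [permMat, Matrix.mul_apply]

theorem diagHom_mul_permGL (d : Fin n → ℂˣ) (w : Equiv.Perm (Fin n)) :
    diagHom d * permGL w = permGL w * diagHom (d ∘ w) := by
  ext i j
  simp only [Units.val_mul, diagHom_val, permGL_val, Matrix.diagonal_mul, Matrix.mul_diagonal,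
    permMat, Matrix.of_apply, Function.comp_apply]
  by_cases h : i = w j <;> simp [h]

/-- This is the identity in `SL₂` that writes the lower unipotent matrix as upper unipotent, Weyl
element, upper unipotent. It computes `sBar` and also drives the multiplication of Bruhat cells. -/
theorem elem_eq {p q : Fin n} (hpq : p ≠ q) : elem q p hpq.symm =
    elem p q hpq * (permGL (Equiv.swap p q) * diagHom (Function.update 1 q (-1))) *
      elem p q hpq := by
  apply Units.ext
  have hv : ∀ (r s : Fin n) h, (elem r s h).1 = Matrix.transvection r s 1 := fun _ _ _ => rfl
  rw [Units.val_mul, Units.val_mul, hv, hv]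
  have hS : ∀ i j, (permGL (Equiv.swap p q) * diagHom (Function.update 1 q (-1))).1 i j =
      if i = Equiv.swap p q j then (if j = q then -1 else 1) else 0 := by
    intro i j
    simp only [Units.val_mul, diagHom_val, permGL_val, Matrix.mul_diagonal, permMat,
      Matrix.of_apply, Function.update_apply]
    split_ifs <;> simp
  generalize (permGL (Equiv.swap p q) * diagHom (Function.update 1 q (-1))).1 = S at hS
  have hTS : ∀ i j, (Matrix.transvection p q (1 : ℂ) * S) i j =
      S i j + if i = p then S q j else 0 := by
    intro i j
    by_cases h : i = p
    · subst h; simp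
    · simp [h]
  ext i j
  have hR : (Matrix.transvection q p (1 : ℂ)) i j = (if i = j then 1 else 0) +
      if q = i ∧ p = j then 1 else 0 := by
    simp [Matrix.transvection, Matrix.one_apply, Matrix.single_apply]
  rw [hR]
  by_cases hj : j = q
  · subst hj
    rw [Matrix.mul_transvection_apply_same, hTS, hTS, hS, hS, hS, hS]
    simp only [Equiv.swap_apply_left, Equiv.swap_apply_right, hpq, if_true, if_false, hpq.symm]
    by_cases h1 : i = p
    · subst h1; simp [hpq]
    · by_cases h2 : i = j
      · subst h2; simp [hpq.symm]
      · simp [h1, h2]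
  · rw [Matrix.mul_transvection_apply_of_ne _ _ _ _ hj, hTS, hS, hS]
    by_cases hj' : j = p
    · subst hj'
      by_cases h1 : i = j
      · subst h1; simp [hpq, hpq.symm]
      · simp [h1, hpq, eq_comm]
    · rw [Equiv.swap_apply_of_ne_of_ne hj' hj]
      simp [hj, Ne.symm hj, Ne.symm hj']

theorem sBar_eq (i : Fin (n - 1)) : sBar i = permGL (simpleReflection i) *
    diagHom (Function.update 1 (botIdx i) (-1)) := by
  rw [sBar, eNeg, elem_eq (topIdx_ne_botIdx i), ePos, simpleReflection]
  group

/-- The signs of the lift need not be known: they form a diagonal matrix, which the triangular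
factors absorb. -/
theorem exists_wordLift_eq (a : List (Fin (n - 1))) :
    ∃ d, wordLift a = permGL (spell a) * diagHom d := by
  induction a with
  | nil => exact ⟨1, by simp [wordLift]⟩
  | cons i a ih =>
    obtain ⟨d, hd⟩ := ih
    have : wordLift (i :: a) = sBar i * wordLift a := by simp [wordLift]
    refine ⟨(Function.update (1 : Fin n → ℂˣ) (botIdx i) (-1)) ∘ spell a * d, ?_⟩
    rw [this, hd, sBar_eq, spell_cons, map_mul, map_mul, mul_assoc,
      ← mul_assoc (diagHom _) (permGL _), diagHom_mul_permGL]
    simp only [mul_assoc]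

/-! ### Gaussian decompositions -/

/-- The diagonal of an invertible triangular matrix. -/
def diagUnits (b : GL (Fin n) ℂ) (h : ∀ i, b.1 i i ≠ 0) (i : Fin n) : ℂˣ := Units.mk0 _ (h i)

/-- Any product of a lower and an upper triangular matrix will do: both diagonals are moved to the
middle. -/
theorem isGaussian_mul {l p : GL (Fin n) ℂ} (hl : IsLower l) (hp : IsUpper p) :
    IsGaussian (l * p) (l * (diagHom (diagUnits l hl.apply_ne_zero))⁻¹)
      (diagHom (diagUnits l hl.apply_ne_zero) * diagHom (diagUnits p hp.apply_ne_zero))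
      ((diagHom (diagUnits p hp.apply_ne_zero))⁻¹ * p) := by
  refine ⟨⟨?_, fun i => ?_⟩, ?_, ⟨?_, fun i => ?_⟩, by group⟩
  · rw [← map_inv]
    exact hl.mul (isLower_diagHom _)
  · rw [← map_inv, Units.val_mul, diagHom_val, Matrix.mul_diagonal]
    simp [diagUnits, hl.apply_ne_zero i]
  · rw [← map_mul]
    exact Matrix.isDiag_diagonal _
  · rw [← map_inv]
    exact (isUpper_diagHom _).mul hp
  · rw [← map_inv, Units.val_mul, diagHom_val, Matrix.diagonal_mul]
    simp [diagUnits, hp.apply_ne_zero i]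

/-- If `P_u⁻¹ E` and `Ξ` are upper triangular and `xᵗ E` and `P_v xᵗ Ξ` are lower triangular, then
`Ξ⁻¹ E` agrees up to diagonal matrices with the transpose of the twist of `x`. -/
theorem exists_gaussian {u v : Equiv.Perm (Fin n)} {ru rv : List (Fin (n - 1))}
    (hru : spell ru = u) (hrv : spell rv = v⁻¹) {x g Ξ E : GL (Fin n) ℂ} (hg : Ξ * g = E)
    (hΞ : IsUpper Ξ) (hΞ' : IsLower (permGL v * transposeGL x * Ξ))
    (hE : IsUpper ((permGL u)⁻¹ * E)) (hE' : IsLower (transposeGL x * E)) :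
    ∃ m₁ h₁ p₁ m₂ h₂ p₂ : GL (Fin n) ℂ,
      IsGaussian ((wordLift ru)⁻¹ * x) m₁ h₁ p₁ ∧ IsGaussian (x * wordLift rv) m₂ h₂ p₂ ∧
      ∃ D D' : Fin n → ℂˣ, g.1 = Matrix.diagonal (fun i => (D i : ℂ)) *
        (m₁⁻¹ * (wordLift ru)⁻¹ * x * wordLift rv * p₂⁻¹).1.transpose *
          Matrix.diagonal (fun i => (D' i : ℂ)) := by
  obtain ⟨δ, hδ⟩ := exists_wordLift_eq ru
  obtain ⟨δ', hδ'⟩ := exists_wordLift_eq rv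
  rw [hru] at hδ
  rw [hrv, map_inv] at hδ'
  set T := transposeGL ((permGL u)⁻¹ * E) with hT
  have hT' : T = transposeGL E * permGL u := by
    rw [hT, transposeGL_mul, transposeGL_inv, transposeGL_permGL, inv_inv]
  have hl₁ : IsLower ((diagHom δ)⁻¹ * T⁻¹) := by
    rw [← map_inv]
    exact (isLower_diagHom _).mul hE.transposeGL.inv
  have hp₁ : IsUpper (transposeGL (transposeGL x * E)) := hE'.transposeGL
  have hl₂ : IsLower (transposeGL Ξ)⁻¹ := hΞ.transposeGL.inv
  have hp₂ : IsUpper (transposeGL (permGL v * transposeGL x * Ξ) * diagHom δ') :=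
    hΞ'.transposeGL.mul (isUpper_diagHom _)
  -- From `x = E⁻ᵗ · Eᵗ x`: the second factor is upper triangular, and the first becomes lower
  -- triangular after multiplication by `P_u⁻¹` on the left.
  have e₁ : (wordLift ru)⁻¹ * x = (diagHom δ)⁻¹ * T⁻¹ * transposeGL (transposeGL x * E) := by
    rw [hδ, hT', transposeGL_mul, transposeGL_transposeGL]
    group
  -- From `x = Ξ⁻ᵗ · Ξᵗ x`: here the first factor is lower triangular, and the second becomes upper
  -- triangular after multiplication by `P_v⁻¹` on the right.
  have e₂ : x * wordLift rv =
      (transposeGL Ξ)⁻¹ * (transposeGL (permGL v * transposeGL x * Ξ) * diagHom δ') := by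
    rw [hδ', transposeGL_mul, transposeGL_mul, transposeGL_transposeGL, transposeGL_permGL]
    group
  have G₁ := isGaussian_mul hl₁ hp₁
  have G₂ := isGaussian_mul hl₂ hp₂
  rw [← e₁] at G₁
  rw [← e₂] at G₂
  refine ⟨_, _, _, _, _, _, G₁, G₂, (diagUnits _ hp₂.apply_ne_zero)⁻¹,
    (diagUnits _ hl₁.apply_ne_zero)⁻¹, ?_⟩
  generalize diagUnits _ hp₂.apply_ne_zero = d₂
  generalize diagUnits _ hl₁.apply_ne_zero = d₁
  have key : g = diagHom d₂⁻¹ * transposeGL ((((diagHom δ)⁻¹ * T⁻¹ * (diagHom d₁)⁻¹)⁻¹ *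
      (wordLift ru)⁻¹ * x * wordLift rv * ((diagHom d₂)⁻¹ *
        (transposeGL (permGL v * transposeGL x * Ξ) * diagHom δ'))⁻¹)) * diagHom d₁⁻¹ := by
    -- All factors cancel except `Eᵗ Ξ⁻ᵗ` between two diagonal matrices, and its transpose is `Ξ⁻¹ E
    -- = g`.
    have : ((diagHom δ)⁻¹ * T⁻¹ * (diagHom d₁)⁻¹)⁻¹ *
      (wordLift ru)⁻¹ * x * wordLift rv * ((diagHom d₂)⁻¹ *
        (transposeGL (permGL v * transposeGL x * Ξ) * diagHom δ'))⁻¹ =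
        diagHom d₁ * transposeGL E * (transposeGL Ξ)⁻¹ * diagHom d₂ := by
      rw [mul_assoc _ x, e₂, hδ, hT']
      group
    rw [this]
    simp only [transposeGL_mul, transposeGL_inv, transposeGL_transposeGL, transposeGL_diagHom,
      map_inv, ← hg]
    group
  exact congrArg Units.val key

/-! ### The matrices of the dual vectors -/

section Dual

variable {V : Type*} [AddCommGroup V] [Module ℂ V] (a : Module.Basis (Fin n) ℂ V)
  (x : GL (Fin n) ℂ)

theorem contraction_basis_eq_zero {I J : Finset (Fin n)} (hIJ : I.card = J.card + 1) {s : Fin n}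
    (hs : s ∉ I) : contraction a.coord (translate a x) I J (a s) = 0 := by
  rw [contraction_apply a x hIJ rfl, colDet]
  refine Matrix.det_eq_zero_of_row_eq_zero (Fin.last _) fun t => ?_
  rw [Matrix.of_apply, Fin.snoc_last, a.repr_self, Finsupp.single_apply, if_neg]
  rintro rfl
  exact hs (Finset.orderEmbOfFin_mem _ _ _)

theorem repr_translate (j : Fin n) : ⇑(a.repr (translate a x j)) = colVec x j := by
  ext i
  exact coord_translate a x i j

theorem contraction_translate_eq_zero {I J : Finset (Fin n)} (hIJ : I.card = J.card + 1)
    {j : Fin n} (hj : j ∈ J) : contraction a.coord (translate a x) I J (translate a x j) = 0 := by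
  rw [contraction_apply a x hIJ rfl, colDet, repr_translate]
  obtain ⟨t, ht⟩ : j ∈ Set.range (J.orderEmbOfFin rfl) := by
    rw [Finset.range_orderEmbOfFin]; exact hj
  refine Matrix.det_zero_of_row_eq (i := t.castSucc) (j := Fin.last _) (Fin.castSucc_lt_last t).ne ?_
  ext s
  simp [ht]

/-- Expanding along the unit vector that represents `a p` removes the row `p`, so the value is the
minor of `I` and `J` up to sign. -/
theorem contraction_insert_basis_ne_zero {I J : Finset (Fin n)} (hIJ : I.card = J.card)
    {p : Fin n} (hp : p ∉ I) (h : minor x I J ≠ 0) :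
    contraction a.coord (translate a x) (insert p I) J (a p) ≠ 0 := by
  have e : (insert p I).card = J.card + 1 := by rw [Finset.card_insert_of_notMem hp, hIJ]
  rw [minor_eq_colDet x hIJ rfl] at h
  rw [contraction_apply a x e rfl, colDet_insert_row hIJ, colDet, comp_snoc, det_snoc]
  have : (fun s => a.repr (a p) ((Matrix.vecCons p (I.orderEmbOfFin hIJ) :
      Fin (J.card + 1) → Fin n) s)) = Pi.single 0 1 := by
    ext s
    rw [a.repr_self]
    refine Fin.cases ?_ (fun s => ?_) s
    · simp
    · rw [Matrix.cons_val_succ, Finsupp.single_apply, if_neg, Pi.single_eq_of_ne]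
      · exact Fin.succ_ne_zero s
      · rintro rfl
        exact hp (Finset.orderEmbOfFin_mem _ _ _)
  rw [this, det_vecCons_single_zero]
  exact mul_ne_zero (by simp [insertSign]) (mul_ne_zero (by simp) h)

/-- The coordinates of a family of dual vectors, as columns. -/
def dualMat (ξ : Fin n → Module.Dual ℂ V) : Matrix (Fin n) (Fin n) ℂ := Matrix.of fun s r => ξ r (a s)

theorem isBasis_of_det_ne_zero {ξ : Fin n → Module.Dual ℂ V} (h : (dualMat a ξ).det ≠ 0) :
    IsBasis ξ := by
  have hli : LinearIndependent ℂ ξ := by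
    rw [Fintype.linearIndependent_iff]
    intro c hc
    have : (dualMat a ξ).mulVec c = 0 := by
      ext s
      have := congrArg (fun φ => φ (a s)) hc
      simpa [Matrix.mulVec, dotProduct, dualMat, mul_comm] using this
    exact fun i => congrFun (Matrix.eq_zero_of_mulVec_eq_zero h this) i
  refine ⟨hli, ?_⟩
  have : FiniteDimensional ℂ V := Module.Basis.finiteDimensional_of_finite a
  refine hli.span_eq_top_of_card_eq_finrank' ?_
  rw [Subspace.dual_finrank_eq, Module.finrank_eq_card_basis a]

theorem takesTo_iff {g : GL (Fin n) ℂ} {ξ η : Fin n → Module.Dual ℂ V} :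
    TakesTo g ξ η ↔ dualMat a ξ * g.1 = dualMat a η := by
  constructor
  · intro h
    ext s j
    rw [dualMat, dualMat, Matrix.of_apply, ← h j, Matrix.mul_apply]
    simp [mul_comm]
  · intro h j
    refine a.ext fun s => ?_
    have := congrFun (congrFun h s) j
    rw [Matrix.mul_apply] at this
    simpa [dualMat, mul_comm] using this

theorem apply_translate (ξ : Fin n → Module.Dual ℂ V) (r j : Fin n) :
    ξ r (translate a x j) = (x.1.transpose * dualMat a ξ) j r := by
  simp [translate, Matrix.mul_apply, dualMat]

theorem uPre_length {u v : Equiv.Perm (Fin n)} {w : List (Letter n)} (hw : IsReducedPair w u v) :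
    uPre w w.length = u := by
  rw [uPre, List.take_length]
  exact hw.1.1

theorem vSuf_zero {u v : Equiv.Perm (Fin n)} {w : List (Letter n)} (hw : IsReducedPair w u v) :
    vSuf w 0 = v := hw.2.1

theorem card_rowSet (w : List (Letter n)) (k : ℕ) (r : Fin n) :
    (rowSet w k (r.1 + 1)).card = (colSet w k r.1).card + 1 := by
  rw [rowSet, colSet, card_initSet _ r.2, card_initSet _ r.2.le]

variable {u v : Equiv.Perm (Fin n)} {w : List (Letter n)}

theorem dualMat_xi_apply_eq_zero {s r : Fin n} (h : r < s) : dualMat a (xi w a x) s r = 0 := by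
  rw [dualMat, Matrix.of_apply, xi_eq]
  refine contraction_basis_eq_zero a x (card_rowSet _ _ _) ?_
  rw [rowSet, uPre_zero, mem_initSet]
  simpa using h

theorem dualMat_eta_apply_eq_zero (hw : IsReducedPair w u v) {s r : Fin n} (h : r < u⁻¹ s) :
    dualMat a (eta w a x) s r = 0 := by
  rw [dualMat, Matrix.of_apply, eta_eq]
  refine contraction_basis_eq_zero a x (card_rowSet _ _ _) ?_
  rw [rowSet, uPre_length hw, mem_initSet]
  simpa using h

theorem transpose_mul_dualMat_xi (hw : IsReducedPair w u v) {j r : Fin n} (h : v j < r) :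
    (x.1.transpose * dualMat a (xi w a x)) j r = 0 := by
  rw [← apply_translate, xi_eq]
  refine contraction_translate_eq_zero a x (card_rowSet _ _ _) ?_
  rw [colSet, vSuf_zero hw, mem_initSet, inv_inv]
  exact h

theorem transpose_mul_dualMat_eta {j r : Fin n} (h : j < r) :
    (x.1.transpose * dualMat a (eta w a x)) j r = 0 := by
  rw [← apply_translate, eta_eq]
  refine contraction_translate_eq_zero a x (card_rowSet _ _ _) ?_
  rw [colSet, vSuf_of_length_le _ le_rfl, mem_initSet]
  simpa using h

/-- The matrix is upper triangular, and its diagonal entry on the line `r` is, up to sign, the minor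
of the leftmost face just above that line. -/
theorem det_dualMat_xi_ne_zero (hx : ∀ f, faceMinor w x f ≠ 0) :
    (dualMat a (xi w a x)).det ≠ 0 := by
  have ht : (dualMat a (xi w a x)).BlockTriangular id := fun s r h =>
    dualMat_xi_apply_eq_zero a x h
  rw [Matrix.det_of_isUpperTriangular ht,
    Finset.prod_ne_zero_iff]
  intro r _
  have hr : rowSet w 0 (r.1 + 1) = insert r (rowSet w 0 r.1) := by
    rw [rowSet, rowSet, uPre_zero, initSet_succ]; rfl
  rw [dualMat, Matrix.of_apply, xi_eq, xiAt, hr]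
  refine contraction_insert_basis_ne_zero a x ?_ ?_ ?_
  · rw [rowSet, colSet, card_initSet _ r.2.le, card_initSet _ r.2.le]
  · rw [rowSet, uPre_zero]
    exact notMem_initSet 1 r
  · have := hx (.inl ⟨r.1, by omega⟩)
    rwa [faceMinor_eq] at this

/-- The conclusion holds wherever the functions `A_f` do not vanish. -/
theorem conclusion_of_faceMinor_ne_zero (hw : IsReducedPair w u v) {ru rv : List (Fin (n - 1))}
    (hru : IsReducedWord ru u) (hrv : IsReducedWord rv v⁻¹) (hx : ∀ f, faceMinor w x f ≠ 0) :
    IsBasis (xi w a x) ∧ IsBasis (eta w a x) ∧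
      (∀ g : GL (Fin n) ℂ, TakesTo g (xi w a x) (eta w a x) ↔
        g = chiMap w (pMap w (psiMap w x hx))) ∧
      ∃ m₁ h₁ p₁ m₂ h₂ p₂ : GL (Fin n) ℂ,
        IsGaussian ((wordLift ru)⁻¹ * x) m₁ h₁ p₁ ∧
        IsGaussian (x * wordLift rv) m₂ h₂ p₂ ∧
        ∃ D D' : Fin n → ℂˣ, (chiMap w (pMap w (psiMap w x hx))).1 =
          Matrix.diagonal (fun i => (D i : ℂ)) *
            (m₁⁻¹ * (wordLift ru)⁻¹ * x * wordLift rv * p₂⁻¹).1.transpose *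
            Matrix.diagonal (fun i => (D' i : ℂ)) := by
  have hT := takesTo_chiMap hw a x hx
  set g₀ := chiMap w (pMap w (psiMap w x hx))
  have hΞ := det_dualMat_xi_ne_zero a x hx
  have hg := (takesTo_iff a).1 hT
  have hE : (dualMat a (eta w a x)).det ≠ 0 := by
    rw [← hg, Matrix.det_mul]
    exact mul_ne_zero hΞ (det_ne_zero g₀)
  refine ⟨isBasis_of_det_ne_zero a hΞ, isBasis_of_det_ne_zero a hE, fun g => ⟨fun h => ?_, ?_⟩, ?_⟩
  · apply Units.ext
    have h' := (takesTo_iff a).1 h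
    rw [← hg] at h'
    have hu : IsUnit (dualMat a (xi w a x)) :=
      (Matrix.isUnit_iff_isUnit_det _).2 (isUnit_iff_ne_zero.2 hΞ)
    exact hu.mul_left_cancel h'
  · rintro rfl
    exact hT
  · let Ξ : GL (Fin n) ℂ := Matrix.GeneralLinearGroup.mkOfDetNeZero _ hΞ
    let E : GL (Fin n) ℂ := Matrix.GeneralLinearGroup.mkOfDetNeZero _ hE
    refine exists_gaussian (v := v) (Ξ := Ξ) (E := E) hru.1 hrv.1 (Units.ext hg) ?_ ?_ ?_ ?_
    · exact fun s r h => dualMat_xi_apply_eq_zero a x h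
    · intro j r h
      rw [mul_assoc, Units.val_mul, permGL_val, permMat_mul_apply]
      exact transpose_mul_dualMat_xi a x hw (by simpa using h)
    · intro s r h
      rw [← map_inv, Units.val_mul, permGL_val, permMat_mul_apply]
      exact dualMat_eta_apply_eq_zero a x hw (by simpa using h)
    · exact fun j r h => transpose_mul_dualMat_eta a x h

end Dual

end DoubleBruhat

namespace DoubleBruhat

variable {n : ℕ}

/-! ### Products of elementary matrices in Bruhat cells -/

section Bruhat

variable {α : Type*} [LinearOrder α]

/-- The double coset of `w` for the group of the matrices that are triangular with respect to the
order given by `f`. -/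
def bruhatCell (f : Fin n → α) (w : Equiv.Perm (Fin n)) : Set (GL (Fin n) ℂ) :=
  {x | ∃ b b' : GL (Fin n) ℂ, b.1.BlockTriangular f ∧ b'.1.BlockTriangular f ∧
    x = b * permGL w * b'}

theorem one_mem_bruhatCell (f : Fin n → α) : 1 ∈ bruhatCell f (1 : Equiv.Perm (Fin n)) :=
  ⟨1, 1, Matrix.blockTriangular_one, Matrix.blockTriangular_one, by simp⟩

theorem mul_mem_bruhatCell {f : Fin n → α} {w : Equiv.Perm (Fin n)} {x b : GL (Fin n) ℂ}
    (hx : x ∈ bruhatCell f w) (hb : b.1.BlockTriangular f) : x * b ∈ bruhatCell f w := by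
  obtain ⟨c, c', hc, hc', rfl⟩ := hx
  exact ⟨c, c' * b, hc, hc'.mul hb, by simp only [mul_assoc]⟩

/-- The matrix `1 + t E_{p,q}`. -/
def transvectionGL {p q : Fin n} (hpq : p ≠ q) (t : ℂ) : GL (Fin n) ℂ where
  val := Matrix.transvection p q t
  inv := Matrix.transvection p q (-t)
  val_inv := by rw [Matrix.transvection_mul_transvection_same p q hpq]; simp
  inv_val := by rw [Matrix.transvection_mul_transvection_same p q hpq]; simp

theorem blockTriangular_transvection {f : Fin n → α} {p q : Fin n} (h : f p < f q) (t : ℂ) :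
    (Matrix.transvection p q t).BlockTriangular f := Matrix.blockTriangular_transvection h.le t

/-- This is the rule `BwB · sB ⊆ BwsB` for a length-increasing simple reflection. In `c w b e s δ
e`, the root factor of `b e` at `(p, q)` is moved to the left through `w`, and the remainder to the
right through `s`. -/
theorem mul_elem_mem_bruhatCell {f : Fin n → α} {p q : Fin n} (hpq : p ≠ q) (h : f p < f q)
    (hadj : ∀ i j, f i < f j → ¬ (i = p ∧ j = q) →
      f (Equiv.swap p q i) < f (Equiv.swap p q j))
    (hdiag : ∀ b : GL (Fin n) ℂ, b.1.BlockTriangular f → b.1 q q ≠ 0)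
    {w : Equiv.Perm (Fin n)} (hw : f (w p) < f (w q)) {x : GL (Fin n) ℂ}
    (hx : x ∈ bruhatCell f w) : x * elem q p hpq.symm ∈ bruhatCell f (w * Equiv.swap p q) := by
  obtain ⟨c, b, hc, hb, rfl⟩ := hx
  rw [elem_eq hpq]
  have he : (elem p q hpq).1.BlockTriangular f := blockTriangular_transvection h 1
  set s := Equiv.swap p q with hs
  set δ := diagHom (Function.update (1 : Fin n → ℂˣ) q (-1)) with hδ
  set e := elem p q hpq
  have hδ' : δ.1.BlockTriangular f := Matrix.blockTriangular_diagonal _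
  have hbe : (b * e).1.BlockTriangular f := hb.mul he
  -- Row operation that clears the entry `(p, q)` of `b * e`.
  set t := (b * e).1 p q / (b * e).1 q q
  have hss : s⁻¹ = s := Equiv.swap_inv _ _
  have hE := blockTriangular_transvection h (-t)
  -- Conjugation by `w` moves the off-diagonal entry to `(w p, w q)`, which is still on the
  -- triangular side because `f (w p) < f (w q)`.
  have h1 : (permGL w * transvectionGL hpq t * (permGL w)⁻¹).1.BlockTriangular f := by
    intro i j hij
    rw [mul_assoc, ← map_inv, Units.val_mul, Units.val_mul, permGL_val, permGL_val,
      permMat_mul_apply, mul_permMat_apply]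
    have hne : i ≠ j := fun e => by rw [e] at hij; exact lt_irrefl _ hij
    have hpq' : ¬ (p = w⁻¹ i ∧ q = w⁻¹ j) := by
      rintro ⟨e₁, e₂⟩
      rw [e₁, e₂] at hw
      have hi : ∀ k, w (w⁻¹ k) = k := fun k => by simp
      rw [hi, hi] at hw
      exact lt_asymm hw hij
    change (Matrix.transvection p q t) _ _ = 0
    simp only [Matrix.transvection, Matrix.add_apply, Matrix.single_apply, if_neg hpq', add_zero]
    exact Matrix.one_apply_ne fun e => hne (w⁻¹.injective e)
  -- Conjugation by `s` could break triangularity only at the entry `(p, q)`, which has been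
  -- cleared.
  have h2 : (permGL s * (transvectionGL hpq t)⁻¹ * (b * e) * permGL s).1.BlockTriangular f := by
    intro i j hij
    rw [mul_assoc, mul_assoc, Units.val_mul, permGL_val, permMat_mul_apply, ← mul_assoc,
      Units.val_mul, permGL_val, mul_permMat_apply, hss]
    change (Matrix.transvection p q (-t) * (b * e).1) (s i) (s j) = 0
    by_cases hc : j = p ∧ i = q
    · obtain ⟨rfl, rfl⟩ := hc
      rw [hs, Equiv.swap_apply_left, Equiv.swap_apply_right, Matrix.transvection_mul_apply_same]
      have := hdiag _ hbe
      simp only [t]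
      field_simp
      ring
    · exact hE.mul hbe (hadj j i hij hc)
  refine ⟨c * (permGL w * transvectionGL hpq t * (permGL w)⁻¹),
    (permGL s * (transvectionGL hpq t)⁻¹ * (b * e) * permGL s) * (δ * e),
    hc.mul h1, h2.mul (hδ'.mul he), ?_⟩
  have hs1 : permGL s * permGL s = 1 := by rw [← map_mul, Equiv.swap_mul_self, map_one]
  have hs2 : permGL s = (permGL s)⁻¹ := eq_inv_of_mul_eq_one_left hs1
  rw [map_mul]
  simp only [mul_assoc]
  rw [← mul_assoc (permGL s) (permGL s), hs1, one_mul]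
  group

end Bruhat

/-! ### Multiplication by a letter moves between double Bruhat cells. -/

theorem topIdx_lt_botIdx (i : Fin (n - 1)) : topIdx i < botIdx i :=
  Fin.lt_def.2 (Nat.lt_succ_self _)

theorem mul_eNeg_mem {w : Equiv.Perm (Fin n)} {i : Fin (n - 1)}
    (hw : w (topIdx i) < w (botIdx i)) {x : GL (Fin n) ℂ} (hx : x ∈ bruhatCell id w) :
    x * eNeg i ∈ bruhatCell id (w * simpleReflection i) :=
  mul_elem_mem_bruhatCell (f := id) (topIdx_ne_botIdx i) (topIdx_lt_botIdx i)
    (fun _ _ h h' => simpleReflection_lt (i := i) h h')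
    (fun b hb => IsUpper.apply_ne_zero (b := b) (fun _ _ h => hb h) _) (w := w) hw hx

theorem mul_ePos_mem {w : Equiv.Perm (Fin n)} {i : Fin (n - 1)}
    (hw : w (topIdx i) < w (botIdx i)) {x : GL (Fin n) ℂ}
    (hx : x ∈ bruhatCell OrderDual.toDual w) :
    x * ePos i ∈ bruhatCell OrderDual.toDual (w * simpleReflection i) := by
  have := mul_elem_mem_bruhatCell (f := OrderDual.toDual) (topIdx_ne_botIdx i).symm
    (topIdx_lt_botIdx i)
    (fun j k h h' => by
      rw [Equiv.swap_comm]
      exact simpleReflection_lt (i := i) h fun e => h' ⟨e.2, e.1⟩)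
    (fun b hb => IsLower.apply_ne_zero (b := b) (fun _ _ h => hb h) _) (w := w) hw hx
  rwa [Equiv.swap_comm] at this

theorem mem_cell_iff {u v : Equiv.Perm (Fin n)} {x : GL (Fin n) ℂ} :
    x ∈ cell u v ↔ x ∈ bruhatCell id u ∧ x ∈ bruhatCell OrderDual.toDual v := by
  constructor
  · rintro ⟨⟨b, b', hb, hb', h⟩, c, c', hc, hc', h'⟩
    exact ⟨⟨b, b', fun _ _ h => hb _ _ h, fun _ _ h => hb' _ _ h, Units.ext h⟩,
      c, c', fun _ _ h => hc _ _ h, fun _ _ h => hc' _ _ h, Units.ext h'⟩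
  · rintro ⟨⟨b, b', hb, hb', h⟩, c, c', hc, hc', h'⟩
    exact ⟨⟨b, b', fun _ _ h => hb h, fun _ _ h => hb' h, congrArg Units.val h⟩,
      c, c', fun _ _ h => hc h, fun _ _ h => hc' h, congrArg Units.val h'⟩

theorem mul_diagHom_mem_cell {u v : Equiv.Perm (Fin n)} {x : GL (Fin n) ℂ} (hx : x ∈ cell u v)
    (d : Fin n → ℂˣ) : x * diagHom d ∈ cell u v := by
  rw [mem_cell_iff] at hx ⊢
  exact ⟨mul_mem_bruhatCell hx.1 (Matrix.blockTriangular_diagonal _),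
    mul_mem_bruhatCell hx.2 (Matrix.blockTriangular_diagonal _)⟩

/-- The permutation spelled by the positive ones among the first `k` letters. -/
def vPre (w : List (Letter n)) (k : ℕ) : Equiv.Perm (Fin n) := spell (posWord (w.take k))

theorem vPre_succ {w : List (Letter n)} {k : ℕ} (h : k < w.length) :
    vPre w (k + 1) = vPre w k * spell (posWord [w[k]]) := by
  rw [vPre, vPre, ← List.take_concat_get' _ _ h, posWord_append, spell_append]

theorem vPre_lt {u v : Equiv.Perm (Fin n)} {w : List (Letter n)} (hw : IsReducedPair w u v)
    {k : ℕ} (h : k < w.length) (hp : w[k].pos = true) :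
    vPre w k (topIdx w[k].idx) < vPre w k (botIdx w[k].idx) := by
  refine hw.2.lt_of_eq_append (b := posWord (w.take k)) (c := posWord (w.drop (k + 1))) ?_
  change posWord w = _
  conv_lhs => rw [← List.take_append_drop k w, List.drop_eq_getElem_cons h]
  rw [posWord_append, posWord_cons, if_pos hp]

/-- A negative letter lies in `B_-`, so it keeps the `B_-` cell and lengthens the Weyl element of
the `B_+` cell; a positive letter does the opposite. -/
theorem mul_letterMat_mem_cell {u v : Equiv.Perm (Fin n)} {w : List (Letter n)}
    (hw : IsReducedPair w u v) {k : ℕ} (hk : k < w.length) {x : GL (Fin n) ℂ}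
    (hx : x ∈ cell (uPre w k) (vPre w k)) :
    x * letterMat w[k] ∈ cell (uPre w (k + 1)) (vPre w (k + 1)) := by
  rw [mem_cell_iff] at hx ⊢
  rw [uPre_succ hk, vPre_succ hk, negWord_cons, posWord_cons, letterMat]
  have hlt := topIdx_lt_botIdx w[k].idx
  rcases hp : w[k].pos
  · have h1 : spell (w[k].idx :: negWord []) = simpleReflection w[k].idx := mul_one _
    have h2 : vPre w k * spell (posWord []) = vPre w k := mul_one _
    simp only [Bool.false_eq_true, if_false]
    rw [h1, h2]
    exact ⟨mul_eNeg_mem (uPre_lt hw hk hp) hx.1, mul_mem_bruhatCell hx.2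
      (blockTriangular_transvection (by exact hlt) 1)⟩
  · have h1 : spell (w[k].idx :: posWord []) = simpleReflection w[k].idx := mul_one _
    have h2 : uPre w k * spell (negWord []) = uPre w k := mul_one _
    simp only [if_true]
    rw [h1, h2]
    exact ⟨mul_mem_bruhatCell hx.1 (blockTriangular_transvection (by exact hlt) 1),
      mul_ePos_mem (vPre_lt hw hk hp) hx.2⟩

/-- The product of the factors of the letters of a word. -/
def wordMat (w : List (Letter n)) : GL (Fin n) ℂ := (w.map letterMat).prod

theorem one_mem_cell (w : List (Letter n)) : 1 ∈ cell (uPre w 0) (vPre w 0) :=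
  mem_cell_iff.2 ⟨one_mem_bruhatCell id, one_mem_bruhatCell OrderDual.toDual⟩

theorem wordMat_take_mem_cell {u v : Equiv.Perm (Fin n)} {w : List (Letter n)}
    (hw : IsReducedPair w u v) {k : ℕ} (hk : k ≤ w.length) :
    wordMat (w.take k) ∈ cell (uPre w k) (vPre w k) := by
  induction k with
  | zero => exact one_mem_cell w
  | succ k ih =>
    have := mul_letterMat_mem_cell hw hk (ih (Nat.le_of_succ_le hk))
    rw [wordMat, ← List.take_concat_get' _ _ hk, List.map_append, List.prod_append]
    simpa [wordMat] using this

theorem mul_wordMat_drop_mem_cell {u v : Equiv.Perm (Fin n)} {w : List (Letter n)}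
    (hw : IsReducedPair w u v) {k : ℕ} (hk : k ≤ w.length) {x : GL (Fin n) ℂ}
    (hx : x ∈ cell (uPre w k) (vPre w k)) : x * wordMat (w.drop k) ∈ cell u v := by
  induction hk using Nat.decreasingInduction generalizing x with
  | self =>
    rw [uPre_length hw, vPre, List.take_length, show spell (posWord w) = v from hw.2.1] at hx
    simpa [wordMat] using hx
  | of_succ k hk ih =>
    have := ih (mul_letterMat_mem_cell hw hk hx)
    rw [List.drop_eq_getElem_cons hk, wordMat, List.map_cons, List.prod_cons, ← mul_assoc]
    exact this

theorem IsReducedWord.of_append_right {b c : List (Fin (n - 1))} {w : Equiv.Perm (Fin n)}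
    (h : IsReducedWord (b ++ c) w) : IsReducedWord c (spell c) := by
  refine ⟨rfl, fun c' hc' => ?_⟩
  have := h.2 (b ++ c') (by
    rw [← h.1]
    change spell (b ++ c') = spell (b ++ c)
    rw [spell_append, spell_append]
    exact congrArg _ hc')
  simpa using this

theorem IsReducedPair.drop {u v : Equiv.Perm (Fin n)} {w : List (Letter n)}
    (hw : IsReducedPair w u v) (k : ℕ) :
    IsReducedPair (w.drop k) (spell (negWord (w.drop k))) (vSuf w k) := by
  obtain ⟨h₁, h₂⟩ := hw
  constructor
  · refine IsReducedWord.of_append_right (b := negWord (w.take k)) (w := u) ?_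
    have : negWord (w.take k) ++ negWord (w.drop k) = negWord w := by
      rw [← negWord_append, List.take_append_drop]
    exact this ▸ h₁
  · refine IsReducedWord.of_append_right (b := posWord (w.take k)) (w := v) ?_
    have : posWord (w.take k) ++ posWord (w.drop k) = posWord w := by
      rw [← posWord_append, List.take_append_drop]
    exact this ▸ h₂

theorem wordMat_drop_mem {u v : Equiv.Perm (Fin n)} {w : List (Letter n)}
    (hw : IsReducedPair w u v) (k : ℕ) :
    wordMat (w.drop k) ∈ bruhatCell OrderDual.toDual (vSuf w k) := by
  have := mul_wordMat_drop_mem_cell (hw.drop k) (Nat.zero_le _) (one_mem_cell _)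
  rw [one_mul] at this
  exact (mem_cell_iff.1 this).2

/-! ### Non-vanishing of the minors on the cell -/

theorem sum_eq_sum_castLE {j : ℕ} (hj : j ≤ n) (g : Fin n → ℂ)
    (h : ∀ k : Fin n, j ≤ k.1 → g k = 0) : ∑ k, g k = ∑ s : Fin j, g (Fin.castLE hj s) := by
  symm
  refine Fintype.sum_of_injective (Fin.castLE hj) (Fin.castLE_injective hj) _ _ (fun k hk => ?_)
    fun _ => rfl
  refine h k (not_lt.1 fun hlt => hk ⟨⟨k.1, hlt⟩, rfl⟩)

theorem det_submatrix_ne_zero_of_isUpper {b : GL (Fin n) ℂ} (hb : IsUpper b) {j : ℕ}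
    (ι : Fin j → Fin n) (hι : StrictMono ι) : (b.1.submatrix ι ι).det ≠ 0 := by
  have ht : (b.1.submatrix ι ι).BlockTriangular id := fun s t h => hb _ _ (hι h)
  rw [Matrix.det_of_isUpperTriangular ht, Finset.prod_ne_zero_iff]
  exact fun s _ => hb.apply_ne_zero _

/-- Write `x = b σ b'`. As `b'` is upper triangular, the first `j` columns of `x` involve only the
first `j` columns of `b σ`, which are the columns of `b` indexed by `initSet σ j`. The minor is
thus, up to sign, a principal minor of `b` times a leading minor of `b'`. -/
theorem det_submatrix_initSet_ne_zero {σ : Equiv.Perm (Fin n)} {x : GL (Fin n) ℂ}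
    (hx : x ∈ bruhatCell id σ) {j : ℕ} (hj : j ≤ n) :
    (x.1.submatrix ((initSet σ j).orderEmbOfFin (card_initSet σ hj)) (Fin.castLE hj)).det ≠ 0 := by
  obtain ⟨b, b', hb, hb', rfl⟩ := hx
  set ρ := (initSet σ j).orderEmbOfFin (card_initSet σ hj)
  have hmem : ∀ t : Fin j, ∃ s, ρ s = σ (Fin.castLE hj t) := by
    intro t
    have : σ (Fin.castLE hj t) ∈ Set.range ρ := by
      rw [Finset.range_orderEmbOfFin]
      simp [mem_initSet]
    exact this
  choose π hπ using hmem
  have hπi : Function.Injective π := fun s t h =>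
    Fin.castLE_injective hj (σ.injective (by rw [← hπ, ← hπ, h]))
  let π' := Equiv.ofBijective π (Finite.injective_iff_bijective.1 hπi)
  have : (b * permGL σ * b').1.submatrix ρ (Fin.castLE hj) =
      (b.1.submatrix ρ ρ).submatrix id π' * b'.1.submatrix (Fin.castLE hj) (Fin.castLE hj) := by
    ext s t
    rw [Matrix.submatrix_apply, Units.val_mul, Units.val_mul, permGL_val, Matrix.mul_apply,
      Matrix.mul_apply, sum_eq_sum_castLE hj]
    · refine Finset.sum_congr rfl fun k _ => ?_
      rw [mul_permMat_apply, ← hπ]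
      rfl
    · intro k hk
      have hlt : Fin.castLE hj t < k := by
        rw [Fin.lt_def]; simp only [Fin.val_castLE]; omega
      have hz : b'.1 k (Fin.castLE hj t) = 0 := hb' hlt
      rw [hz, mul_zero]
  rw [this, Matrix.det_mul, Matrix.det_permute']
  refine mul_ne_zero (mul_ne_zero ?_ (det_submatrix_ne_zero_of_isUpper (fun _ _ h => hb h) ρ
    ρ.strictMono)) (det_submatrix_ne_zero_of_isUpper (fun _ _ h => hb' h) _
      (Fin.strictMono_castLE hj))
  exact Int.cast_ne_zero.2 (Units.ne_zero _)

theorem transposeGL_mem_bruhatCell {τ : Equiv.Perm (Fin n)} {x : GL (Fin n) ℂ}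
    (hx : x ∈ bruhatCell OrderDual.toDual τ) : transposeGL x ∈ bruhatCell id τ⁻¹ := by
  obtain ⟨b, b', hb, hb', rfl⟩ := hx
  refine ⟨transposeGL b', transposeGL b, fun _ _ h => hb' h, fun _ _ h => hb h, ?_⟩
  rw [transposeGL_mul, transposeGL_mul, transposeGL_permGL, map_inv, mul_assoc]

/-- For the singular matrix `d = diag (1, …, 1, 0, …, 0)` with `j` ones, the minor is the product of
the two given determinants. By continuity it stays non-zero when the zeros are replaced by a small
`s ≠ 0`. -/
theorem exists_mul_diagHom_mul_det_ne_zero (x y : Matrix (Fin n) (Fin n) ℂ) {j : ℕ} (hj : j ≤ n)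
    (ρ κ : Fin j → Fin n) (hx : (x.submatrix ρ (Fin.castLE hj)).det ≠ 0)
    (hy : (y.submatrix (Fin.castLE hj) κ).det ≠ 0) :
    ∃ d : Fin n → ℂˣ, ((x * (diagHom d).1 * y).submatrix ρ κ).det ≠ 0 := by
  let Φ : ℂ → ℂ := fun s =>
    ((x * Matrix.diagonal (fun k : Fin n => if k.1 < j then 1 else s) * y).submatrix ρ κ).det
  have h0 : Φ 0 ≠ 0 := by
    have : (x * Matrix.diagonal (fun k : Fin n => if k.1 < j then (1 : ℂ) else 0) * y).submatrix ρ κ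
        = x.submatrix ρ (Fin.castLE hj) * y.submatrix (Fin.castLE hj) κ := by
      ext s t
      rw [Matrix.submatrix_apply, Matrix.mul_apply, Matrix.mul_apply, sum_eq_sum_castLE hj]
      · simp [Matrix.mul_diagonal]
      · intro k hk
        simp [Matrix.mul_diagonal, not_lt.2 hk]
    change Matrix.det _ ≠ 0
    rw [this, Matrix.det_mul]
    exact mul_ne_zero hx hy
  have hΦ : Continuous Φ := by
    refine Continuous.matrix_det (Continuous.matrix_submatrix ?_ _ _)
    refine (continuous_const.matrix_mul (Continuous.matrix_diagonal ?_)).matrix_mul continuous_const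
    refine continuous_pi fun k => ?_
    split_ifs
    · exact continuous_const
    · exact continuous_id
  have hev : ∀ᶠ s in nhdsWithin (0 : ℂ) {0}ᶜ, Φ s ≠ 0 :=
    (hΦ.continuousAt.eventually_ne h0).filter_mono nhdsWithin_le_nhds
  obtain ⟨s, hs, hs0⟩ := (hev.and self_mem_nhdsWithin).exists
  refine ⟨fun k => if k.1 < j then 1 else Units.mk0 s hs0, ?_⟩
  have : (diagHom fun k : Fin n => if k.1 < j then 1 else Units.mk0 s hs0).1 =
      Matrix.diagonal fun k : Fin n => if k.1 < j then 1 else s := by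
    rw [diagHom_val]
    congr 1
    ext k
    split_ifs <;> rfl
  rw [this]
  exact hs

/-- Cut the word at the left end of the face and insert a diagonal matrix there. The row set fits
the Bruhat cell of the first part, the column set that of the transpose of the second part. -/
theorem exists_mem_cell_faceMinor_ne_zero {u v : Equiv.Perm (Fin n)} {w : List (Letter n)}
    (hw : IsReducedPair w u v) (f : Face w) : ∃ x ∈ cell u v, faceMinor w x f ≠ 0 := by
  set k := faceTime w f with hk
  have hkl : k ≤ w.length := faceTime_le w f
  have hj : (faceSpacing w f).1 ≤ n := Nat.lt_succ_iff.1 (faceSpacing w f).2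
  have h₁ := wordMat_take_mem_cell hw hkl
  have h₂ := wordMat_drop_mem hw k
  obtain ⟨d, hd⟩ := exists_mul_diagHom_mul_det_ne_zero (wordMat (w.take k)).1
    (wordMat (w.drop k)).1 hj
    ((initSet (uPre w k) (faceSpacing w f)).orderEmbOfFin (card_initSet _ hj))
    ((initSet (vSuf w k)⁻¹ (faceSpacing w f)).orderEmbOfFin (card_initSet _ hj))
    (det_submatrix_initSet_ne_zero (mem_cell_iff.1 h₁).1 hj) (by
      have := det_submatrix_initSet_ne_zero (transposeGL_mem_bruhatCell h₂) hj
      rwa [← Matrix.det_transpose] at this)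
  refine ⟨_, mul_wordMat_drop_mem_cell hw hkl (mul_diagHom_mem_cell h₁ d), ?_⟩
  rw [faceMinor_eq, minorAt, rowSet, colSet, ← hk, minor_eq_colDet _ (card_initSet _ hj) (card_initSet _ hj), colDet,
    ← Matrix.det_transpose]
  exact hd

end DoubleBruhat

namespace DoubleBruhat

variable {n : ℕ}

/-! ### Polynomial triangular factorization -/

section Factor

variable {R S : Type*} [CommRing R] [CommRing S]

/-- The leading submatrix of `A` that ends in the row and column `r`. -/
def leadSub (A : Matrix (Fin n) (Fin n) R) (r : Fin n) : Matrix (Fin (r.1 + 1)) (Fin (r.1 + 1)) R :=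
  A.submatrix (Fin.castLE r.2) (Fin.castLE r.2)

/-- A lower triangular matrix, polynomial in `A`, whose product with `A` is upper triangular. -/
def lowFactor (A : Matrix (Fin n) (Fin n) R) : Matrix (Fin n) (Fin n) R :=
  Matrix.of fun r k =>
    (leadSub A r).cramer (fun s => (1 : Matrix (Fin n) (Fin n) R) (Fin.castLE r.2 s) k) (Fin.last _)

/-- The upper triangular matrix `lowFactor A * A`. -/
def upFactor (A : Matrix (Fin n) (Fin n) R) : Matrix (Fin n) (Fin n) R := lowFactor A * A

theorem lowFactor_map (A : Matrix (Fin n) (Fin n) R) (f : R →+* S) :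
    (lowFactor A).map f = lowFactor (A.map f) := by
  ext r k
  rw [Matrix.map_apply, lowFactor, lowFactor, Matrix.of_apply, Matrix.of_apply,
    Matrix.cramer_apply, Matrix.cramer_apply, RingHom.map_det]
  congr 1
  ext s t
  simp only [RingHom.mapMatrix_apply, Matrix.map_apply, Matrix.updateCol_apply, leadSub,
    Matrix.submatrix_apply, Matrix.one_apply]
  split_ifs <;> simp

theorem upFactor_map (A : Matrix (Fin n) (Fin n) R) (f : R →+* S) :
    (upFactor A).map f = upFactor (A.map f) := by
  rw [upFactor, upFactor, Matrix.map_mul, lowFactor_map]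

theorem lowFactor_apply_eq_zero (A : Matrix (Fin n) (Fin n) R) {r k : Fin n} (h : r < k) :
    lowFactor A r k = 0 := by
  have : (fun s => (1 : Matrix (Fin n) (Fin n) R) (Fin.castLE r.2 s) k) = 0 := by
    ext s
    refine Matrix.one_apply_ne fun e => ?_
    rw [← e, Fin.lt_def, Fin.val_castLE] at h
    omega
  rw [lowFactor, Matrix.of_apply, this, map_zero]
  rfl

/-- By linearity of Cramer's rule in the right-hand side, summing against the column `j` of `A` puts
that column into the last place. Hence the entry has a repeated column for `j < r` and is the
leading minor for `j = r`. No division occurs, so this is valid over polynomial rings. -/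
theorem upFactor_apply (A : Matrix (Fin n) (Fin n) R) (r j : Fin n) :
    upFactor A r j = ((leadSub A r).updateCol (Fin.last _)
      fun s => A (Fin.castLE r.2 s) j).det := by
  have : (fun s => A (Fin.castLE r.2 s) j) = ∑ k, A k j •
      fun s => (1 : Matrix (Fin n) (Fin n) R) (Fin.castLE r.2 s) k := by
    ext s
    simp [Finset.sum_apply, Matrix.one_apply]
  rw [← Matrix.cramer_apply, this, map_sum, Finset.sum_apply, upFactor, Matrix.mul_apply]
  refine Finset.sum_congr rfl fun k _ => ?_
  rw [map_smul, Pi.smul_apply, smul_eq_mul, mul_comm]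
  rfl

theorem upFactor_apply_eq_zero (A : Matrix (Fin n) (Fin n) R) {r j : Fin n} (h : j < r) :
    upFactor A r j = 0 := by
  rw [upFactor_apply]
  have hne : (⟨j.1, Nat.lt_succ_of_lt h⟩ : Fin (r.1 + 1)) ≠ Fin.last _ := by
    rw [Ne, Fin.ext_iff]
    exact (Fin.lt_def.1 h).ne
  refine Matrix.det_zero_of_column_eq hne fun s => ?_
  rw [Matrix.updateCol_ne hne, Matrix.updateCol_self]
  rfl

theorem upFactor_apply_self (A : Matrix (Fin n) (Fin n) R) (r : Fin n) :
    upFactor A r r = (leadSub A r).det := by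
  rw [upFactor_apply]
  congr 1
  exact Matrix.updateCol_eq_self (leadSub A r) (Fin.last _)

end Factor

theorem exists_factor {A : Matrix (Fin n) (Fin n) ℂ} (hA : ∀ r, (leadSub A r).det ≠ 0) :
    ∃ L U : GL (Fin n) ℂ, IsLower L ∧ IsUpper U ∧ U.1 = upFactor A ∧ L.1 * A = U.1 := by
  have ht : (upFactor A).BlockTriangular id := fun _ _ h => upFactor_apply_eq_zero A h
  have hU : (upFactor A).det ≠ 0 := by
    rw [Matrix.det_of_isUpperTriangular ht, Finset.prod_ne_zero_iff]
    intro r _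
    rw [upFactor_apply_self]
    exact hA r
  have hL : (lowFactor A).det ≠ 0 := by
    rw [upFactor, Matrix.det_mul] at hU
    exact left_ne_zero_of_mul hU
  exact ⟨Matrix.GeneralLinearGroup.mkOfDetNeZero _ hL, Matrix.GeneralLinearGroup.mkOfDetNeZero _ hU,
    fun _ _ h => lowFactor_apply_eq_zero A h, fun _ _ h => upFactor_apply_eq_zero A h, rfl, rfl⟩

theorem det_leadSub_mul_ne_zero {c b : GL (Fin n) ℂ} (hc : IsLower c) (hb : IsUpper b)
    (r : Fin n) : (leadSub (c * b).1 r).det ≠ 0 := by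
  have h : leadSub (c * b).1 r = leadSub c.1 r * leadSub b.1 r := by
    ext s t
    rw [leadSub, Matrix.submatrix_apply, Units.val_mul, Matrix.mul_apply, sum_eq_sum_castLE r.2]
    · rfl
    · intro k hk
      rw [hc, zero_mul]
      rw [Fin.lt_def, Fin.val_castLE]
      omega
  have hl : (leadSub c.1 r).BlockTriangular OrderDual.toDual := fun s t h => hc _ _ h
  rw [h, Matrix.det_mul]
  refine mul_ne_zero ?_ (det_submatrix_ne_zero_of_isUpper hb _ (Fin.strictMono_castLE _))
  rw [Matrix.det_of_isLowerTriangular _ hl, Finset.prod_ne_zero_iff]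
  exact fun s _ => hc.apply_ne_zero _

theorem exists_eq_diagHom {d : GL (Fin n) ℂ} (h : IsUpper d) (h' : IsLower d) :
    ∃ e, d = diagHom e := by
  refine ⟨diagUnits d h.apply_ne_zero, ?_⟩
  ext i j
  rw [diagHom_val, Matrix.diagonal_apply]
  split_ifs with hij
  · subst hij; rfl
  · rcases lt_or_gt_of_ne hij with hlt | hlt
    · exact h' i j hlt
    · exact h i j hlt

/-! ### Irreducibility of the cell -/

/-- A polynomial parametrization of the double Bruhat cell. -/
def cellParam {R : Type*} [CommRing R] (u v : Equiv.Perm (Fin n)) (A : Matrix (Fin n) (Fin n) R)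
    (h h' : Fin n → R) : Matrix (Fin n) (Fin n) R :=
  (Matrix.diagonal h * upFactor A).submatrix id u * (upFactor (A.submatrix v u)).adjugate *
    Matrix.diagonal h'

theorem cellParam_map {R S : Type*} [CommRing R] [CommRing S] (u v : Equiv.Perm (Fin n))
    (A : Matrix (Fin n) (Fin n) R) (h h' : Fin n → R) (f : R →+* S) :
    (cellParam u v A h h').map f = cellParam u v (A.map f) (f ∘ h) (f ∘ h') := by
  have hadj : ∀ M : Matrix (Fin n) (Fin n) R, M.adjugate.map f = (M.map f).adjugate := fun M => by
    have := RingHom.map_adjugate f M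
    simpa [RingHom.mapMatrix_apply] using this
  rw [cellParam, cellParam, Matrix.map_mul, Matrix.map_mul, Matrix.diagonal_map (map_zero f),
    hadj, upFactor_map, Matrix.submatrix_map, ← Matrix.submatrix_map, Matrix.map_mul,
    upFactor_map, Matrix.diagonal_map (map_zero f)]
  rfl

/-- The parametrization is defined where this function does not vanish. -/
def paramDenom {R : Type*} [CommRing R] (u v : Equiv.Perm (Fin n)) (A : Matrix (Fin n) (Fin n) R)
    (h h' : Fin n → R) : R :=
  (∏ r, (leadSub A r).det) * (∏ r, (leadSub (A.submatrix v u) r).det) * (∏ i, h i) * ∏ i, h' i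

theorem paramDenom_map {R S : Type*} [CommRing R] [CommRing S] (u v : Equiv.Perm (Fin n))
    (A : Matrix (Fin n) (Fin n) R) (h h' : Fin n → R) (f : R →+* S) :
    f (paramDenom u v A h h') = paramDenom u v (A.map f) (f ∘ h) (f ∘ h') := by
  simp only [paramDenom, map_mul, map_prod, RingHom.map_det, Function.comp_apply]
  rfl

theorem paramDenom_ne_zero_iff {u v : Equiv.Perm (Fin n)} {A : Matrix (Fin n) (Fin n) ℂ}
    {h h' : Fin n → ℂ} : paramDenom u v A h h' ≠ 0 ↔ (∀ r, (leadSub A r).det ≠ 0) ∧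
      (∀ r, (leadSub (A.submatrix v u) r).det ≠ 0) ∧ (∀ i, h i ≠ 0) ∧ ∀ i, h' i ≠ 0 := by
  simp [paramDenom, Finset.prod_eq_zero_iff, and_assoc]

theorem submatrix_perm (u v : Equiv.Perm (Fin n)) (A : Matrix (Fin n) (Fin n) ℂ) :
    A.submatrix v u = permMat v⁻¹ * A * permMat u := by
  ext i j
  rw [mul_permMat_apply, permMat_mul_apply, inv_inv]
  rfl

theorem submatrix_id_perm (u : Equiv.Perm (Fin n)) (A : Matrix (Fin n) (Fin n) ℂ) :
    A.submatrix id u = A * permMat u := by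
  ext i j
  rw [mul_permMat_apply]
  rfl

theorem adjugate_eq (U : GL (Fin n) ℂ) : U.1.adjugate = U.1.det • (U⁻¹).1 := by
  have h : U.1 * U.1.adjugate = U.1.det • 1 := Matrix.mul_adjugate _
  calc U.1.adjugate = (U⁻¹).1 * (U.1 * U.1.adjugate) := by
        rw [← mul_assoc, ← Units.val_mul, inv_mul_cancel, Units.val_one, one_mul]
    _ = _ := by rw [h, Matrix.mul_smul, mul_one]

/-- The adjugate replaces the inverse to keep the parametrization polynomial; the resulting scalar
`det U'` is absorbed into the right diagonal factor. -/
theorem cellParam_eq {u v : Equiv.Perm (Fin n)} {A : Matrix (Fin n) (Fin n) ℂ}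
    {U U' : GL (Fin n) ℂ} (hU : U.1 = upFactor A) (hU' : U'.1 = upFactor (A.submatrix v u))
    (h h' : Fin n → ℂˣ) :
    cellParam u v A (fun i => (h i : ℂ)) (fun i => (h' i : ℂ)) =
      (diagHom h * U * permGL u * U'⁻¹ *
        diagHom fun i => Units.mk0 U'.1.det (det_ne_zero U') * h' i).1 := by
  rw [cellParam, submatrix_id_perm, ← hU, ← hU', adjugate_eq]
  have : (diagHom fun i => Units.mk0 U'.1.det (det_ne_zero U') * h' i).1 =
      U'.1.det • (diagHom h').1 := by
    rw [diagHom_val, diagHom_val, ← Matrix.diagonal_smul]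
    rfl
  simp only [Units.val_mul]
  rw [this, Matrix.mul_smul, Matrix.mul_smul, Matrix.smul_mul]
  rfl

/-- If `x = b u b' = c v c'`, put `A = c⁻¹ b`. Then `v⁻¹ A u = c' b'⁻¹`, so both matrices are lower
times upper, and their triangular factors recover `b` and `b'` up to diagonal matrices. -/
theorem exists_cellParam {u v : Equiv.Perm (Fin n)} {x : GL (Fin n) ℂ} (hx : x ∈ cell u v) :
    ∃ A h h', paramDenom u v A h h' ≠ 0 ∧ x.1 = cellParam u v A h h' := by
  obtain ⟨⟨b, b', hb, hb', e⟩, c, c', hc, hc', e'⟩ := hx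
  have e₁ : x = b * permGL u * b' := Units.ext e
  have e₂ : x = c * permGL v * c' := Units.ext e'
  have hC : (c⁻¹ * b).1.submatrix v u = (c' * b'⁻¹).1 := by
    have : (permGL v)⁻¹ * (c⁻¹ * b) * permGL u = c' * b'⁻¹ := by
      have h1 : b = x * b'⁻¹ * (permGL u)⁻¹ := by rw [e₁]; group
      rw [h1, e₂]
      group
    rw [submatrix_perm, ← this, ← map_inv]
    rfl
  have hA : ∀ r, (leadSub (c⁻¹ * b).1 r).det ≠ 0 := det_leadSub_mul_ne_zero hc.inv hb
  have hA' : ∀ r, (leadSub ((c⁻¹ * b).1.submatrix v u) r).det ≠ 0 := by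
    rw [hC]
    exact det_leadSub_mul_ne_zero hc' hb'.inv
  obtain ⟨L, U, hL, hU, hU₁, hU₂⟩ := exists_factor hA
  obtain ⟨L', U', hL', hU', hU₁', hU₂'⟩ := exists_factor hA'
  have hU₂ : L * (c⁻¹ * b) = U := Units.ext hU₂
  have hU₂' : L' * (c' * b'⁻¹) = U' := Units.ext (by rw [Units.val_mul, ← hC]; exact hU₂')
  -- The same matrix is upper triangular as `b U⁻¹` and lower triangular as `c L⁻¹`, hence diagonal.
  obtain ⟨d, hd⟩ := exists_eq_diagHom (d := b * U⁻¹) (hb.mul hU.inv) (by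
    rw [show b * U⁻¹ = c * L⁻¹ by rw [← hU₂]; group]
    exact hc.mul hL.inv)
  obtain ⟨d', hd'⟩ := exists_eq_diagHom (d := U' * b') (hU'.mul hb') (by
    rw [show U' * b' = L' * c' by rw [← hU₂']; group]
    exact hL'.mul hc')
  refine ⟨(c⁻¹ * b).1, fun i => (d i : ℂ),
    fun i => (((Units.mk0 U'.1.det (det_ne_zero U'))⁻¹ * d' i : ℂˣ) : ℂ), ?_, ?_⟩
  · exact paramDenom_ne_zero_iff.2 ⟨hA, hA', fun i => Units.ne_zero _, fun i => Units.ne_zero _⟩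
  · rw [cellParam_eq hU₁ hU₁']
    congr 1
    simp only [mul_inv_cancel_left]
    rw [← hd, ← hd', e₁]
    group

theorem exists_mem_cell_of_paramDenom_ne_zero {u v : Equiv.Perm (Fin n)}
    {A : Matrix (Fin n) (Fin n) ℂ} {h h' : Fin n → ℂ} (hd : paramDenom u v A h h' ≠ 0) :
    ∃ x ∈ cell u v, x.1 = cellParam u v A h h' := by
  obtain ⟨hA, hA', hh, hh'⟩ := paramDenom_ne_zero_iff.1 hd
  obtain ⟨L, U, hL, hU, hU₁, hU₂⟩ := exists_factor hA
  obtain ⟨L', U', hL', hU', hU₁', hU₂'⟩ := exists_factor hA'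
  let d := diagHom fun i => Units.mk0 _ (hh i)
  let d' := diagHom fun i => Units.mk0 U'.1.det (det_ne_zero U') * Units.mk0 _ (hh' i)
  have key : cellParam u v A h h' = (d * U * permGL u * U'⁻¹ * d').1 :=
    cellParam_eq hU₁ hU₁' (fun i => Units.mk0 _ (hh i)) fun i => Units.mk0 _ (hh' i)
  refine ⟨d * U * permGL u * U'⁻¹ * d', ⟨⟨d * U, U'⁻¹ * d', (isUpper_diagHom _).mul hU,
    hU'.inv.mul (isUpper_diagHom _), ?_⟩, d * L, L'⁻¹ * d', (isLower_diagHom _).mul hL,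
    hL'.inv.mul (isLower_diagHom _), ?_⟩, key.symm⟩
  · rw [← permGL_val, ← Units.val_mul, ← Units.val_mul, mul_assoc _ U'⁻¹]
  · rw [← permGL_val, ← Units.val_mul, ← Units.val_mul]
    congr 1
    -- The two factorizations of `A` and `v⁻¹ A u` turn the `B_+` expression of `x` into a `B_-`
    -- expression.
    have hLU : U * permGL u = L * permGL v * L'⁻¹ * U' := by
      have h1 : (permGL v * L'⁻¹ * U').1 = A * permMat u := by
        have h2 : (L'⁻¹ * U').1 = A.submatrix v u := by
          rw [Units.val_mul, ← hU₂', ← mul_assoc, ← Units.val_mul, inv_mul_cancel, Units.val_one,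
            one_mul]
        rw [mul_assoc, Units.val_mul, h2, submatrix_perm, permGL_val, ← mul_assoc, ← mul_assoc,
          ← permMat_mul, mul_inv_cancel, permMat_one, one_mul]
      apply Units.ext
      rw [mul_assoc L, mul_assoc L, Units.val_mul, Units.val_mul, h1, ← hU₂, permGL_val, mul_assoc]
    rw [mul_assoc _ U, hLU]
    group

/-- The double Bruhat cell is irreducible. -/
theorem cell_irreducible {u v : Equiv.Perm (Fin n)} {P Q : MvPolynomial (Fin n × Fin n) ℂ}
    (h : ∀ x ∈ cell u v, MvPolynomial.eval (fun ij => x.1 ij.1 ij.2) P *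
      MvPolynomial.eval (fun ij => x.1 ij.1 ij.2) Q = 0) :
    (∀ x ∈ cell u v, MvPolynomial.eval (fun ij => x.1 ij.1 ij.2) P = 0) ∨
      ∀ x ∈ cell u v, MvPolynomial.eval (fun ij => x.1 ij.1 ij.2) Q = 0 := by
  by_contra! hcon
  obtain ⟨⟨x₀, hx₀, hP⟩, x₁, hx₁, hQ⟩ := hcon
  obtain ⟨A₀, h₀, h₀', hd₀, e₀⟩ := exists_cellParam hx₀
  obtain ⟨A₁, h₁, h₁', hd₁, e₁⟩ := exists_cellParam hx₁
  -- Join the parameters of the two points by a line. Along it everything is a polynomial in one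
  -- variable, and `ℂ[t]` is a domain.
  let line : ℂ → ℂ → Polynomial ℂ := fun y z => Polynomial.C y + Polynomial.X * Polynomial.C (z - y)
  have hl0 : ∀ y z, (line y z).eval 0 = y := fun y z => by simp [line]
  have hl1 : ∀ y z, (line y z).eval 1 = z := fun y z => by simp [line]
  let A : Matrix (Fin n) (Fin n) (Polynomial ℂ) := Matrix.of fun i j => line (A₀ i j) (A₁ i j)
  let k : Fin n → Polynomial ℂ := fun i => line (h₀ i) (h₁ i)
  let k' : Fin n → Polynomial ℂ := fun i => line (h₀' i) (h₁' i)
  let M := cellParam u v A k k'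
  let D := paramDenom u v A k k'
  have hM : ∀ t, M.map (Polynomial.evalRingHom t) = cellParam u v
      (A.map (Polynomial.evalRingHom t)) (Polynomial.evalRingHom t ∘ k)
        (Polynomial.evalRingHom t ∘ k') := fun t => cellParam_map u v A k k' _
  have hD : ∀ t, D.eval t = paramDenom u v
      (A.map (Polynomial.evalRingHom t)) (Polynomial.evalRingHom t ∘ k)
        (Polynomial.evalRingHom t ∘ k') := fun t => paramDenom_map u v A k k' (Polynomial.evalRingHom t)
  have hA0 : A.map (Polynomial.evalRingHom 0) = A₀ := by ext i j; exact hl0 _ _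
  have hk0 : Polynomial.evalRingHom 0 ∘ k = h₀ := by ext i; exact hl0 _ _
  have hk0' : Polynomial.evalRingHom 0 ∘ k' = h₀' := by ext i; exact hl0 _ _
  have hA1 : A.map (Polynomial.evalRingHom 1) = A₁ := by ext i j; exact hl1 _ _
  have hk1 : Polynomial.evalRingHom 1 ∘ k = h₁ := by ext i; exact hl1 _ _
  have hk1' : Polynomial.evalRingHom 1 ∘ k' = h₁' := by ext i; exact hl1 _ _
  let pull : MvPolynomial (Fin n × Fin n) ℂ → Polynomial ℂ :=
    fun F => MvPolynomial.aeval (fun ij => M ij.1 ij.2) F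
  have hpull : ∀ F t, (pull F).eval t =
      MvPolynomial.eval (fun ij : Fin n × Fin n => M.map (Polynomial.evalRingHom t) ij.1 ij.2) F := by
    intro F t
    have : (Polynomial.aeval t).comp (MvPolynomial.aeval fun ij : Fin n × Fin n => M ij.1 ij.2) =
        MvPolynomial.aeval (R := ℂ)
          (fun ij : Fin n × Fin n => M.map (Polynomial.evalRingHom t) ij.1 ij.2) := by
      ext ij
      simp
    have h2 := congrArg (fun φ => φ F) this
    simpa [pull, MvPolynomial.aeval_eq_eval] using h2
  -- At each `t` either the denominator vanishes or the parameters give a point of the cell, where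
  -- `P Q = 0`. None of the three factors is zero: `P` and `D` are non-zero at `t = 0`, and `Q` at
  -- `t = 1`.
  have hzero : pull P * pull Q * D = 0 := by
    refine Polynomial.funext fun t => ?_
    rw [Polynomial.eval_mul, Polynomial.eval_mul, Polynomial.eval_zero, hpull, hpull, hD, hM]
    by_cases hdt : paramDenom u v (A.map (Polynomial.evalRingHom t))
        (Polynomial.evalRingHom t ∘ k) (Polynomial.evalRingHom t ∘ k') = 0
    · rw [hdt, mul_zero]
    · obtain ⟨x, hx, hxe⟩ := exists_mem_cell_of_paramDenom_ne_zero hdt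
      rw [← hxe, h x hx, zero_mul]
  rcases mul_eq_zero.1 hzero with hzero | hzero
  · rcases mul_eq_zero.1 hzero with hzero | hzero
    · apply hP
      rw [e₀, ← hA0, ← hk0, ← hk0', ← hM, ← hpull, hzero, Polynomial.eval_zero]
    · apply hQ
      rw [e₁, ← hA1, ← hk1, ← hk1', ← hM, ← hpull, hzero, Polynomial.eval_zero]
  · apply hd₀
    rw [← hA0, ← hk0, ← hk0', ← hD, hzero, Polynomial.eval_zero]

/-! ### Genericity -/

/-- Minors as polynomials in the entries. -/
def minorPoly (I J : Finset (Fin n)) : MvPolynomial (Fin n × Fin n) ℂ :=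
  if h : J.card = I.card then
    (Matrix.of fun s t => MvPolynomial.X (I.orderEmbOfFin rfl s, J.orderEmbOfFin h t)).det
  else 0

theorem eval_minorPoly (x : GL (Fin n) ℂ) (I J : Finset (Fin n)) :
    MvPolynomial.eval (fun ij => x.1 ij.1 ij.2) (minorPoly I J) = minor x I J := by
  rw [minorPoly, minor]
  split_ifs
  · rw [RingHom.map_det]
    congr 1
    ext s t
    simp
  · exact map_zero _

/-- If `P` vanishes where no `A_f` does, then `P ∏ A_f` vanishes on the whole cell. By
irreducibility `P` vanishes there, since otherwise some single `A_f` would vanish identically. -/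
theorem generically_of_faceMinor_ne_zero {u v : Equiv.Perm (Fin n)} {w : List (Letter n)}
    (hw : IsReducedPair w u v) {p : GL (Fin n) ℂ → Prop}
    (hp : ∀ x, (∀ f, faceMinor w x f ≠ 0) → p x) : Generically (cell u v) p := by
  have heval : ∀ (s : Finset (Face w)) (x : GL (Fin n) ℂ),
      MvPolynomial.eval (fun ij => x.1 ij.1 ij.2) (∏ f ∈ s, minorPoly (faceI w f) (faceJ w f)) =
        ∏ f ∈ s, faceMinor w x f := by
    intro s x
    rw [map_prod]
    exact Finset.prod_congr rfl fun f _ => eval_minorPoly _ _ _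
  refine ⟨{x | ∀ f, faceMinor w x f ≠ 0},
    ⟨{∏ f, minorPoly (faceI w f) (faceJ w f)}, ?_⟩, ?_, fun x hx => hp x hx.2⟩
  · ext x
    simp only [Set.mem_compl_iff, Set.mem_ofPred_eq, Set.mem_singleton_iff, forall_eq, heval,
      Finset.prod_eq_zero_iff, Finset.mem_univ, true_and]
    push Not
    rfl
  · rintro Z ⟨I, rfl⟩ hZ x hx P hP
    have h : ∀ y ∈ cell u v, MvPolynomial.eval (fun ij => y.1 ij.1 ij.2) P *
        MvPolynomial.eval (fun ij => y.1 ij.1 ij.2)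
          (∏ f, minorPoly (faceI w f) (faceJ w f)) = 0 := by
      intro y hy
      rw [heval]
      by_cases hy' : ∀ f, faceMinor w y f ≠ 0
      · rw [hZ ⟨hy, hy'⟩ P hP, zero_mul]
      · push Not at hy'
        obtain ⟨f, hf⟩ := hy'
        rw [Finset.prod_eq_zero (Finset.mem_univ f) hf, mul_zero]
    refine (cell_irreducible h).resolve_right ?_ x hx
    -- Irreducibility splits off one factor at a time; the empty product is `1`, and `x` witnesses
    -- that the cell is non-empty.
    have : ∀ s : Finset (Face w), ¬ ∀ y ∈ cell u v, MvPolynomial.eval (fun ij => y.1 ij.1 ij.2)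
        (∏ f ∈ s, minorPoly (faceI w f) (faceJ w f)) = 0 := by
      intro s
      induction s using Finset.cons_induction with
      | empty =>
        intro h0
        simpa using h0 x hx
      | cons f s hf ih =>
        intro h0
        rw [Finset.prod_cons] at h0
        simp only [map_mul] at h0
        rcases cell_irreducible h0 with h1 | h1
        · obtain ⟨y, hy, hy'⟩ := exists_mem_cell_faceMinor_ne_zero hw f
          exact hy' (by rw [faceMinor, ← eval_minorPoly]; exact h1 y hy)
        · exact ih h1
    exact this _

end DoubleBruhat

end

theorem corollary3p5 {n : ℕ} (u v : Equiv.Perm (Fin n))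
    (w : List (DoubleBruhat.Letter n)) (hw : DoubleBruhat.IsReducedPair w u v)
    (ru rv : List (Fin (n - 1))) (hru : DoubleBruhat.IsReducedWord ru u)
    (hrv : DoubleBruhat.IsReducedWord rv v⁻¹)
    {V : Type*} [AddCommGroup V] [Module ℂ V] (a : Module.Basis (Fin n) ℂ V) :
    DoubleBruhat.Generically (DoubleBruhat.cell u v) fun x =>
      ∃ hx : ∀ f, DoubleBruhat.faceMinor w x f ≠ 0,
        DoubleBruhat.IsBasis (DoubleBruhat.xi w a x) ∧
        DoubleBruhat.IsBasis (DoubleBruhat.eta w a x) ∧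
        (∀ g : GL (Fin n) ℂ,
          DoubleBruhat.TakesTo g (DoubleBruhat.xi w a x) (DoubleBruhat.eta w a x) ↔
            g = DoubleBruhat.chiMap w (DoubleBruhat.pMap w (DoubleBruhat.psiMap w x hx))) ∧
        ∃ m₁ h₁ p₁ m₂ h₂ p₂ : GL (Fin n) ℂ,
          DoubleBruhat.IsGaussian ((DoubleBruhat.wordLift ru)⁻¹ * x) m₁ h₁ p₁ ∧
          DoubleBruhat.IsGaussian (x * DoubleBruhat.wordLift rv) m₂ h₂ p₂ ∧
          ∃ D D' : Fin n → ℂˣ,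
            (DoubleBruhat.chiMap w (DoubleBruhat.pMap w (DoubleBruhat.psiMap w x hx))).1 =
              Matrix.diagonal (fun i => (D i : ℂ)) *
                (m₁⁻¹ * (DoubleBruhat.wordLift ru)⁻¹ * x * DoubleBruhat.wordLift rv *
                  p₂⁻¹).1.transpose *
                Matrix.diagonal (fun i => (D' i : ℂ)) :=
  DoubleBruhat.generically_of_faceMinor_ne_zero hw fun x hx =>
    ⟨hx, DoubleBruhat.conclusion_of_faceMinor_ne_zero a x hw hru hrv hx⟩
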